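/- Let $n\ge 1$ and let $\mathbb{R}^{2,n+2}$ be $\mathbb{R}^{n+4}$ with basis $p_1,p_2,e_1,\dots,e_n,q_1,q_2$ and the symmetric bilinear form $\eta$ of signature $(2,n+2)$ whose only nonzero values on basis vectors are $\eta(p_1,q_1)=\eta(q_1,p_1)=\eta(p_2,q_2)=\eta(q_2,p_2)=1$ and $\eta(e_i,e_i)=1$. For a Lie subalgebra $\mathfrak{h}\subset\mathfrak{so}(n)$ define the Lie algebra $$\mathfrak{g}^{\mathfrak{h}}=\left\{\begin{pmatrix}0&0&-X^t&0&-c\\0&0&-Y^t&c&0\\0&0&A&X&Y\\0&0&0&0&0\\0&0&0&0&0\end{pmatrix}\ :\ A\in\mathfrak{h},\ X,Y\in\mathbb{R}^n,\ c\in\mathbb{R}\right\},$$ a subalgebra of the stabilizer of the isotropic plane $\mathrm{span}\{p_1,p_2\}$ in $\mathfrak{so}(2,n+2)=\mathfrak{so}(\eta)$. **Theorem.** (1) Let $n\ge1$, let $\mathfrak{h}\subset\mathfrak{so}(n)$ be an arbitrary Lie subalgebra and let $A_1,\dots,A_N$ be any basis of the vector space $\mathfrak{h}$. On $\mathbb{R}^{n+4}$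 with coordinates $x^1,\dots,x^{n+4}$ put $$g=2\,dx^1dx^{n+3}+2\,dx^2dx^{n+4}+\sum_{i=3}^{n+2}(dx^i)^2+2\sum_{i=3}^{n+2}u^i\,dx^i\,dx^{n+4}+f\,(dx^{n+3})^2+f\,(dx^{n+4})^2,$$ $$u^i=\sum_{\alpha=1}^{N}\sum_{j=3}^{n+2}(A_\alpha)_{i-2,\,j-2}\;x^j\,(x^{n+3})^\alpha,\qquad f=\sum_{i=3}^{n+2}(x^i)^2 ,$$ where $(x^{n+3})^\alpha$ is the $\alpha$-th power of $x^{n+3}$. Then $g$ is a pseudo-Riemannian metric of signature $(2,n+2)$ (two negative and $n+2$ positive directions), and its holonomy algebra at the origin (the Lie algebra of the group of parallel transports of the Levi-Civita connection along piecewise smooth loops at $0$), written in matrices with respect to $\partial_{x^1},\dots,\partial_{x^{n+4}}$, which correspond to $p_1,p_2,e_1,\dots,e_n,q_1,q_2$, is exactly $\mathfrak{g}^{\mathfrak{h}}$. (2) The subalgebra $\mathfrak{h}$ need not be a Riemannian holonomy algebra: there are $n\ge1$ and a Lie subalgebra $\mathfrak{h}\subset\mathfrak{so}(n)$ such that, for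 every connected (Hausdorff, second countable) smooth Riemannian manifold $M$ of dimension $n$, every point $p\in M$ and every orthonormal basis of $T_pM$, the holonomy algebra of $M$ at $p$, written in matrices with respect to that basis, is different from $\mathfrak{h}$. -/

import Mathlib

open Matrix Manifold Bundle
open scoped ContDiff

attribute [local instance 100] LieRing.ofAssociativeRing

noncomputable section

/-! ## Pseudo-Riemannian metrics, parallel transport and holonomy -/

section Holonomy

/-- A smooth pseudo-Riemannian metric on a smooth manifold `M` modelled on `E`: a smooth field of
symmetric nondegenerate bilinear forms on the tangent spaces. -/
structure PseudoRiemannianMetric (E : Type*) [NormedAddCommGroup E] [NormedSpace ℝ E]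
    (M : Type*) [TopologicalSpace M] [ChartedSpace E M] [IsManifold 𝓘(ℝ, E) ∞ M] where
  /-- The bilinear form on the tangent space at a point. -/
  val (x : M) : TangentSpace 𝓘(ℝ, E) x →L[ℝ] TangentSpace 𝓘(ℝ, E) x →L[ℝ] ℝ
  symm (x : M) (v w : TangentSpace 𝓘(ℝ, E) x) : val x v w = val x w v
  nondegenerate (x : M) (v : TangentSpace 𝓘(ℝ, E) x) (hv : ∀ w, val x v w = 0) : v = 0
  contMDiff : ContMDiff 𝓘(ℝ, E) (𝓘(ℝ, E).prod 𝓘(ℝ, E →L[ℝ] E →L[ℝ] ℝ)) ∞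
    (fun x ↦ TotalSpace.mk' (E →L[ℝ] E →L[ℝ] ℝ)
      (E := fun x : M ↦ TangentSpace 𝓘(ℝ, E) x →L[ℝ] TangentSpace 𝓘(ℝ, E) x →L[ℝ] ℝ) x (val x))

namespace PseudoRiemannianMetric

variable {E : Type*} [NormedAddCommGroup E] [NormedSpace ℝ E]
  {M : Type*} [TopologicalSpace M] [ChartedSpace E M] [IsManifold 𝓘(ℝ, E) ∞ M]

/-- The metric has signature `(r, s)`: every tangent space has an orthogonal basis of `r` vectors
of square `-1` and `s` vectors of square `1`. -/
def HasSignature (g : PseudoRiemannianMetric E M) (r s : ℕ) : Prop :=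
  ∀ x : M, ∃ b : Module.Basis (Fin r ⊕ Fin s) ℝ (TangentSpace 𝓘(ℝ, E) x),
    ∀ i j, g.val x (b i) (b j) = if i = j then Sum.elim (fun _ ↦ -1) (fun _ ↦ 1) i else 0

/-- The metric is Riemannian, i.e. positive definite. -/
def IsRiemannian (g : PseudoRiemannianMetric E M) : Prop :=
  ∀ (x : M) (v : TangentSpace 𝓘(ℝ, E) x), v ≠ 0 → 0 < g.val x v v

/-- The metric in the preferred chart at `x`: the pullback of `g` under the inverse of that chart,
a field of bilinear forms on (an open subset of) `E`. -/
def inChart (g : PseudoRiemannianMetric E M) (x : M) (y : E) : E →L[ℝ] E →L[ℝ] ℝ :=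
  ContinuousLinearMap.bilinearComp (E := E) (F := E)
    (g.val ((extChartAt 𝓘(ℝ, E) x).symm y))
    (mfderiv 𝓘(ℝ, E) 𝓘(ℝ, E) (extChartAt 𝓘(ℝ, E) x).symm y : E →L[ℝ] E)
    (mfderiv 𝓘(ℝ, E) 𝓘(ℝ, E) (extChartAt 𝓘(ℝ, E) x).symm y : E →L[ℝ] E)

/-- The Christoffel symbol of the first kind at `x`, in the preferred chart at `x`:
`Γ(u, v; w) = (∂_u g(v, w) + ∂_v g(u, w) - ∂_w g(u, v)) / 2`. -/
def christoffel (g : PseudoRiemannianMetric E M) (x : M) (u v w : E) : ℝ :=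
  (fderiv ℝ (g.inChart x) (extChartAt 𝓘(ℝ, E) x x) u v w
    + fderiv ℝ (g.inChart x) (extChartAt 𝓘(ℝ, E) x x) v u w
    - fderiv ℝ (g.inChart x) (extChartAt 𝓘(ℝ, E) x x) w u v) / 2

/-- The vector field `V` along the curve `γ` satisfies `∇_{γ'} V = 0` at time `t`, where `∇` is the
Levi-Civita connection. In the preferred chart at `γ t` the equation is
`V'ᵏ + Γᵏᵢⱼ γ'ⁱ Vʲ = 0`; here it is paired, by means of `g`, with every vector `w`. -/
def IsParallelAt (g : PseudoRiemannianMetric E M) (γ : ℝ → M)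
    (V : (t : ℝ) → TangentSpace 𝓘(ℝ, E) (γ t)) (t : ℝ) : Prop :=
  ∃ γ' V' : E,
    HasDerivAt (fun s ↦ extChartAt 𝓘(ℝ, E) (γ t) (γ s)) γ' t ∧
    HasDerivAt (fun s ↦ (mfderiv 𝓘(ℝ, E) 𝓘(ℝ, E) (extChartAt 𝓘(ℝ, E) (γ t)) (γ s) (V s) : E))
      V' t ∧
    ∀ w : E, g.inChart (γ t) (extChartAt 𝓘(ℝ, E) (γ t) (γ t)) V' w
      + g.christoffel (γ t) γ'
          (mfderiv 𝓘(ℝ, E) 𝓘(ℝ, E) (extChartAt 𝓘(ℝ, E) (γ t)) (γ t) (V t)) w = 0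

/-- `P` is the parallel transport along the curve `γ` from time `0` to time `1`. -/
def IsTransportAlong (g : PseudoRiemannianMetric E M) (γ : ℝ → M)
    (P : TangentSpace 𝓘(ℝ, E) (γ 0) →L[ℝ] TangentSpace 𝓘(ℝ, E) (γ 1)) : Prop :=
  ∀ v, ∃ V : (t : ℝ) → TangentSpace 𝓘(ℝ, E) (γ t),
    (∀ t, g.IsParallelAt γ V t) ∧ V 0 = v ∧ V 1 = P v

/-- `g.IsTransport p q P`: the map `P : T_p M → T_q M` is the parallel transport along some
piecewise smooth path from `p` to `q`. Such a path is a finite concatenation of smooth curves, each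
parametrized by `[0, 1]`. -/
inductive IsTransport (g : PseudoRiemannianMetric E M) (p : M) :
    (q : M) → (TangentSpace 𝓘(ℝ, E) p →L[ℝ] TangentSpace 𝓘(ℝ, E) q) → Prop
  | refl : IsTransport g p p (ContinuousLinearMap.id ℝ (TangentSpace 𝓘(ℝ, E) p))
  | step (γ : ℝ → M) (hγ : ContMDiff 𝓘(ℝ, ℝ) 𝓘(ℝ, E) ∞ γ)
      (P : TangentSpace 𝓘(ℝ, E) p →L[ℝ] TangentSpace 𝓘(ℝ, E) (γ 0))
      (Q : TangentSpace 𝓘(ℝ, E) (γ 0) →L[ℝ] TangentSpace 𝓘(ℝ, E) (γ 1)) :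
      IsTransport g p (γ 0) P → IsTransportAlong g γ Q → IsTransport g p (γ 1) (Q ∘L P)

/-- The holonomy group at `p`: all parallel transports along piecewise smooth loops at `p`.
(As a type, `T_p M` is the model space `E`.) -/
def holonomyGroup (g : PseudoRiemannianMetric E M) (p : M) : Set (E →L[ℝ] E) :=
  {P | g.IsTransport p p P}

/-- The holonomy algebra at `p`: the Lie algebra of the holonomy group, i.e. the set of the
velocities at the identity of the `C¹` curves that run in the holonomy group. -/
def holonomyAlgebra (g : PseudoRiemannianMetric E M) (p : M) : Set (E →L[ℝ] E) :=
  {A | ∃ c : ℝ → E →L[ℝ] E, ContDiff ℝ 1 c ∧ c 0 = ContinuousLinearMap.id ℝ E ∧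
    (∀ t, c t ∈ g.holonomyGroup p) ∧ HasDerivAt c A 0}

/-- The holonomy algebra at `p` as a set of matrices, with respect to a basis of `T_p M`. -/
def holonomyMatrices {ι : Type*} [Fintype ι] [DecidableEq ι]
    (g : PseudoRiemannianMetric E M) (p : M)
    (b : Module.Basis ι ℝ (TangentSpace 𝓘(ℝ, E) p)) : Set (Matrix ι ι ℝ) :=
  {Z | ∃ A ∈ g.holonomyAlgebra p, Z = LinearMap.toMatrix b b (A : E →ₗ[ℝ] E)}

/-- The basis `b` of `T_p M` is orthonormal. -/
def IsOrthonormalBasis {ι : Type*} [DecidableEq ι] (g : PseudoRiemannianMetric E M) (p : M)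
    (b : Module.Basis ι ℝ (TangentSpace 𝓘(ℝ, E) p)) : Prop :=
  ∀ i j, g.val p (b i) (b j) = if i = j then 1 else 0

theorem trivializationAt_bilinear_model (x y : E)
    (T : TangentSpace 𝓘(ℝ, E) y →L[ℝ] TangentSpace 𝓘(ℝ, E) y →L[ℝ] ℝ) :
    (trivializationAt (E →L[ℝ] E →L[ℝ] ℝ) (fun x : E ↦
      TangentSpace 𝓘(ℝ, E) x →L[ℝ] TangentSpace 𝓘(ℝ, E) x →L[ℝ] ℝ) x ⟨y, T⟩).2 = T := by
  rw [hom_trivializationAt_apply]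
  refine ContinuousLinearMap.ext fun v ↦ ContinuousLinearMap.ext fun w ↦ ?_
  change ContinuousLinearMap.inCoordinates E (TangentSpace 𝓘(ℝ, E)) (E →L[ℝ] ℝ)
    (fun x : E ↦ TangentSpace 𝓘(ℝ, E) x →L[ℝ] Bundle.Trivial E ℝ x) x y x y T v w = T v w
  rw [inCoordinates_apply_eq₂ (by simp [chartAt_self_eq]) (by simp [chartAt_self_eq]) (by simp)]
  have h (v : E) : (trivializationAt E (TangentSpace 𝓘(ℝ, E)) x).symm y v = v := by
    have hs := DFunLike.congr_fun (TangentBundle.symmL_model_space (𝕜 := ℝ) x y) v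
    rw [Trivialization.symmL_apply _ (by simp [chartAt_self_eq])] at hs
    exact hs
  simp only [h]
  simp

/-- A smooth field of symmetric nondegenerate bilinear forms on a vector space, as a
pseudo-Riemannian metric. -/
def ofModelSpace (B : E → E →L[ℝ] E →L[ℝ] ℝ) (hsymm : ∀ x v w, B x v w = B x w v)
    (hnondeg : ∀ x v, (∀ w, B x v w = 0) → v = 0) (hB : ContDiff ℝ ∞ B) :
    PseudoRiemannianMetric E E where
  val x := B x
  symm x v w := hsymm x v w
  nondegenerate x v hv := hnondeg x v hv
  contMDiff := by
    intro x
    refine (contMDiffAt_section (E := fun x : E ↦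
      TangentSpace 𝓘(ℝ, E) x →L[ℝ] TangentSpace 𝓘(ℝ, E) x →L[ℝ] ℝ) x).2 ?_
    refine ContMDiffAt.congr_of_eventuallyEq (hB.contMDiff x) (.of_forall fun y ↦ ?_)
    exact trivializationAt_bilinear_model x y (B y)

end PseudoRiemannianMetric

end Holonomy

/-! ## The Lie algebras -/

section Algebra

/-- The indices of the basis `p₁, p₂, e₁, …, eₙ, q₁, q₂` of `ℝ^{2,n+2}`, and of the coordinates
`x¹, x², x³, …, xⁿ⁺², xⁿ⁺³, xⁿ⁺⁴` of `ℝⁿ⁺⁴`, in this order. -/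
abbrev Idx (n : ℕ) : Type := Fin 2 ⊕ (Fin n ⊕ Fin 2)

/-- The index of `pᵢ`. -/
abbrev Idx.p {n : ℕ} (i : Fin 2) : Idx n := Sum.inl i

/-- The index of `eᵢ`. -/
abbrev Idx.e {n : ℕ} (i : Fin n) : Idx n := Sum.inr (Sum.inl i)

/-- The index of `qᵢ`. -/
abbrev Idx.q {n : ℕ} (i : Fin 2) : Idx n := Sum.inr (Sum.inr i)

/-- The Gram matrix of the form `η` of signature `(2, n + 2)`. -/
def etaMatrix (n : ℕ) : Matrix (Idx n) (Idx n) ℝ :=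
  fromBlocks 0 (fromCols 0 1) (fromRows 0 1) (fromBlocks 1 0 0 0)

/-- The subalgebra of `so(2, n + 2)` that preserves the isotropic plane `span {p₁, p₂}`. -/
def soPlane (n : ℕ) : LieSubalgebra ℝ (Matrix (Idx n) (Idx n) ℝ) where
  carrier := {Z | Z ∈ skewAdjointMatricesLieSubalgebra (etaMatrix n) ∧
    ∀ i j, Z (Sum.inr i) (Idx.p j) = 0}
  add_mem' := by
    rintro a b ⟨ha, ha'⟩ ⟨hb, hb'⟩
    exact ⟨add_mem ha hb, fun i j ↦ by simp [ha', hb']⟩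
  zero_mem' := ⟨zero_mem _, fun i j ↦ rfl⟩
  smul_mem' := by
    rintro c a ⟨ha, ha'⟩
    exact ⟨(skewAdjointMatricesLieSubalgebra (etaMatrix n)).smul_mem c ha,
      fun i j ↦ by simp [ha']⟩
  lie_mem' := by
    rintro a b ⟨ha, ha'⟩ ⟨hb, hb'⟩
    refine ⟨(skewAdjointMatricesLieSubalgebra (etaMatrix n)).lie_mem ha hb, fun i j ↦ ?_⟩
    simp [Ring.lie_def, Matrix.mul_apply, ha', hb']

/-- The block matrix
`(0 0 -Xᵗ 0 -c; 0 0 -Yᵗ c 0; 0 0 A X Y; 0 0 0 0 0; 0 0 0 0 0)`. -/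
def gMatrix {n : ℕ} (A : Matrix (Fin n) (Fin n) ℝ) (X Y : Fin n → ℝ) (c : ℝ) :
    Matrix (Idx n) (Idx n) ℝ :=
  fromBlocks 0 (fromCols (-(of ![X, Y])) !![0, -c; c, 0])
    0 (fromBlocks A (of ![X, Y])ᵀ 0 0)

theorem gMatrix_add {n : ℕ} (A A' : Matrix (Fin n) (Fin n) ℝ) (X Y X' Y' : Fin n → ℝ) (c c' : ℝ) :
    gMatrix A X Y c + gMatrix A' X' Y' c' = gMatrix (A + A') (X + X') (Y + Y') (c + c') := by
  ext (i | i | i) (j | j | j) <;> try fin_cases i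
  all_goals try fin_cases j
  all_goals simp [gMatrix] <;> ring

theorem gMatrix_smul {n : ℕ} (r : ℝ) (A : Matrix (Fin n) (Fin n) ℝ) (X Y : Fin n → ℝ) (c : ℝ) :
    r • gMatrix A X Y c = gMatrix (r • A) (r • X) (r • Y) (r * c) := by
  ext (i | i | i) (j | j | j) <;> try fin_cases i
  all_goals try fin_cases j
  all_goals simp [gMatrix]

theorem gMatrix_lie {n : ℕ} {A A' : Matrix (Fin n) (Fin n) ℝ} (hA : Aᵀ = -A) (hA' : A'ᵀ = -A')
    (X Y X' Y' : Fin n → ℝ) (c c' : ℝ) :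
    ⁅gMatrix A X Y c, gMatrix A' X' Y' c'⁆ =
      gMatrix ⁅A, A'⁆ (A *ᵥ X' - A' *ᵥ X) (A *ᵥ Y' - A' *ᵥ Y) (X ⬝ᵥ Y' - X' ⬝ᵥ Y) := by
  have h1 (i j) : A i j = -A j i := by rw [← Matrix.neg_apply, ← hA]; rfl
  have h2 (i j) : A' i j = -A' j i := by rw [← Matrix.neg_apply, ← hA']; rfl
  ext (i | i | i) (j | j | j) <;> try fin_cases i
  all_goals try fin_cases j
  all_goals
    simp [gMatrix, Ring.lie_def, Matrix.mul_apply, Matrix.mulVec, dotProduct,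
      Fintype.sum_sum_type]
  · simp only [h1 _ j, h2 _ j, mul_neg, Finset.sum_neg_distrib, mul_comm]
    ring
  · simp only [h1 _ j, h2 _ j, mul_neg, Finset.sum_neg_distrib, mul_comm]
    ring
  all_goals
    simp only [fun k ↦ mul_comm (X' k), fun k ↦ mul_comm (Y' k)]
    ring

theorem so_transpose {n : ℕ} (A : LieAlgebra.Orthogonal.so (Fin n) ℝ) : A.1ᵀ = -A.1 :=
  (LieAlgebra.Orthogonal.mem_so (Fin n) ℝ A.1).1 A.2

/-- The Lie algebra `𝔤^𝔥`, for a subalgebra `𝔥` of `so(n)`. -/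
def gAlgebra {n : ℕ} (h : LieSubalgebra ℝ (LieAlgebra.Orthogonal.so (Fin n) ℝ)) :
    LieSubalgebra ℝ (Matrix (Idx n) (Idx n) ℝ) where
  carrier := {Z | ∃ A ∈ h, ∃ (X Y : Fin n → ℝ) (c : ℝ), Z = gMatrix A.1 X Y c}
  add_mem' := by
    rintro _ _ ⟨A, hA, X, Y, c, rfl⟩ ⟨A', hA', X', Y', c', rfl⟩
    exact ⟨A + A', h.add_mem hA hA', _, _, _, gMatrix_add _ _ _ _ _ _ _ _⟩
  zero_mem' := ⟨0, h.zero_mem, 0, 0, 0, by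
    simpa using (gMatrix_smul (n := n) 0 0 0 0 0)⟩
  smul_mem' := by
    rintro r _ ⟨A, hA, X, Y, c, rfl⟩
    exact ⟨r • A, h.smul_mem r hA, _, _, _, gMatrix_smul _ _ _ _ _⟩
  lie_mem' := by
    rintro _ _ ⟨A, hA, X, Y, c, rfl⟩ ⟨A', hA', X', Y', c', rfl⟩
    exact ⟨⁅A, A'⁆, h.lie_mem hA hA', _, _, _, gMatrix_lie (so_transpose A) (so_transpose A') _ _ _ _ _ _⟩

theorem gAlgebra_le_soPlane {n : ℕ} (h : LieSubalgebra ℝ (LieAlgebra.Orthogonal.so (Fin n) ℝ)) :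
    gAlgebra h ≤ soPlane n := by
  rintro _ ⟨A, hA, X, Y, c, rfl⟩
  have h1 (i j) : A.1 i j = -A.1 j i := by rw [← Matrix.neg_apply, ← so_transpose]; rfl
  refine ⟨?_, ?_⟩
  · rw [mem_skewAdjointMatricesLieSubalgebra, mem_skewAdjointMatricesSubmodule,
      Matrix.IsSkewAdjoint, Matrix.IsAdjointPair]
    ext (i | i | i) (j | j | j) <;> try fin_cases i
    all_goals try fin_cases j
    all_goals
      simp [gMatrix, etaMatrix, Matrix.mul_apply, Fintype.sum_sum_type, Matrix.one_apply]
    exact h1 _ _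
  · rintro (i | i) j <;> simp [gMatrix]

end Algebra

/-! ## The metric on `ℝⁿ⁺⁴` -/

section Metric

set_option synthInstance.maxHeartbeats 200000

variable {n : ℕ}

/-- The symmetric product `dxᵃ dxᵇ = (dxᵃ ⊗ dxᵇ + dxᵇ ⊗ dxᵃ) / 2` on `ℝⁿ⁺⁴`. -/
def dxdx (a b : Idx n) : (Idx n → ℝ) →L[ℝ] (Idx n → ℝ) →L[ℝ] ℝ :=
  (1 / 2 : ℝ) • ((ContinuousLinearMap.proj (R := ℝ) (φ := fun _ : Idx n ↦ ℝ) a).smulRight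
      (ContinuousLinearMap.proj (R := ℝ) (φ := fun _ : Idx n ↦ ℝ) b)
    + (ContinuousLinearMap.proj (R := ℝ) (φ := fun _ : Idx n ↦ ℝ) b).smulRight
      (ContinuousLinearMap.proj (R := ℝ) (φ := fun _ : Idx n ↦ ℝ) a))

/-- The functions `uⁱ = ∑_{j, α} (A_α)ⁱⱼ xʲ (xⁿ⁺³)^α`, with `α` running from `1` to `N`. -/
def uFun {N : ℕ} (A : Fin N → Matrix (Fin n) (Fin n) ℝ) (i : Fin n) (x : Idx n → ℝ) : ℝ :=
  ∑ α : Fin N, ∑ j : Fin n, A α i j * x (Idx.e j) * x (Idx.q 0) ^ (α.1 + 1)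

/-- The function `f = ∑ᵢ (xⁱ)²`. -/
def fFun (x : Idx n → ℝ) : ℝ := ∑ i : Fin n, x (Idx.e i) ^ 2

/-- The form
`2 dx¹ dxⁿ⁺³ + 2 dx² dxⁿ⁺⁴ + ∑ᵢ (dxⁱ)² + 2 ∑ᵢ uⁱ dxⁱ dxⁿ⁺⁴ + f (dxⁿ⁺³)² + f (dxⁿ⁺⁴)²`
at the point `x` of `ℝⁿ⁺⁴`. -/
def metricForm {N : ℕ} (A : Fin N → Matrix (Fin n) (Fin n) ℝ) (x : Idx n → ℝ) :
    (Idx n → ℝ) →L[ℝ] (Idx n → ℝ) →L[ℝ] ℝ :=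
  (2 : ℝ) • dxdx (Idx.p 0) (Idx.q 0) + (2 : ℝ) • dxdx (Idx.p 1) (Idx.q 1)
    + ∑ i : Fin n, dxdx (Idx.e i) (Idx.e i)
    + (2 : ℝ) • ∑ i : Fin n, uFun A i x • dxdx (Idx.e i) (Idx.q 1)
    + fFun x • dxdx (Idx.q 0) (Idx.q 0) + fFun x • dxdx (Idx.q 1) (Idx.q 1)

theorem dxdx_apply (a b : Idx n) (v w : Idx n → ℝ) :
    dxdx a b v w = (v a * w b + v b * w a) / 2 := by
  simp [dxdx]; ring

theorem metricForm_apply {N : ℕ} (A : Fin N → Matrix (Fin n) (Fin n) ℝ) (x v w : Idx n → ℝ) :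
    metricForm A x v w =
      (v (Idx.p 0) * w (Idx.q 0) + v (Idx.q 0) * w (Idx.p 0))
      + (v (Idx.p 1) * w (Idx.q 1) + v (Idx.q 1) * w (Idx.p 1))
      + ∑ i : Fin n, v (Idx.e i) * w (Idx.e i)
      + ∑ i : Fin n, uFun A i x * (v (Idx.e i) * w (Idx.q 1) + v (Idx.q 1) * w (Idx.e i))
      + fFun x * (v (Idx.q 0) * w (Idx.q 0)) + fFun x * (v (Idx.q 1) * w (Idx.q 1)) := by
  have h (a b : ℝ) : (a * b + a * b) / 2 = a * b := by ring
  simp only [metricForm, _root_.add_apply, _root_.smul_apply, _root_.sum_apply, dxdx_apply, smul_eq_mul, h, Finset.mul_sum]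
  congr 3
  · ring_nf
  · exact Finset.sum_congr rfl fun i _ ↦ by ring

theorem metricForm_symm {N : ℕ} (A : Fin N → Matrix (Fin n) (Fin n) ℝ) (x v w : Idx n → ℝ) :
    metricForm A x v w = metricForm A x w v := by
  simp only [metricForm_apply, mul_comm, add_comm]

theorem metricForm_nondegenerate {N : ℕ} (A : Fin N → Matrix (Fin n) (Fin n) ℝ)
    (x v : Idx n → ℝ) (hv : ∀ w, metricForm A x v w = 0) : v = 0 := by
  have hq0 := hv (Pi.single (Idx.p 0) 1)
  have hq1 := hv (Pi.single (Idx.p 1) 1)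
  have he i := hv (Pi.single (Idx.e i) 1)
  have hp0 := hv (Pi.single (Idx.q 0) 1)
  have hp1 := hv (Pi.single (Idx.q 1) 1)
  simp [metricForm_apply] at hq0 hq1
  simp [metricForm_apply, Pi.single_apply, hq0, hq1] at he
  simp [metricForm_apply, hq0, hq1, he] at hp0 hp1
  ext (i | i | i)
  · fin_cases i <;> simp [*]
  · simp [he]
  · fin_cases i <;> simp [*]

theorem metricForm_contDiff {N : ℕ} (A : Fin N → Matrix (Fin n) (Fin n) ℝ) :
    ContDiff ℝ ∞ (metricForm A) := by
  have h1 (i) : ContDiff ℝ ∞ (uFun A i) := by unfold uFun; fun_prop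
  have h2 : ContDiff ℝ ∞ (fFun (n := n)) := by unfold fFun; fun_prop
  refine contDiff_clm_apply_iff.2 fun v ↦ contDiff_clm_apply_iff.2 fun w ↦ ?_
  simp only [metricForm_apply]
  fun_prop

/-- The form above as a pseudo-Riemannian metric on the manifold `ℝⁿ⁺⁴`. -/
def polynomialMetric {N : ℕ} (A : Fin N → Matrix (Fin n) (Fin n) ℝ) :
    PseudoRiemannianMetric (Idx n → ℝ) (Idx n → ℝ) :=
  .ofModelSpace (metricForm A) (metricForm_symm A) (metricForm_nondegenerate A)
    (metricForm_contDiff A)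

end Metric

end

/-!
# Holonomy algebras of metrics of signature `(2, n + 2)`

The metric has the holonomy algebra `𝔤^𝔥` at the origin for the following reasons. Write
`u = a(xⁿ⁺³) x` with the polynomial `a(t) = ∑ A_α t^α` with values in `𝔥`.

*Lower bound.* The values of the curvature are velocities of transports around small parallelograms,
so they belong to the holonomy algebra (`curv_mem_holonomySubmodule`), as do their commutators
(`commutator_mem`). On the axis `xⁿ⁺³ = t`, where all the other coordinates vanish, constant fields are
parallel, and the curvature operators are explicit (`curv_axis_q_q`, `curv_axis_e_q_zero`,
`curv_axis_e_q_one`): they contain the block `a'(t)`, whose coefficients span `𝔥`, and the operators of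
`𝔤^𝔥` with `X = -k`, `Y = -a'(t) k / 2` and with `X = a'(t) k / 2`, `Y = -(k + a(t)² k)`. Their
combinations give all `X` and `Y`, because a vector orthogonal to what they give would make a polynomial
bounded (`gMatrix_Y_mem`). Commutators give `c`.

*Upper bound.* The fields `p₁, p₂` are parallel, and modulo them the transports act on `e₁, …, eₙ` by
solutions of `U' = ξ U` with `ξ` a curve in `𝔥` (`transportAlong_ePart`). Hence a curve in the holonomy
group induces a curve in the group generated by such solutions, and its velocity must be shown to
belong to `𝔥`. This group need not be closed in `SO(n)`, so the closed subgroup theorem does not apply.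
Instead, the part `m` of the velocity that is orthogonal to `𝔥` commutes with `𝔥`, since the group
normalizes `𝔥`; the group then preserves the eigenspaces of `i m`, and with the determinants `D_μ` on
them the function `∑ μ log D_μ` has countably many values along the curve, hence is constant, while its
derivative is `i tr (m²)` (`MatrixEvolution.mem_of_hasDerivAt`).

For the second claim, let `𝔥` be the line in `so(4)` spanned by a complex structure `J`. If it were a
Riemannian holonomy algebra, all curvature operators would be multiples of a parallel transport of `J`,
and the first Bianchi identity in dimension at least three makes them vanish
(`isFlat_of_holonomy_complexStructure`). A flat metric has parallel local frames, whose transition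
functions are locally constant. With countably many frames this makes the holonomy group countable, so
every curve in it is constant and the holonomy algebra is zero
(`IsFlat.eq_zero_of_mem_holonomyAlgebra`).
-/

set_option synthInstance.maxHeartbeats 200000

/-! ### Linear ordinary differential equations -/

namespace LinearODE

open MeasureTheory Set Filter Topology intervalIntegral

section Existence

variable {F : Type*} [NormedAddCommGroup F] [NormedSpace ℝ F]

/-- The terms of the Peano–Baker series of `X' = L X`, `X 0 = x₀`. -/
noncomputable def seriesTerm (L : ℝ → F →L[ℝ] F) (x₀ : F) : ℕ → ℝ → F
  | 0 => fun _ ↦ x₀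
  | n + 1 => fun t ↦ ∫ s in (0 : ℝ)..t, L s (seriesTerm L x₀ n s)

variable {L : ℝ → F →L[ℝ] F} {x₀ : F}

theorem continuous_seriesTerm (hL : Continuous L) (n : ℕ) :
    Continuous (seriesTerm L x₀ n) := by
  induction n with
  | zero => exact continuous_const
  | succ n ih =>
    exact continuous_primitive (fun _ _ ↦ (hL.clm_apply ih).intervalIntegrable _ _) 0

theorem norm_seriesTerm_le {T C : ℝ}
    (hC : ∀ t, |t| ≤ T → ‖L t‖ ≤ C) (n : ℕ) (t : ℝ) (ht : |t| ≤ T) :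
    ‖seriesTerm L x₀ n t‖ ≤ (C * |t|) ^ n / n.factorial * ‖x₀‖ := by
  have hC0 : 0 ≤ C := (norm_nonneg _).trans (hC t ht)
  induction n generalizing t with
  | zero => simp [seriesTerm]
  | succ n ih =>
    calc ‖seriesTerm L x₀ (n + 1) t‖
        ≤ ∫ s in uIoc 0 t, C ^ (n + 1) * |s - 0| ^ n / n.factorial * ‖x₀‖ := by
          rw [seriesTerm, norm_intervalIntegral_eq]
          apply MeasureTheory.norm_integral_le_of_norm_le (Continuous.integrableOn_uIoc (by fun_prop))
          refine (ae_restrict_mem measurableSet_uIoc).mono fun s hs ↦ ?_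
          have hs' : |s| ≤ T := by
            have := uIoc_subset_uIcc hs
            rcases mem_uIcc.1 this with h | h <;> grind
          calc ‖L s (seriesTerm L x₀ n s)‖ ≤ ‖L s‖ * ‖seriesTerm L x₀ n s‖ := (L s).le_opNorm _
            _ ≤ C * ((C * |s|) ^ n / n.factorial * ‖x₀‖) := by
              gcongr
              · exact hC s hs'
              · exact ih s hs'
            _ = _ := by rw [sub_zero]; ring
      _ = (C * |t|) ^ (n + 1) / (n + 1).factorial * ‖x₀‖ := by
          rw [MeasureTheory.integral_mul_const, MeasureTheory.integral_div,
            MeasureTheory.integral_const_mul, integral_pow_abs_sub_uIoc]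
          rw [Nat.factorial_succ, sub_zero]
          push_cast
          rw [mul_pow]
          field_simp

theorem solution_unique (hL : Continuous L) {X Y : ℝ → F}
    (hX : ∀ t, HasDerivAt X (L t (X t)) t) (hY : ∀ t, HasDerivAt Y (L t (Y t)) t)
    {t₀ : ℝ} (h : X t₀ = Y t₀) : X = Y := by
  funext t
  obtain ⟨C, hC⟩ := (isCompact_Icc (a := min t t₀ - 1) (b := max t t₀ + 1)).exists_bound_of_continuousOn
    hL.continuousOn
  refine ODE_solution_unique_of_mem_Ioo (v := fun t x ↦ L t x) (s := fun _ ↦ univ)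
    (K := C.toNNReal) (a := min t t₀ - 1) (b := max t t₀ + 1) (t₀ := t₀) ?_ ?_ ?_ ?_ h ?_
  · intro s hs
    refine ((L s).lipschitz.weaken ?_).lipschitzOnWith
    exact NNReal.le_toNNReal_of_coe_le (hC s ⟨hs.1.le, hs.2.le⟩)
  · exact ⟨by grind, by grind⟩
  · exact fun s _ ↦ ⟨hX s, trivial⟩
  · exact fun s _ ↦ ⟨hY s, trivial⟩
  · exact ⟨by grind, by grind⟩

variable [CompleteSpace F]

/-- Global solvability of a linear equation with continuous coefficients, with the exponential
bound on the solution. -/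
theorem exists_solution (hL : Continuous L) (x₀ : F) :
    ∃ X : ℝ → F, X 0 = x₀ ∧ (∀ t, HasDerivAt X (L t (X t)) t) ∧
      ∀ T C : ℝ, (∀ t, |t| ≤ T → ‖L t‖ ≤ C) → ∀ t, |t| ≤ T →
        ‖X t‖ ≤ Real.exp (C * |t|) * ‖x₀‖ := by
  have hbound : ∀ T : ℝ, ∃ C, ∀ t, |t| ≤ T → ‖L t‖ ≤ C := fun T ↦ by
    obtain ⟨C, hC⟩ := (isCompact_Icc (a := -T) (b := T)).exists_bound_of_continuousOn
      hL.continuousOn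
    exact ⟨C, fun t ht ↦ hC t (abs_le.1 ht)⟩
  have hsum : ∀ t, Summable fun n ↦ seriesTerm L x₀ n t := fun t ↦ by
    obtain ⟨C, hC⟩ := hbound |t|
    exact .of_norm_bounded ((Real.summable_pow_div_factorial (C * |t|)).mul_right ‖x₀‖)
      fun n ↦ norm_seriesTerm_le hC n t le_rfl
  refine ⟨fun t ↦ ∑' n, seriesTerm L x₀ n t, ?_, fun t ↦ ?_, fun T C hC t ht ↦ ?_⟩
  · change ∑' n, seriesTerm L x₀ n 0 = x₀
    rw [tsum_eq_single 0]
    · rfl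
    · rintro (_ | n) hn
      · exact absurd rfl hn
      · simp [seriesTerm]
  · have h1 : ∀ n s, HasDerivAt (seriesTerm L x₀ (n + 1)) (L s (seriesTerm L x₀ n s)) s :=
      fun n s ↦ integral_hasDerivAt_right
        ((hL.clm_apply (continuous_seriesTerm hL n)).intervalIntegrable _ _)
        ((hL.clm_apply (continuous_seriesTerm hL n)).stronglyMeasurableAtFilter _ _)
        (hL.clm_apply (continuous_seriesTerm hL n)).continuousAt
    -- On the ball of radius `|t| + 1` the series of the derivatives is dominated by an exponential series.
    obtain ⟨C, hC⟩ := hbound (|t| + 1)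
    have hC0 : 0 ≤ C := (norm_nonneg _).trans (hC t (by linarith))
    have hu : Summable fun n : ℕ ↦ C * ((C * (|t| + 1)) ^ n / n.factorial * ‖x₀‖) :=
      ((Real.summable_pow_div_factorial (C * (|t| + 1))).mul_right ‖x₀‖).mul_left C
    have hb : ∀ (n : ℕ), ∀ y ∈ Metric.ball (0 : ℝ) (|t| + 1), ‖L y (seriesTerm L x₀ n y)‖ ≤
        C * ((C * (|t| + 1)) ^ n / n.factorial * ‖x₀‖) := by
      intro n y hy
      have hy' : |y| ≤ |t| + 1 := by
        rw [Metric.mem_ball, dist_zero_right, Real.norm_eq_abs] at hy; exact hy.le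
      calc ‖L y (seriesTerm L x₀ n y)‖ ≤ ‖L y‖ * ‖seriesTerm L x₀ n y‖ := (L y).le_opNorm _
        _ ≤ C * ((C * |y|) ^ n / n.factorial * ‖x₀‖) := by
          gcongr
          · exact hC y hy'
          · exact norm_seriesTerm_le hC n y hy'
        _ ≤ _ := by gcongr
    have ht : t ∈ Metric.ball (0 : ℝ) (|t| + 1) := by simp
    have h2 : HasDerivAt (fun s ↦ ∑' n, seriesTerm L x₀ (n + 1) s)
        (∑' n, L t (seriesTerm L x₀ n t)) t :=
      hasDerivAt_tsum_of_isPreconnected (g := fun n ↦ seriesTerm L x₀ (n + 1))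
        (g' := fun n y ↦ L y (seriesTerm L x₀ n y)) hu
        Metric.isOpen_ball (convex_ball _ _).isPreconnected (fun n y _ ↦ h1 n y) hb ht
        ((summable_nat_add_iff 1).2 (hsum t)) ht
    have h3 : (fun s ↦ ∑' n, seriesTerm L x₀ n s) =
        fun s ↦ x₀ + ∑' n, seriesTerm L x₀ (n + 1) s := by
      funext s; rw [(hsum s).tsum_eq_zero_add]; rfl
    have h4 : L t (∑' n, seriesTerm L x₀ n t) = ∑' n, L t (seriesTerm L x₀ n t) :=
      (L t).map_tsum (hsum t)
    change HasDerivAt (fun s ↦ ∑' n, seriesTerm L x₀ n s) (L t (∑' n, seriesTerm L x₀ n t)) t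
    rw [h4, h3]
    exact h2.const_add x₀
  · have h := (Real.summable_pow_div_factorial (C * |t|)).mul_right ‖x₀‖
    refine (tsum_of_norm_bounded h.hasSum
      fun n ↦ norm_seriesTerm_le (L := L) (x₀ := x₀) hC n t ht).trans ?_
    rw [tsum_mul_right, Real.exp_eq_exp_ℝ, NormedSpace.exp_eq_tsum_div]

end Existence

end LinearODE

/-! ### The evolution operator and its dependence on parameters -/

namespace LinearODE

theorem continuous_slice {X Y Z : Type*} [TopologicalSpace X] [TopologicalSpace Y]
    [TopologicalSpace Z] {K : X → Y → Z} (hK : Continuous (Function.uncurry K)) (p : X) :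
    Continuous (K p) :=
  hK.comp (Continuous.prodMk_right p)

theorem exists_eventually_norm_le {T G : Type*} [TopologicalSpace T] [NormedAddCommGroup G]
    {K : T → ℝ → G} (hK : Continuous (Function.uncurry K)) (p : T) (S : ℝ) :
    ∃ C, ∀ᶠ q in nhds p, ∀ r, |r| ≤ S → ‖K q r‖ ≤ C := by
  obtain ⟨C, hC⟩ := (isCompact_Icc (a := -S) (b := S)).exists_bound_of_continuousOn
    (continuous_slice hK p).continuousOn
  refine ⟨C + 1, ?_⟩
  have := (isCompact_Icc (a := -S) (b := S)).eventually_forall_of_forall_eventually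
    (x₀ := p) (P := fun q r ↦ ‖K q r‖ ≤ C + 1) fun r hr ↦ ?_
  · exact this.mono fun q hq r hr ↦ hq r (abs_le.1 hr)
  · have h1 : ‖Function.uncurry K (p, r)‖ < C + 1 := (hC r hr).trans_lt (lt_add_one C)
    exact (hK.norm.continuousAt.eventually_lt continuousAt_const h1).mono fun q hq ↦ hq.le

open MeasureTheory Set Filter Topology intervalIntegral

section Evolution

variable {𝔸 : Type*} [NormedRing 𝔸] [NormedAlgebra ℝ 𝔸] [CompleteSpace 𝔸]

/-- The fundamental solution `U` of `U' = A U` in a Banach algebra, with its inverse `V`, which solves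
`V' = -V A`. -/
theorem exists_evolution {A : ℝ → 𝔸} (hA : Continuous A) :
    ∃ U V : ℝ → 𝔸, U 0 = 1 ∧ V 0 = 1 ∧ (∀ t, HasDerivAt U (A t * U t) t) ∧
      (∀ t, HasDerivAt V (-(V t * A t)) t) ∧ (∀ t, U t * V t = 1) ∧ (∀ t, V t * U t = 1) ∧
      ∀ T C : ℝ, (∀ t, |t| ≤ T → ‖A t‖ ≤ C) → ∀ t, |t| ≤ T →
        ‖U t‖ ≤ Real.exp (C * |t|) * ‖(1 : 𝔸)‖ ∧ ‖V t‖ ≤ Real.exp (C * |t|) * ‖(1 : 𝔸)‖ := by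
  have hL : Continuous fun t ↦ ContinuousLinearMap.mul ℝ 𝔸 (A t) := by fun_prop
  have hR : Continuous fun t ↦ -(ContinuousLinearMap.mul ℝ 𝔸).flip (A t) := by fun_prop
  obtain ⟨U, hU0, hU, hUb⟩ := exists_solution hL (1 : 𝔸)
  obtain ⟨V, hV0, hV, hVb⟩ := exists_solution hR (1 : 𝔸)
  have hU' : ∀ t, HasDerivAt U (A t * U t) t := hU
  have hV' : ∀ t, HasDerivAt V (-(V t * A t)) t := hV
  have hVU : ∀ t, V t * U t = 1 := by
    have h : ∀ t, HasDerivAt (fun t ↦ V t * U t) 0 t := fun t ↦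
      ((hV' t).mul (hU' t)).congr_deriv (by noncomm_ring)
    intro t
    have := is_const_of_deriv_eq_zero (fun t ↦ (h t).differentiableAt) (fun t ↦ (h t).deriv) t 0
    simpa [hU0, hV0] using this
  -- In infinite dimensions `U V = 1` does not follow from `V U = 1`; but `U V` and `1` solve the same
  -- linear equation.
  have hUV : ∀ t, U t * V t = 1 := by
    have hLR : Continuous fun t ↦ ContinuousLinearMap.mul ℝ 𝔸 (A t)
        - (ContinuousLinearMap.mul ℝ 𝔸).flip (A t) := by fun_prop
    have := solution_unique hLR (X := fun t ↦ U t * V t) (Y := fun _ ↦ 1) (t₀ := 0) ?_ ?_ ?_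
    · exact fun t ↦ congrFun this t
    · intro t
      refine ((hU' t).mul (hV' t)).congr_deriv ?_
      change _ = A t * (U t * V t) - U t * V t * A t
      noncomm_ring
    · intro t
      refine (hasDerivAt_const t (1 : 𝔸)).congr_deriv ?_
      change _ = A t * 1 - 1 * A t
      noncomm_ring
    · simp [hU0, hV0]
  refine ⟨U, V, hU0, hV0, hU', hV', hUV, hVU, fun T C hC t ht ↦ ⟨?_, ?_⟩⟩
  · refine hUb T C (fun s hs ↦ ?_) t ht
    exact (ContinuousLinearMap.opNorm_mul_apply_le ℝ 𝔸 _).trans (hC s hs)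
  · refine hVb T C (fun s hs ↦ ?_) t ht
    rw [norm_neg]
    refine (ContinuousLinearMap.opNorm_le_bound _ (norm_nonneg _) fun x ↦ ?_).trans (hC s hs)
    rw [ContinuousLinearMap.flip_apply, ContinuousLinearMap.mul_apply', mul_comm ‖A s‖]
    exact norm_mul_le _ _

open Classical in
/-- The evolution operator of `A`: the solution of `U' = A U`, `U 0 = 1`. (Equal to `1` if `A` is
not continuous.) -/
noncomputable def evol (A : ℝ → 𝔸) : ℝ → 𝔸 :=
  if h : Continuous A then (exists_evolution h).choose else 1

open Classical in
/-- The inverse of the evolution operator of `A`. -/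
noncomputable def evolInv (A : ℝ → 𝔸) : ℝ → 𝔸 :=
  if h : Continuous A then (exists_evolution h).choose_spec.choose else 1

variable {A B : ℝ → 𝔸}

theorem evol_spec (hA : Continuous A) :
    evol A 0 = 1 ∧ evolInv A 0 = 1 ∧ (∀ t, HasDerivAt (evol A) (A t * evol A t) t) ∧
      (∀ t, HasDerivAt (evolInv A) (-(evolInv A t * A t)) t) ∧
      (∀ t, evol A t * evolInv A t = 1) ∧ (∀ t, evolInv A t * evol A t = 1) ∧
      ∀ T C : ℝ, (∀ t, |t| ≤ T → ‖A t‖ ≤ C) → ∀ t, |t| ≤ T →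
        ‖evol A t‖ ≤ Real.exp (C * |t|) * ‖(1 : 𝔸)‖ ∧
        ‖evolInv A t‖ ≤ Real.exp (C * |t|) * ‖(1 : 𝔸)‖ := by
  rw [evol, evolInv, dif_pos hA, dif_pos hA]
  exact (exists_evolution hA).choose_spec.choose_spec

theorem evol_zero (hA : Continuous A) : evol A 0 = 1 := (evol_spec hA).1

theorem evolInv_zero (hA : Continuous A) : evolInv A 0 = 1 := (evol_spec hA).2.1

theorem hasDerivAt_evol (hA : Continuous A) (t : ℝ) :
    HasDerivAt (evol A) (A t * evol A t) t := (evol_spec hA).2.2.1 t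

theorem hasDerivAt_evolInv (hA : Continuous A) (t : ℝ) :
    HasDerivAt (evolInv A) (-(evolInv A t * A t)) t := (evol_spec hA).2.2.2.1 t

theorem evol_mul_evolInv (hA : Continuous A) (t : ℝ) : evol A t * evolInv A t = 1 :=
  (evol_spec hA).2.2.2.2.1 t

theorem evolInv_mul_evol (hA : Continuous A) (t : ℝ) : evolInv A t * evol A t = 1 :=
  (evol_spec hA).2.2.2.2.2.1 t

theorem continuous_evol (hA : Continuous A) : Continuous (evol A) :=
  continuous_iff_continuousAt.2 fun t ↦ (hasDerivAt_evol hA t).continuousAt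

theorem continuous_evolInv (hA : Continuous A) : Continuous (evolInv A) :=
  continuous_iff_continuousAt.2 fun t ↦ (hasDerivAt_evolInv hA t).continuousAt

theorem isUnit_evol (hA : Continuous A) (t : ℝ) : IsUnit (evol A t) :=
  ⟨⟨_, _, evol_mul_evolInv hA t, evolInv_mul_evol hA t⟩, rfl⟩

theorem evolInv_eq_inverse (hA : Continuous A) (t : ℝ) :
    evolInv A t = Ring.inverse (evol A t) := by
  let u : 𝔸ˣ := ⟨_, _, evol_mul_evolInv hA t, evolInv_mul_evol hA t⟩
  exact (Ring.inverse_unit u).symm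

/-- Duhamel's formula, which compares the evolutions of two coefficients. -/
theorem evolInv_mul_evol_eq_integral (hA : Continuous A) (hB : Continuous B) (s : ℝ) :
    evolInv A s * evol B s = 1 + ∫ r in (0 : ℝ)..s, evolInv A r * (B r - A r) * evol B r := by
  have hc : Continuous fun r ↦ evolInv A r * (B r - A r) * evol B r :=
    ((continuous_evolInv hA).mul (hB.sub hA)).mul (continuous_evol hB)
  rw [integral_eq_sub_of_hasDerivAt (f := fun r ↦ evolInv A r * evol B r) ?_
    (hc.intervalIntegrable _ _), evolInv_zero hA, evol_zero hB]
  · simp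
  · intro r _
    refine ((hasDerivAt_evolInv hA r).mul (hasDerivAt_evol hB r)).congr_deriv ?_
    noncomm_ring

section Parameter

variable {T : Type*} [TopologicalSpace T] {K : T → ℝ → 𝔸}

theorem exists_eventually_norm_evol_le (hK : Continuous (Function.uncurry K)) (p : T) (S : ℝ) :
    ∃ C, ∀ᶠ q in 𝓝 p, ∀ r, |r| ≤ S → ‖evol (K q) r‖ ≤ C ∧ ‖evolInv (K q) r‖ ≤ C := by
  obtain ⟨C, hC⟩ := exists_eventually_norm_le hK p S
  refine ⟨Real.exp (|C| * S) * ‖(1 : 𝔸)‖, hC.mono fun q hq r hr ↦ ?_⟩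
  have h := (evol_spec (continuous_slice hK q)).2.2.2.2.2.2 S C hq r hr
  have h2 : Real.exp (C * |r|) * ‖(1 : 𝔸)‖ ≤ Real.exp (|C| * S) * ‖(1 : 𝔸)‖ := by
    gcongr
    exact le_abs_self C
  exact ⟨h.1.trans h2, h.2.trans h2⟩

theorem abs_le_of_mem_uIoc {r s : ℝ} (h : r ∈ uIoc 0 s) : |r| ≤ |s| := by
  rcases mem_uIoc.1 h with h | h <;> grind

variable [FirstCountableTopology T]

/-- Continuous dependence of the evolution on a parameter. -/
theorem continuous_evol_param (hK : Continuous (Function.uncurry K)) (s : ℝ) :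
    Continuous fun p ↦ evol (K p) s := by
  refine continuous_iff_continuousAt.2 fun p ↦ ?_
  have hp := continuous_slice hK p
  obtain ⟨C, hC⟩ := exists_eventually_norm_evol_le hK p |s|
  obtain ⟨D, hD⟩ := exists_eventually_norm_le hK p |s|
  have key : Tendsto (fun q ↦ ∫ r in (0 : ℝ)..s, evolInv (K p) r * (K q r - K p r) * evol (K q) r)
      (𝓝 p) (𝓝 (∫ r in (0 : ℝ)..s, (0 : 𝔸))) := by
    refine tendsto_integral_filter_of_dominated_convergence (fun _ ↦ C * (D + D) * C) ?_ ?_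
      intervalIntegrable_const ?_
    · refine .of_forall fun q ↦ Continuous.aestronglyMeasurable ?_
      exact ((continuous_evolInv hp).mul ((continuous_slice hK q).sub hp)).mul
        (continuous_evol (continuous_slice hK q))
    · filter_upwards [hC, hD] with q hq hq'
      refine .of_forall fun r hr ↦ ?_
      have hr' := abs_le_of_mem_uIoc hr
      have hC0 : 0 ≤ C := (norm_nonneg _).trans (hq r hr').1
      have hD0 : 0 ≤ D := (norm_nonneg _).trans (hq' r hr')
      calc _ ≤ ‖evolInv (K p) r‖ * ‖K q r - K p r‖ * ‖evol (K q) r‖ := norm_mul₃_le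
        _ ≤ _ := by
          gcongr
          · exact (hC.self_of_nhds r hr').2
          · exact (norm_sub_le _ _).trans (add_le_add (hq' r hr') (hD.self_of_nhds r hr'))
          · exact (hq r hr').1
    · refine .of_forall fun r hr ↦ ?_
      have hr' := abs_le_of_mem_uIoc hr
      have h1 : Tendsto (fun q ↦ K q r - K p r) (𝓝 p) (𝓝 0) := by
        have : Continuous fun q ↦ K q r - K p r :=
          (hK.comp (Continuous.prodMk_left r)).sub continuous_const
        simpa using this.tendsto p
      refine squeeze_zero_norm' (a := fun q ↦ C * ‖K q r - K p r‖ * C) ?_ ?_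
      · filter_upwards [hC] with q hq
        have hC0 : 0 ≤ C := (norm_nonneg _).trans (hq r hr').1
        calc _ ≤ ‖evolInv (K p) r‖ * ‖K q r - K p r‖ * ‖evol (K q) r‖ := norm_mul₃_le
          _ ≤ _ := by
            gcongr
            · exact (hC.self_of_nhds r hr').2
            · exact (hq r hr').1
      · simpa using (h1.norm.const_mul C).mul_const C
  -- Duhamel's formula expresses `evol (K q)` by the integral that was just shown to tend to zero.
  have h2 : ∀ q, evol (K q) s = evol (K p) s *
      (1 + ∫ r in (0 : ℝ)..s, evolInv (K p) r * (K q r - K p r) * evol (K q) r) := fun q ↦ by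
    rw [← evolInv_mul_evol_eq_integral hp (continuous_slice hK q), ← mul_assoc,
      evol_mul_evolInv hp, one_mul]
  have h3 := (key.const_add 1).const_mul (evol (K p) s)
  rw [intervalIntegral.integral_zero, add_zero, mul_one] at h3
  refine ContinuousAt.congr ?_ (.of_forall fun q ↦ (h2 q).symm)
  rw [ContinuousAt]
  simpa using h3

theorem continuous_evolInv_param (hK : Continuous (Function.uncurry K)) (s : ℝ) :
    Continuous fun p ↦ evolInv (K p) s := by
  refine continuous_iff_continuousAt.2 fun p ↦ ?_
  simp only [fun p ↦ evolInv_eq_inverse (continuous_slice hK p) s]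
  obtain ⟨u, hu⟩ := isUnit_evol (continuous_slice hK p) s
  have h := NormedRing.inverse_continuousAt u
  rw [hu] at h
  exact ContinuousAt.comp (f := fun p ↦ evol (K p) s) h (continuous_evol_param hK s).continuousAt

end Parameter

section Derivative

variable {K K' : ℝ → ℝ → 𝔸}

/-- The logarithmic derivative of the evolution with respect to a parameter. -/
noncomputable def evolVar (K K' : ℝ → ℝ → 𝔸) (t s : ℝ) : 𝔸 :=
  ∫ r in (0 : ℝ)..s, evolInv (K t) r * K' t r * evol (K t) r

/-- Differentiable dependence of the evolution on a parameter. -/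
theorem hasDerivAt_evol_param (hK : Continuous (Function.uncurry K))
    (hK' : Continuous (Function.uncurry K'))
    (hKK' : ∀ t r, HasDerivAt (fun t ↦ K t r) (K' t r) t) (t s : ℝ) :
    HasDerivAt (fun t ↦ evol (K t) s) (evol (K t) s * evolVar K K' t s) t := by
  have hp := continuous_slice hK t
  obtain ⟨C, hC⟩ := exists_eventually_norm_evol_le hK t |s|
  obtain ⟨D, hD⟩ := exists_eventually_norm_le hK' t |s|
  obtain ⟨ε, hε, hεD⟩ := Metric.eventually_nhds_iff_ball.1 hD
  -- The difference quotients of `K` are dominated by the bound `D` on `K'`.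
  have hLip : ∀ q ∈ Metric.ball t ε, ∀ r, |r| ≤ |s| → ‖K q r - K t r‖ ≤ D * ‖q - t‖ :=
    fun q hq r hr ↦ (convex_ball t ε).norm_image_sub_le_of_norm_hasDerivWithin_le
      (f := fun t ↦ K t r) (fun x _ ↦ (hKK' x r).hasDerivWithinAt) (fun x hx ↦ hεD x hx r hr)
      (Metric.mem_ball_self hε) hq
  rw [hasDerivAt_iff_tendsto_slope]
  have hD0 : 0 ≤ D := (norm_nonneg _).trans (hD.self_of_nhds 0 (by simp))
  have key : Tendsto (fun q ↦ ∫ r in (0 : ℝ)..s,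
      evolInv (K t) r * ((q - t)⁻¹ • (K q r - K t r)) * evol (K q) r)
      (𝓝[≠] t) (𝓝 (evolVar K K' t s)) := by
    refine tendsto_integral_filter_of_dominated_convergence (fun _ ↦ C * D * C) ?_ ?_
      intervalIntegrable_const ?_
    · refine .of_forall fun q ↦ Continuous.aestronglyMeasurable ?_
      exact ((continuous_evolInv hp).mul (((continuous_slice hK q).sub hp).const_smul _)).mul
        (continuous_evol (continuous_slice hK q))
    · filter_upwards [hC.filter_mono nhdsWithin_le_nhds,
        nhdsWithin_le_nhds (Metric.ball_mem_nhds t hε), self_mem_nhdsWithin] with q hq hq' hqt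
      refine .of_forall fun r hr ↦ ?_
      have hr' := abs_le_of_mem_uIoc hr
      have hC0 : 0 ≤ C := (norm_nonneg _).trans (hq r hr').1
      calc _ ≤ ‖evolInv (K t) r‖ * ‖(q - t)⁻¹ • (K q r - K t r)‖ * ‖evol (K q) r‖ :=
            norm_mul₃_le
        _ ≤ _ := by
          gcongr
          · exact (hC.self_of_nhds r hr').2
          · rw [norm_smul, norm_inv, inv_mul_le_iff₀ (norm_pos_iff.2 (sub_ne_zero.2 hqt)), mul_comm]
            exact hLip q hq' r hr'
          · exact (hq r hr').1
    · refine .of_forall fun r _ ↦ ?_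
      have h1 := hasDerivAt_iff_tendsto_slope.1 (hKK' t r)
      have h2 : Tendsto (fun q ↦ evol (K q) r) (𝓝[≠] t) (𝓝 (evol (K t) r)) :=
        ((continuous_evol_param hK r).tendsto t).mono_left nhdsWithin_le_nhds
      exact (h1.const_mul _).mul h2
  refine (key.const_mul (evol (K t) s)).congr' ?_
  filter_upwards [self_mem_nhdsWithin] with q hqt
  have h2 := evolInv_mul_evol_eq_integral hp (continuous_slice hK q) s
  have h3 : evol (K q) s - evol (K t) s = evol (K t) s *
      ∫ r in (0 : ℝ)..s, evolInv (K t) r * (K q r - K t r) * evol (K q) r := by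
    rw [← sub_eq_iff_eq_add'] at h2
    rw [← h2, mul_sub, ← mul_assoc, evol_mul_evolInv hp, one_mul, mul_one]
  rw [slope_def_module, h3, ← mul_smul_comm, ← intervalIntegral.integral_smul]
  simp only [mul_smul_comm, smul_mul_assoc]

theorem continuous_evolVar (hK : Continuous (Function.uncurry K))
    (hK' : Continuous (Function.uncurry K')) (s : ℝ) :
    Continuous fun t ↦ evolVar K K' t s := by
  refine continuous_iff_continuousAt.2 fun t ↦ ?_
  obtain ⟨C, hC⟩ := exists_eventually_norm_evol_le hK t |s|
  obtain ⟨D, hD⟩ := exists_eventually_norm_le hK' t |s|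
  refine tendsto_integral_filter_of_dominated_convergence (fun _ ↦ C * D * C) ?_ ?_
      intervalIntegrable_const ?_
  · refine .of_forall fun q ↦ Continuous.aestronglyMeasurable ?_
    exact ((continuous_evolInv (continuous_slice hK q)).mul (continuous_slice hK' q)).mul
      (continuous_evol (continuous_slice hK q))
  · filter_upwards [hC, hD] with q hq hq'
    refine .of_forall fun r hr ↦ ?_
    have hr' := abs_le_of_mem_uIoc hr
    have hC0 : 0 ≤ C := (norm_nonneg _).trans (hq r hr').1
    have hD0 : 0 ≤ D := (norm_nonneg _).trans (hq' r hr')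
    calc _ ≤ ‖evolInv (K q) r‖ * ‖K' q r‖ * ‖evol (K q) r‖ := norm_mul₃_le
      _ ≤ _ := by
        gcongr
        · exact (hq r hr').2
        · exact hq' r hr'
        · exact (hq r hr').1
  · refine .of_forall fun r _ ↦ ?_
    exact (((continuous_evolInv_param hK r).mul (hK'.comp (Continuous.prodMk_left r))).mul
      (continuous_evol_param hK r)).tendsto t

theorem hasDerivAt_evolVar (hK : Continuous (Function.uncurry K))
    (hK' : Continuous (Function.uncurry K')) (t s : ℝ) :
    HasDerivAt (evolVar K K' t) (evolInv (K t) s * K' t s * evol (K t) s) s := by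
  have hc : Continuous fun r ↦ evolInv (K t) r * K' t r * evol (K t) r :=
    ((continuous_evolInv (continuous_slice hK t)).mul (continuous_slice hK' t)).mul
      (continuous_evol (continuous_slice hK t))
  exact integral_hasDerivAt_right (hc.intervalIntegrable _ _)
    (hc.stronglyMeasurableAtFilter _ _) hc.continuousAt

theorem hasDerivAt_inverse {c : ℝ → 𝔸} {c' : 𝔸} {t : ℝ} (u : 𝔸ˣ) (hu : c t = u)
    (hc : HasDerivAt c c' t) :
    HasDerivAt (fun t ↦ Ring.inverse (c t)) (-(↑u⁻¹ * c' * ↑u⁻¹)) t := by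
  have h := hasFDerivAt_ringInverse (𝕜 := ℝ) u
  rw [← hu] at h
  exact h.comp_hasDerivAt t hc

end Derivative

end Evolution

end LinearODE

/-! ### Pseudo-Riemannian metrics in charts -/

namespace PseudoRiemannianMetric

open Set Filter Topology

section Charts

variable {E : Type*} [NormedAddCommGroup E] [NormedSpace ℝ E]
  {M : Type*} [TopologicalSpace M] [ChartedSpace E M] [IsManifold 𝓘(ℝ, E) ∞ M]
  (g : PseudoRiemannianMetric E M)

/-- The pullback of the metric under a map `ψ : E → M`. -/
noncomputable def pullbackForm (ψ : E → M) (y : E) : E →L[ℝ] E →L[ℝ] ℝ :=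
  ContinuousLinearMap.bilinearComp (E := E) (F := E) (g.val (ψ y))
    (mfderiv 𝓘(ℝ, E) 𝓘(ℝ, E) ψ y : E →L[ℝ] E) (mfderiv 𝓘(ℝ, E) 𝓘(ℝ, E) ψ y : E →L[ℝ] E)

theorem pullbackForm_apply (ψ : E → M) (y v w : E) :
    g.pullbackForm ψ y v w =
      g.val (ψ y) (mfderiv 𝓘(ℝ, E) 𝓘(ℝ, E) ψ y v) (mfderiv 𝓘(ℝ, E) 𝓘(ℝ, E) ψ y w) := rfl

theorem inChart_eq_pullbackForm (x : M) :
    g.inChart x = g.pullbackForm (extChartAt 𝓘(ℝ, E) x).symm := rfl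

/-- The points of `M` on the two sides are only propositionally equal; the vectors are compared in the
model space. -/
theorem val_congr {p q : M} (h : p = q) (v w : E) :
    g.val p (v : TangentSpace 𝓘(ℝ, E) p) (w : TangentSpace 𝓘(ℝ, E) p) =
      g.val q (v : TangentSpace 𝓘(ℝ, E) q) (w : TangentSpace 𝓘(ℝ, E) q) := by
  subst h; rfl

theorem contDiffOn_pullbackForm [FiniteDimensional ℝ E] {ψ : E → M} {s : Set E} (hs : IsOpen s)
    (hψ : ContMDiffOn 𝓘(ℝ, E) 𝓘(ℝ, E) ∞ ψ s) : ContDiffOn ℝ ∞ (g.pullbackForm ψ) s := by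
  -- The tangent map applied to a constant vector field is a smooth section along `ψ`.
  have key : ∀ v : E, ContMDiffOn 𝓘(ℝ, E) (𝓘(ℝ, E).prod 𝓘(ℝ, E)) ∞
      (fun y ↦ TotalSpace.mk' E (E := fun x : M ↦ TangentSpace 𝓘(ℝ, E) x) (ψ y)
        (mfderiv 𝓘(ℝ, E) 𝓘(ℝ, E) ψ y v)) s := by
    intro v
    have h1 := hψ.contMDiffOn_tangentMapWithin (m := ∞) (by simp) hs.uniqueMDiffOn
    have h2 : ContMDiffOn 𝓘(ℝ, E) (𝓘(ℝ, E).prod 𝓘(ℝ, E)) ∞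
        (fun y : E ↦ (TotalSpace.mk' E (E := fun x : E ↦ TangentSpace 𝓘(ℝ, E) x) y v)) s := by
      refine ContMDiff.contMDiffOn ?_
      intro y
      refine (Bundle.contMDiffAt_section y).2 ?_
      have h3 : ∀ z : E, (trivializationAt E (TangentSpace 𝓘(ℝ, E)) y
          (TotalSpace.mk' E (E := fun x : E ↦ TangentSpace 𝓘(ℝ, E) x) z v)).2 = v := fun z ↦ by
        simp
      simp only [h3]
      exact contMDiffAt_const
    refine (h1.comp h2 fun y hy ↦ hy).congr fun y hy ↦ ?_
    simp only [Function.comp_def, tangentMapWithin, mfderivWithin_of_isOpen hs hy]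
  have hv : ∀ v w : E, ContDiffOn ℝ ∞ (fun y ↦ g.pullbackForm ψ y v w) s := by
    intro v w
    rw [← contMDiffOn_iff_contDiffOn]
    have h3 : ContMDiffOn 𝓘(ℝ, E) (𝓘(ℝ, E).prod 𝓘(ℝ, ℝ)) ∞
      (fun y ↦ TotalSpace.mk' ℝ (E := Bundle.Trivial M ℝ) (ψ y) (g.pullbackForm ψ y v w)) s := by
      refine ContMDiffOn.clm_bundle_apply₂ (F₁ := E) (F₂ := E) (F₃ := ℝ)
        (E₁ := fun x : M ↦ TangentSpace 𝓘(ℝ, E) x) (E₂ := fun x : M ↦ TangentSpace 𝓘(ℝ, E) x)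
        (E₃ := Bundle.Trivial M ℝ) (ψ := fun y ↦ g.val (ψ y)) ?_ (key v) (key w)
      exact g.contMDiff.comp_contMDiffOn hψ
    intro y hy
    have h4 := h3 y hy
    simp only [Bundle.contMDiffWithinAt_totalSpace] at h4
    exact h4.2
  exact contDiffOn_clm_apply.2 fun v ↦ contDiffOn_clm_apply.2 fun w ↦ hv v w

theorem contDiffAt_inChart [FiniteDimensional ℝ E] (x : M) :
    ContDiffAt ℝ ∞ (g.inChart x) (extChartAt 𝓘(ℝ, E) x x) := by
  have h := g.contDiffOn_pullbackForm (isOpen_extChartAt_target x)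
    (contMDiffOn_extChartAt_symm (I := 𝓘(ℝ, E)) (n := ∞) x)
  exact h.contDiffAt (extChartAt_target_mem_nhds x)

theorem inChart_symm (x : M) (y v w : E) : g.inChart x y v w = g.inChart x y w v := by
  rw [inChart_eq_pullbackForm, pullbackForm_apply, pullbackForm_apply]
  exact g.symm _ _ _

theorem fderiv_inChart_symm [FiniteDimensional ℝ E] (x : M) (u v w : E) :
    fderiv ℝ (g.inChart x) (extChartAt 𝓘(ℝ, E) x x) u v w =
      fderiv ℝ (g.inChart x) (extChartAt 𝓘(ℝ, E) x x) u w v := by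
  have hd : DifferentiableAt ℝ (g.inChart x) (extChartAt 𝓘(ℝ, E) x x) :=
    (g.contDiffAt_inChart x).differentiableAt (by simp)
  have h (v w : E) : HasFDerivAt (fun y ↦ g.inChart x y v w)
      (((fderiv ℝ (g.inChart x) (extChartAt 𝓘(ℝ, E) x x)).flip v).flip w)
      (extChartAt 𝓘(ℝ, E) x x) := by
    have := (hd.hasFDerivAt.clm_apply (hasFDerivAt_const v _)).clm_apply (hasFDerivAt_const w _)
    refine this.congr_fderiv ?_
    ext u
    simp
  have h2 := (h v w).unique (by simpa only [g.inChart_symm x _ v w] using h w v)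
  exact DFunLike.congr_fun h2 u

variable {g}

/-- Each chart is an isometry between `g` and `g.inChart`. -/
theorem inChart_mfderiv_extChartAt (x : M) {q : M} (hq : q ∈ (chartAt E x).source) (v w : E) :
    g.inChart x (extChartAt 𝓘(ℝ, E) x q)
      (mfderiv 𝓘(ℝ, E) 𝓘(ℝ, E) (extChartAt 𝓘(ℝ, E) x) q v)
      (mfderiv 𝓘(ℝ, E) 𝓘(ℝ, E) (extChartAt 𝓘(ℝ, E) x) q w) = g.val q v w := by
  have hq' : q ∈ (extChartAt 𝓘(ℝ, E) x).source := by rwa [extChartAt_source]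
  have h1 := mfderivWithin_extChartAt_symm_comp_mfderiv_extChartAt' (I := 𝓘(ℝ, E)) hq'
  simp only [modelWithCornersSelf_coe, range_id, mfderivWithin_univ] at h1
  have h2 (v : E) : (mfderiv 𝓘(ℝ, E) 𝓘(ℝ, E) (extChartAt 𝓘(ℝ, E) x).symm
      (extChartAt 𝓘(ℝ, E) x q) : E →L[ℝ] E)
      (mfderiv 𝓘(ℝ, E) 𝓘(ℝ, E) (extChartAt 𝓘(ℝ, E) x) q v) = v := DFunLike.congr_fun h1 v
  change g.val _ _ _ = _
  refine (congrArg₂ (fun a b : E ↦ g.val ((extChartAt 𝓘(ℝ, E) x).symm (extChartAt 𝓘(ℝ, E) x q))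
    a b) (h2 v) (h2 w)).trans ?_
  exact g.val_congr ((extChartAt 𝓘(ℝ, E) x).left_inv hq') v w

/-- The algebra behind metric compatibility: `D c v w = ∂_c g(v, w)` equals the sum of two Christoffel
symbols of the first kind. -/
theorem metric_compatibility_aux {G : E →L[ℝ] E →L[ℝ] ℝ} {D : E →L[ℝ] E →L[ℝ] E →L[ℝ] ℝ}
    {v w v' w' c : E} (hG : G w' v = G v w') (hD : D c v w = D c w v)
    (h1 : G v' w + (D c v w + D v c w - D w c v) / 2 = 0)
    (h2 : G w' v + (D c w v + D w c v - D v c w) / 2 = 0) :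
    (D c v + G v') w + G v w' = 0 := by
  rw [_root_.add_apply]
  linarith

/-- The Levi-Civita connection is metric: the product of two parallel vector fields along a curve
has derivative zero. -/
theorem IsParallelAt.hasDerivAt_val [FiniteDimensional ℝ E] {γ : ℝ → M} {t : ℝ}
    (hγ : ContinuousAt γ t) {V W : (t : ℝ) → TangentSpace 𝓘(ℝ, E) (γ t)}
    (hV : g.IsParallelAt γ V t) (hW : g.IsParallelAt γ W t) :
    HasDerivAt (fun s ↦ g.val (γ s) (V s) (W s)) 0 t := by
  obtain ⟨γ', V', hγ', hV', h1⟩ := hV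
  obtain ⟨γ'', W', hγ'', hW', h2⟩ := hW
  obtain rfl := hγ'.unique hγ''
  let φ : M → E := fun q ↦ extChartAt 𝓘(ℝ, E) (γ t) q
  let V₁ : ℝ → E := fun s ↦ mfderiv 𝓘(ℝ, E) 𝓘(ℝ, E) φ (γ s) (V s)
  let W₁ : ℝ → E := fun s ↦ mfderiv 𝓘(ℝ, E) 𝓘(ℝ, E) φ (γ s) (W s)
  have hγ₁ : HasDerivAt (fun s ↦ φ (γ s)) γ' t := hγ'
  have hV₁ : HasDerivAt V₁ V' t := hV'
  have hW₁ : HasDerivAt W₁ W' t := hW'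
  have hd : HasFDerivAt (g.inChart (γ t)) (fderiv ℝ (g.inChart (γ t)) (φ (γ t))) (φ (γ t)) :=
    ((g.contDiffAt_inChart (γ t)).differentiableAt (by simp)).hasFDerivAt
  have h5 : HasDerivAt (fun s ↦ g.inChart (γ t) (φ (γ s)))
    (fderiv ℝ (g.inChart (γ t)) (φ (γ t)) γ') t := HasFDerivAt.comp_hasDerivAt (l := g.inChart (γ t)) t hd hγ₁
  have h3 := (h5.clm_apply hV₁).clm_apply hW₁
  have h4 : (fun s ↦ g.val (γ s) (V s) (W s)) =ᶠ[𝓝 t] fun s ↦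
      g.inChart (γ t) (φ (γ s)) (V₁ s) (W₁ s) := by
    filter_upwards [hγ.preimage_mem_nhds (chart_source_mem_nhds E (γ t))] with s hs
    exact (inChart_mfderiv_extChartAt (γ t) hs (V s) (W s)).symm
  refine (HasDerivAt.congr_of_eventuallyEq h3 h4).congr_deriv ?_
  exact metric_compatibility_aux (g.inChart_symm _ _ _ _) (g.fderiv_inChart_symm _ _ _ _)
    (h1 _) (h2 _)

end Charts

end PseudoRiemannianMetric

/-! ### Parallel transport and the holonomy algebra -/

namespace PseudoRiemannianMetric

open Set Filter Topology

section Transport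

variable {E : Type*} [NormedAddCommGroup E] [NormedSpace ℝ E]
  {M : Type*} [TopologicalSpace M] [ChartedSpace E M] [IsManifold 𝓘(ℝ, E) ∞ M]
  {g : PseudoRiemannianMetric E M}

/-- A single smooth curve is a piecewise smooth path; its endpoints are only propositionally equal
to `p` and `q`. -/
theorem IsTransport.of_along {γ : ℝ → M} (hγ : ContMDiff 𝓘(ℝ, ℝ) 𝓘(ℝ, E) ∞ γ) {p q : M}
    (h0 : γ 0 = p) (h1 : γ 1 = q) {Q : E →L[ℝ] E} (hQ : g.IsTransportAlong γ Q) :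
    g.IsTransport p q Q := by
  subst h0 h1
  exact .step γ hγ _ Q .refl hQ

theorem IsTransport.trans {p q r : M} {P Q : E →L[ℝ] E} (hP : g.IsTransport p q P)
    (hQ : g.IsTransport q r Q) : g.IsTransport p r (Q ∘L P) := by
  induction hQ with
  | refl => exact hP
  | step γ hγ P' Q' _ hQ' ih => exact .step γ hγ _ Q' ih hQ'

theorem IsTransportAlong.val_eq [FiniteDimensional ℝ E] {γ : ℝ → M}
    (hγ : ContMDiff 𝓘(ℝ, ℝ) 𝓘(ℝ, E) ∞ γ) {Q : E →L[ℝ] E} (hQ : g.IsTransportAlong γ Q) (v w : E) :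
    g.val (γ 1) (Q v) (Q w) = g.val (γ 0) v w := by
  obtain ⟨V, hV, hV0, hV1⟩ := hQ v
  obtain ⟨W, hW, hW0, hW1⟩ := hQ w
  have h : ∀ t, HasDerivAt (fun s ↦ g.val (γ s) (V s) (W s)) 0 t := fun t ↦
    (hV t).hasDerivAt_val hγ.continuous.continuousAt (hW t)
  have h2 := is_const_of_deriv_eq_zero (fun t ↦ (h t).differentiableAt) (fun t ↦ (h t).deriv) 1 0
  simp only [hV0, hV1, hW0, hW1] at h2
  exact h2

/-- Parallel transports are isometries. -/
theorem IsTransport.val_eq [FiniteDimensional ℝ E] {p q : M} {P : E →L[ℝ] E}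
    (hP : g.IsTransport p q P) (v w : E) : g.val q (P v) (P w) = g.val p v w := by
  induction hP with
  | refl => rfl
  | step γ hγ P' Q' _ hQ' ih => exact (hQ'.val_eq hγ (P' v) (P' w)).trans ih

theorem injective_of_val_eq {p q : M} {P : E →L[ℝ] E}
    (hP : ∀ v w : E, g.val q (P v) (P w) = g.val p v w) : Function.Injective P := by
  refine (injective_iff_map_eq_zero P).2 fun v hv ↦ g.nondegenerate p v fun w ↦ ?_
  refine (hP v w).symm.trans ?_
  rw [hv]
  exact congrArg (fun f : TangentSpace 𝓘(ℝ, E) q →L[ℝ] ℝ ↦ f (P w)) (map_zero (g.val q))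

theorem exists_inverse_of_injective [FiniteDimensional ℝ E] {P : E →L[ℝ] E}
    (hP : Function.Injective P) : ∃ Q : E →L[ℝ] E, Q ∘L P = .id ℝ E ∧ P ∘L Q = .id ℝ E := by
  let e := (LinearEquiv.ofInjectiveEndo (P : E →ₗ[ℝ] E) hP).toContinuousLinearEquiv
  have he : (e : E →L[ℝ] E) = P := by ext v; rfl
  refine ⟨e.symm, ?_, ?_⟩
  · rw [← he]; ext v; simp
  · rw [← he]; ext v; simp

theorem neg_apply_aux (G : E →L[ℝ] E →L[ℝ] ℝ) (v w : E) : G (-v) w = -G v w := by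
  rw [map_neg, _root_.neg_apply]

theorem christoffel_neg (g : PseudoRiemannianMetric E M) (x : M) (u v w : E) :
    g.christoffel x (-u) v w = -g.christoffel x u v w := by
  simp only [christoffel, map_neg, _root_.neg_apply]
  ring

/-- A parallel field remains parallel when the curve is traversed backwards. -/
theorem IsParallelAt.comp_neg {γ : ℝ → M} {V : (t : ℝ) → TangentSpace 𝓘(ℝ, E) (γ t)} {t a : ℝ}
    (h : g.IsParallelAt γ V (a - t)) :
    g.IsParallelAt (fun s ↦ γ (a - s)) (fun s ↦ V (a - s)) t := by
  obtain ⟨γ', V', h1, h2, h3⟩ := h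
  refine ⟨-γ', -V', ?_, ?_, fun w ↦ ?_⟩
  · exact HasDerivAt.comp_const_sub (f := fun s ↦ extChartAt 𝓘(ℝ, E) (γ (a - t)) (γ s)) a t h1
  · exact HasDerivAt.comp_const_sub (f := fun s ↦ (mfderiv 𝓘(ℝ, E) 𝓘(ℝ, E)
      (extChartAt 𝓘(ℝ, E) (γ (a - t))) (γ s) (V s) : E)) a t h2
  · exact (congrArg₂ (· + ·) (neg_apply_aux _ _ _) (g.christoffel_neg _ _ _ _)).trans
      ((neg_add _ _).symm.trans (by rw [h3 w, neg_zero]))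

/-- Parallel transports are invertible, and the inverse is again a parallel transport. -/
theorem IsTransport.exists_inverse [FiniteDimensional ℝ E] {p q : M} {P : E →L[ℝ] E}
    (hP : g.IsTransport p q P) : ∃ P' : E →L[ℝ] E, g.IsTransport q p P' ∧
      P' ∘L P = .id ℝ E ∧ P ∘L P' = .id ℝ E := by
  induction hP with
  | refl => exact ⟨.id ℝ E, .refl, rfl, rfl⟩
  | step γ hγ P₁ Q _ hQ ih =>
    obtain ⟨P₁', h1, h2, h3⟩ := ih
    obtain ⟨Q', h4, h5⟩ := exists_inverse_of_injective (injective_of_val_eq (hQ.val_eq hγ))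
    -- The inverse of the transport along `γ` is the transport along the reversed curve.
    have h6 : g.IsTransport (γ 1) (γ 0) Q' := by
      refine .of_along (γ := fun t ↦ γ (1 - t)) (hγ.comp ?_) (by simp) (by simp) ?_
      · exact (contDiff_const.sub contDiff_id).contMDiff
      · intro v
        obtain ⟨V, hV, hV0, hV1⟩ := hQ (Q' v)
        refine ⟨fun t ↦ V (1 - t), fun t ↦ (hV (1 - t)).comp_neg, ?_, ?_⟩
        · have h7 : ∀ s, s = (1 : ℝ) → (V s : E) = v := by
            rintro s rfl
            exact hV1.trans (DFunLike.congr_fun h5 v)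
          exact h7 _ (sub_zero 1)
        · have h7 : ∀ s, s = (0 : ℝ) → (V s : E) = Q' v := by
            rintro s rfl
            exact hV0
          exact h7 _ (sub_self 1)
    refine ⟨P₁' ∘L Q', h6.trans h1, ?_, ?_⟩
    · ext v
      have e1 : Q' (Q (P₁ v)) = P₁ v := DFunLike.congr_fun h4 (P₁ v)
      have e2 : P₁' (P₁ v) = v := DFunLike.congr_fun h2 v
      exact (congrArg P₁' e1).trans e2
    · ext v
      have e1 : P₁ (P₁' (Q' v)) = Q' v := DFunLike.congr_fun h3 (Q' v)
      have e2 : Q (Q' v) = v := DFunLike.congr_fun h5 v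
      exact (congrArg Q e1).trans e2

/-- The holonomy algebra is a linear subspace, since products and
reparametrizations of curves in the holonomy group are again such curves. -/
def holonomySubmodule (g : PseudoRiemannianMetric E M) (p : M) : Submodule ℝ (E →L[ℝ] E) where
  carrier := g.holonomyAlgebra p
  zero_mem' := ⟨fun _ ↦ .id ℝ E, contDiff_const, rfl, fun _ ↦ .refl, hasDerivAt_const _ _⟩
  add_mem' := by
    rintro A B ⟨c, hc, hc0, hcm, hcA⟩ ⟨d, hd, hd0, hdm, hdB⟩
    refine ⟨fun t ↦ (c t).comp (d t), hc.clm_comp hd, ?_, fun t ↦ (hdm t).trans (hcm t), ?_⟩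
    · simp [hc0, hd0]
    · refine (hcA.clm_comp hdB).congr_deriv ?_
      rw [hc0, hd0]; rfl
  smul_mem' := by
    rintro r A ⟨c, hc, hc0, hcm, hcA⟩
    refine ⟨fun t ↦ c (r * t), hc.comp (by fun_prop), by simpa using hc0, fun t ↦ hcm _, ?_⟩
    have h : HasDerivAt (fun t : ℝ ↦ r * t) r 0 := by simpa using (hasDerivAt_id (0 : ℝ)).const_mul r
    exact HasDerivAt.scomp (g₁ := c) (h := fun t ↦ r * t) 0 (by simpa using hcA) h

/-- Parallel transport carries the holonomy algebra at one point to that at another. -/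
theorem IsTransport.conj_mem {p q : M} {P P' A : E →L[ℝ] E} (hP : g.IsTransport p q P)
    (hP' : g.IsTransport q p P') (h : P' ∘L P = .id ℝ E) (hA : A ∈ g.holonomySubmodule q) :
    P' ∘L A ∘L P ∈ g.holonomySubmodule p := by
  obtain ⟨c, hc, hc0, hcm, hcA⟩ := hA
  refine ⟨fun t ↦ P' ∘L c t ∘L P, contDiff_const.clm_comp (hc.clm_comp contDiff_const), ?_,
    fun t ↦ ?_, ?_⟩
  · simp only [hc0, ContinuousLinearMap.id_comp, h]
  · exact (hP.trans (hcm t)).trans hP'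
  · have := ((hasDerivAt_const (0 : ℝ) P').clm_comp (hcA.clm_comp (hasDerivAt_const (0 : ℝ) P)))
    refine this.congr_deriv ?_
    ext v
    simp

/-- A finite-dimensional subspace that contains a curve contains its velocities. -/
theorem _root_.Submodule.hasDerivAt_mem {F : Type*} [NormedAddCommGroup F] [NormedSpace ℝ F]
    [FiniteDimensional ℝ F] (S : Submodule ℝ F) {c : ℝ → F} {c' : F} {t : ℝ}
    (h : HasDerivAt c c' t) (hc : ∀ s, c s ∈ S) : c' ∈ S := by
  have hS : IsClosed (S : Set F) := S.closed_of_finiteDimensional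
  refine hS.mem_of_tendsto (hasDerivAt_iff_tendsto_slope.1 h) (.of_forall fun s ↦ ?_)
  rw [slope_def_module]
  exact S.smul_mem _ (S.sub_mem (hc s) (hc t))

/-- The holonomy algebra is closed under commutators: differentiate the adjoint action of a curve in
the holonomy group. -/
theorem commutator_mem [FiniteDimensional ℝ E] {p : M} {A B : E →L[ℝ] E}
    (hA : A ∈ g.holonomySubmodule p) (hB : B ∈ g.holonomySubmodule p) :
    A * B - B * A ∈ g.holonomySubmodule p := by
  have : CompleteSpace E := FiniteDimensional.complete ℝ E
  obtain ⟨c, hc, hc0, hcm, hcA⟩ := hA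
  have hinv : ∀ t, Ring.inverse (c t) ∈ g.holonomyGroup p ∧ c t * Ring.inverse (c t) = 1 ∧
      Ring.inverse (c t) * c t = 1 := fun t ↦ by
    obtain ⟨P', h1, h2, h3⟩ := (hcm t).exists_inverse
    let u : (E →L[ℝ] E)ˣ := ⟨c t, P', h3, h2⟩
    have h4 : Ring.inverse (c t) = P' := Ring.inverse_unit u
    exact ⟨by rw [h4]; exact h1, by rw [h4]; exact h3, by rw [h4]; exact h2⟩
  have hd : HasDerivAt (fun t ↦ Ring.inverse (c t)) (-A) 0 := by
    have := LinearODE.hasDerivAt_inverse (t := 0) (1 : (E →L[ℝ] E)ˣ) hc0 hcA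
    simpa using this
  have h0 : Ring.inverse (c 0) = 1 := by rw [hc0]; exact Ring.inverse_one _
  have key : HasDerivAt (fun t ↦ c t * B * Ring.inverse (c t)) (A * B - B * A) 0 := by
    refine ((hcA.mul_const B).mul hd).congr_deriv ?_
    rw [h0, hc0]
    change A * B * 1 + 1 * B * (-A) = _
    noncomm_ring
  -- The curve `c(t) B c(t)⁻¹` runs in the holonomy algebra, and `key` computes its velocity.
  refine Submodule.hasDerivAt_mem _ key fun t ↦ ?_
  exact IsTransport.conj_mem (hinv t).1 (hcm t) (hinv t).2.1 hB

end Transport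

end PseudoRiemannianMetric

/-! ### Connections on a vector space: curvature, small loops, flatness -/

namespace Connection

open Set Filter Topology LinearODE

variable {E : Type*} [NormedAddCommGroup E] [NormedSpace ℝ E]
  {Γ : E → E →L[ℝ] E →L[ℝ] E}

/-- The curvature of the connection `d + Γ` on a vector space. -/
noncomputable def curv (Γ : E → E →L[ℝ] E →L[ℝ] E) (x u v : E) : E →L[ℝ] E :=
  fderiv ℝ Γ x u v - fderiv ℝ Γ x v u + Γ x u * Γ x v - Γ x v * Γ x u

/-- The coefficient of the equation of parallel transport along the line `r ↦ y + r u`. -/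
noncomputable def lineCoeff (Γ : E → E →L[ℝ] E →L[ℝ] E) (y u : E) (r : ℝ) : E →L[ℝ] E :=
  -Γ (y + r • u) u

/-- The coefficients of parallel transport along the lines `r ↦ x + t v + r u`, differentiated with
respect to `t`. -/
noncomputable def lineCoeffVar (Γ : E → E →L[ℝ] E →L[ℝ] E) (x u v : E) (t r : ℝ) : E →L[ℝ] E :=
  -fderiv ℝ Γ (x + t • v + r • u) v u

theorem continuous_lineCoeff (hΓ : ContDiff ℝ ∞ Γ) (y u : E) : Continuous (lineCoeff Γ y u) := by
  have := hΓ.continuous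
  unfold lineCoeff
  fun_prop

theorem continuous_lineCoeff_uncurry (hΓ : ContDiff ℝ ∞ Γ) (x u v : E) :
    Continuous (Function.uncurry fun t : ℝ ↦ lineCoeff Γ (x + t • v) u) := by
  have := hΓ.continuous
  unfold lineCoeff Function.uncurry
  fun_prop

theorem continuous_lineCoeffVar (hΓ : ContDiff ℝ ∞ Γ) (x u v : E) :
    Continuous (Function.uncurry (lineCoeffVar Γ x u v)) := by
  have := hΓ.continuous_fderiv (by simp)
  unfold lineCoeffVar Function.uncurry
  fun_prop

theorem hasDerivAt_apply_line (hΓ : ContDiff ℝ ∞ Γ) (y v w : E) (t : ℝ) :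
    HasDerivAt (fun t : ℝ ↦ Γ (y + t • v) w) (fderiv ℝ Γ (y + t • v) v w) t := by
  have h1 : HasDerivAt (fun t : ℝ ↦ y + t • v) v t := by
    simpa using ((hasDerivAt_id t).smul_const v).const_add y
  have h2 : HasFDerivAt Γ (fderiv ℝ Γ (y + t • v)) (y + t • v) :=
    (hΓ.differentiable (by simp) _).hasFDerivAt
  have h3 := HasFDerivAt.comp_hasDerivAt (l := Γ) t h2 h1
  refine (h3.clm_apply (hasDerivAt_const t w)).congr_deriv ?_
  simp

theorem hasDerivAt_lineCoeff (hΓ : ContDiff ℝ ∞ Γ) (x u v : E) (t r : ℝ) :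
    HasDerivAt (fun t ↦ lineCoeff Γ (x + t • v) u r) (lineCoeffVar Γ x u v t r) t := by
  have h := (hasDerivAt_apply_line hΓ (x + r • u) v u t).neg
  have e : ∀ t : ℝ, x + r • u + t • v = x + t • v + r • u := fun t ↦ by abel
  simp only [e] at h
  exact h

theorem continuous_radialCoeff (hΓ : ContDiff ℝ ∞ Γ) (y : E) :
    Continuous fun s : ℝ ↦ -Γ (s • y) y := by
  have := hΓ.continuous
  fun_prop

variable [CompleteSpace E]

/-- The parallel transport around the parallelogram with the vertices `x`, `x + s u`,
`x + s u + t v`, `x + t v`. -/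
noncomputable def loop (Γ : E → E →L[ℝ] E →L[ℝ] E) (x u v : E) (s t : ℝ) : E →L[ℝ] E :=
  evolInv (lineCoeff Γ x v) t * evolInv (lineCoeff Γ (x + t • v) u) s *
    evol (lineCoeff Γ (x + s • u) v) t * evol (lineCoeff Γ x u) s

/-- The derivative of `loop Γ x u v s t` with respect to `t` at `t = 0`. -/
noncomputable def loopVelocity (Γ : E → E →L[ℝ] E →L[ℝ] E) (x u v : E) (s : ℝ) : E →L[ℝ] E :=
  Γ x v - evolVar (fun t ↦ lineCoeff Γ (x + t • v) u) (lineCoeffVar Γ x u v) 0 s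
    - evolInv (lineCoeff Γ x u) s * Γ (x + s • u) v * evol (lineCoeff Γ x u) s

theorem loop_zero (hΓ : ContDiff ℝ ∞ Γ) (x u v : E) (s : ℝ) : loop Γ x u v s 0 = 1 := by
  rw [loop, zero_smul, add_zero, evolInv_zero (continuous_lineCoeff hΓ _ _),
    evol_zero (continuous_lineCoeff hΓ _ _), mul_one, one_mul,
    evolInv_mul_evol (continuous_lineCoeff hΓ _ _)]

theorem contDiff_one_of_hasDerivAt {F : Type*} [NormedAddCommGroup F] [NormedSpace ℝ F]
    {f f' : ℝ → F} (h : ∀ t, HasDerivAt f (f' t) t) (hc : Continuous f') : ContDiff ℝ 1 f := by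
  refine contDiff_one_iff_deriv.2 ⟨fun t ↦ (h t).differentiableAt, ?_⟩
  rwa [show deriv f = f' from funext fun t ↦ (h t).deriv]

theorem contDiff_loop (hΓ : ContDiff ℝ ∞ Γ) (x u v : E) (s : ℝ) :
    ContDiff ℝ 1 (loop Γ x u v s) := by
  have h1 := continuous_lineCoeff hΓ
  have hK := continuous_lineCoeff_uncurry hΓ x u v
  have hK' := continuous_lineCoeffVar hΓ x u v
  have c1 : ContDiff ℝ 1 (evolInv (lineCoeff Γ x v)) :=
    contDiff_one_of_hasDerivAt (hasDerivAt_evolInv (h1 x v))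
      ((continuous_evolInv (h1 x v)).mul (h1 x v)).neg
  have c3 : ContDiff ℝ 1 (evol (lineCoeff Γ (x + s • u) v)) :=
    contDiff_one_of_hasDerivAt (hasDerivAt_evol (h1 _ v))
      ((h1 _ v).mul (continuous_evol (h1 _ v)))
  have c2' : ContDiff ℝ 1 fun t : ℝ ↦ evol (lineCoeff Γ (x + t • v) u) s :=
    contDiff_one_of_hasDerivAt
      (fun t ↦ hasDerivAt_evol_param hK hK' (hasDerivAt_lineCoeff hΓ x u v) t s)
      ((continuous_evol_param hK s).mul (continuous_evolVar hK hK' s))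
  have c2 : ContDiff ℝ 1 fun t : ℝ ↦ evolInv (lineCoeff Γ (x + t • v) u) s := by
    simp only [fun t : ℝ ↦ evolInv_eq_inverse (h1 (x + t • v) u) s]
    refine contDiff_iff_contDiffAt.2 fun t ↦ ?_
    obtain ⟨a, ha⟩ := isUnit_evol (h1 (x + t • v) u) s
    have h := contDiffAt_ringInverse ℝ (n := 1) a
    rw [ha] at h
    exact ContDiffAt.comp t h c2'.contDiffAt
  exact ((c1.mul c2).mul c3).mul contDiff_const

theorem hasDerivAt_inverse_of_mul_eq_one {𝔸 : Type*} [NormedRing 𝔸] [NormedAlgebra ℝ 𝔸]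
    [CompleteSpace 𝔸] {c : ℝ → 𝔸} {c' d : 𝔸} {t : ℝ} (h : c t * d = 1) (h' : d * c t = 1)
    (hc : HasDerivAt c c' t) : HasDerivAt (fun t ↦ Ring.inverse (c t)) (-(d * c' * d)) t :=
  hasDerivAt_inverse ⟨_, _, h, h'⟩ rfl hc

theorem hasDerivAt_loop (hΓ : ContDiff ℝ ∞ Γ) (x u v : E) (s : ℝ) :
    HasDerivAt (loop Γ x u v s) (loopVelocity Γ x u v s) 0 := by
  have h1 := continuous_lineCoeff hΓ
  have hK := continuous_lineCoeff_uncurry hΓ x u v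
  have hK' := continuous_lineCoeffVar hΓ x u v
  have hP := evolInv_mul_evol (h1 (x + (0 : ℝ) • v) u) s
  have d1 := hasDerivAt_evolInv (h1 x v) 0
  have d3 := hasDerivAt_evol (h1 (x + s • u) v) 0
  -- At `t = 0` the side `x + t v, x + s u + t v` varies with `t`, and the two sides in the direction of
  -- `v` grow from zero length.
  have d2' := hasDerivAt_evol_param hK hK' (hasDerivAt_lineCoeff hΓ x u v) 0 s
  have d2 : HasDerivAt (fun t : ℝ ↦ evolInv (lineCoeff Γ (x + t • v) u) s)
      (-(evolInv (lineCoeff Γ (x + (0 : ℝ) • v) u) s * (evol (lineCoeff Γ (x + (0 : ℝ) • v) u) s *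
        evolVar (fun t ↦ lineCoeff Γ (x + t • v) u) (lineCoeffVar Γ x u v) 0 s) *
        evolInv (lineCoeff Γ (x + (0 : ℝ) • v) u) s)) 0 := by
    have h2 := hasDerivAt_inverse_of_mul_eq_one
      (c := fun t : ℝ ↦ evol (lineCoeff Γ (x + t • v) u) s) (t := 0) (evol_mul_evolInv (h1 (x + (0 : ℝ) • v) u) s) hP d2'
    exact h2.congr_of_eventuallyEq
      (.of_forall fun t : ℝ ↦ evolInv_eq_inverse (h1 (x + t • v) u) s)
  refine (((d1.mul d2).mul d3).mul (hasDerivAt_const 0 _)).congr_deriv ?_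
  simp only [Pi.mul_apply, evolInv_zero (h1 _ _), evol_zero (h1 _ _), loopVelocity, one_mul,
    mul_one, mul_zero, add_zero]
  rw [show lineCoeff Γ x v 0 = -Γ x v by simp [lineCoeff],
    show lineCoeff Γ (x + s • u) v 0 = -Γ (x + s • u) v by simp [lineCoeff]]
  have e : x + (0 : ℝ) • v = x := by simp
  simp only [e] at hP ⊢
  generalize evolInv (lineCoeff Γ x u) s = P' at hP ⊢
  generalize evol (lineCoeff Γ x u) s = P at hP ⊢
  have hP2 : ∀ z, P' * (P * z) = z := fun z ↦ by rw [← mul_assoc, hP, one_mul]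
  simp only [neg_neg, add_mul, mul_assoc, hP, hP2, neg_mul, mul_neg, mul_one]
  abel

/-- Two differentiations of the transport around a small parallelogram give the curvature. -/
theorem hasDerivAt_loopVelocity (hΓ : ContDiff ℝ ∞ Γ) (x u v : E) :
    HasDerivAt (loopVelocity Γ x u v) (-curv Γ x u v) 0 := by
  have h1 := continuous_lineCoeff hΓ x u
  have hK := continuous_lineCoeff_uncurry hΓ x u v
  have hK' := continuous_lineCoeffVar hΓ x u v
  have d1 := hasDerivAt_evolVar hK hK' 0 0
  have d2 := ((hasDerivAt_evolInv h1 0).mul (hasDerivAt_apply_line hΓ x u v 0)).mul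
    (hasDerivAt_evol h1 0)
  refine (((hasDerivAt_const 0 (Γ x v)).sub d1).sub d2).congr_deriv ?_
  have e1 : lineCoeff Γ x u 0 = -Γ x u := by simp [lineCoeff]
  have e2 : lineCoeffVar Γ x u v 0 0 = -fderiv ℝ Γ x v u := by simp [lineCoeffVar]
  have e3 : ∀ y u, evol (lineCoeff Γ y u) 0 = 1 := fun y u ↦ evol_zero (continuous_lineCoeff hΓ y u)
  have e4 : ∀ y u, evolInv (lineCoeff Γ y u) 0 = 1 :=
    fun y u ↦ evolInv_zero (continuous_lineCoeff hΓ y u)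
  simp only [Pi.mul_apply, e3, e4, e1, e2, zero_smul, add_zero, one_mul, mul_one, curv]
  noncomm_ring

/-! #### Flat connections -/

/-- The parallel transport from `0` to `y` along the segment. -/
noncomputable def radialFrame (Γ : E → E →L[ℝ] E →L[ℝ] E) (y : E) : E →L[ℝ] E :=
  evol (fun s : ℝ ↦ -Γ (s • y) y) 1

theorem isUnit_radialFrame (hΓ : ContDiff ℝ ∞ Γ) (y : E) : IsUnit (radialFrame Γ y) :=
  isUnit_evol (continuous_radialCoeff hΓ y) 1

theorem continuous_radialFrame (hΓ : ContDiff ℝ ∞ Γ) : Continuous (radialFrame Γ) := by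
  refine continuous_evol_param (K := fun (y : E) (s : ℝ) ↦ -Γ (s • y) y) ?_ 1
  have := hΓ.continuous
  unfold Function.uncurry
  fun_prop

set_option maxHeartbeats 2000000 in
/-- If the curvature vanishes, then the radial frame is parallel along lines: by the homotopy formula
the derivative of the transport from `0` to `y + t v` is that of its endpoint only. -/
theorem hasDerivAt_radialFrame_line (hΓ : ContDiff ℝ ∞ Γ) (hR : ∀ x u v, curv Γ x u v = 0)
    (y v : E) (t : ℝ) : HasDerivAt (fun t : ℝ ↦ radialFrame Γ (y + t • v))
      (-(Γ (y + t • v) v * radialFrame Γ (y + t • v))) t := by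
  have hd : Differentiable ℝ Γ := hΓ.differentiable (by simp)
  have hc := hΓ.continuous
  have hc' : Continuous (fderiv ℝ Γ) := hΓ.continuous_fderiv (by simp)
  let K : ℝ → ℝ → E →L[ℝ] E := fun t s ↦ -Γ (s • (y + t • v)) (y + t • v)
  let K' : ℝ → ℝ → E →L[ℝ] E := fun t s ↦
    -(fderiv ℝ Γ (s • (y + t • v)) (s • v) (y + t • v) + Γ (s • (y + t • v)) v)
  have hK : Continuous (Function.uncurry K) := by
    unfold K Function.uncurry
    fun_prop
  have hK' : Continuous (Function.uncurry K') := by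
    unfold K' Function.uncurry
    fun_prop
  have hKK' : ∀ t s, HasDerivAt (fun t ↦ K t s) (K' t s) t := fun t s ↦ by
    have h1 : HasDerivAt (fun t : ℝ ↦ y + t • v) v t := by
      simpa using ((hasDerivAt_id t).smul_const v).const_add y
    exact ((HasFDerivAt.comp_hasDerivAt (l := Γ) t (hd _).hasFDerivAt
      (h1.const_smul s)).clm_apply h1).neg
  let G : ℝ → E →L[ℝ] E := fun s ↦ -Γ (s • (y + t • v)) (s • v)
  -- This is where the vanishing of the curvature enters: it says that `K'` is the covariant derivative
  -- of `G` along the segment.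
  have hG : ∀ s, HasDerivAt G (K' t s + K t s * G s - G s * K t s) s := fun s ↦ by
    have h1 : HasDerivAt (fun s : ℝ ↦ s • (y + t • v)) (y + t • v) s := by
      simpa using (hasDerivAt_id s).smul_const (y + t • v)
    have h2 : HasDerivAt (fun s : ℝ ↦ s • v) v s := by
      simpa using (hasDerivAt_id s).smul_const v
    refine ((HasFDerivAt.comp_hasDerivAt (l := Γ) s (hd _).hasFDerivAt h1).clm_apply
      h2).neg.congr_deriv ?_
    have h3 := hR (s • (y + t • v)) (s • v) (y + t • v)
    rw [curv] at h3
    simp only [K, K', G, Function.comp_apply]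
    rw [← sub_eq_zero]
    refine Eq.trans ?_ h3
    noncomm_ring
  have h1 := hasDerivAt_evol_param hK hK' hKK' t 1
  have hKt := continuous_slice hK t
  -- Hence the integral that defines `evolVar` can be evaluated.
  have key : evolVar K K' t = fun s ↦ evolInv (K t) s * G s * evol (K t) s := by
    have h2 : ∀ s, HasDerivAt (fun s ↦ evolVar K K' t s - evolInv (K t) s * G s * evol (K t) s)
        0 s := fun s ↦ by
      refine ((hasDerivAt_evolVar hK hK' t s).sub (((hasDerivAt_evolInv hKt s).mul (hG s)).mul
        (hasDerivAt_evol hKt s))).congr_deriv ?_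
      simp only [Pi.mul_apply]
      noncomm_ring
    funext s
    have h3 := is_const_of_deriv_eq_zero (fun s ↦ (h2 s).differentiableAt)
      (fun s ↦ (h2 s).deriv) s 0
    have h4 : evolVar K K' t 0 - evolInv (K t) 0 * G 0 * evol (K t) 0 = 0 := by
      simp [evolVar, G]
    exact sub_eq_zero.1 (h3.trans h4)
  refine h1.congr_deriv ?_
  rw [key]
  change evol (K t) 1 * (evolInv (K t) 1 * G 1 * evol (K t) 1) = -(Γ (y + t • v) v * evol (K t) 1)
  rw [← mul_assoc, ← mul_assoc, evol_mul_evolInv hKt, one_mul]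
  simp [G]

/-- The map `v ↦ -Γ(v) F`, which is the derivative of the radial frame `F` if `F` is parallel. -/
noncomputable def radialFrameDeriv (Γ : E → E →L[ℝ] E →L[ℝ] E) (y : E) : E →L[ℝ] E →L[ℝ] E :=
  -(((ContinuousLinearMap.mul ℝ (E →L[ℝ] E)).flip (radialFrame Γ y)).comp (Γ y))

theorem radialFrameDeriv_apply (y v : E) :
    radialFrameDeriv Γ y v = -(Γ y v * radialFrame Γ y) := rfl

theorem continuous_radialFrameDeriv (hΓ : ContDiff ℝ ∞ Γ) : Continuous (radialFrameDeriv Γ) := by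
  have := hΓ.continuous
  have := continuous_radialFrame hΓ
  unfold radialFrameDeriv
  fun_prop

/-- If the curvature vanishes, then the radial frame is parallel in all directions. -/
theorem hasFDerivAt_radialFrame (hΓ : ContDiff ℝ ∞ Γ) (hR : ∀ x u v, curv Γ x u v = 0) (y : E) :
    HasFDerivAt (radialFrame Γ) (radialFrameDeriv Γ y) y := by
  refine HasFDerivAt.of_isLittleO (Asymptotics.isLittleO_iff.2 fun ε hε ↦ ?_)
  have hc : ContinuousAt (radialFrameDeriv Γ) y := (continuous_radialFrameDeriv hΓ).continuousAt
  obtain ⟨δ, hδ, hδε⟩ := (Metric.continuousAt_iff (f := radialFrameDeriv Γ) (a := y)).1 hc ε hε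
  filter_upwards [Metric.ball_mem_nhds y hδ] with z hz
  -- The derivatives along the segments from `y` are known and depend continuously on the point, so the
  -- mean value inequality gives the total derivative.
  have h1 : ∀ t ∈ Icc (0 : ℝ) 1, HasDerivWithinAt
      (fun t : ℝ ↦ radialFrame Γ (y + t • (z - y)) - t • radialFrameDeriv Γ y (z - y))
      (radialFrameDeriv Γ (y + t • (z - y)) (z - y) - radialFrameDeriv Γ y (z - y))
      (Icc 0 1) t := fun t _ ↦ by
    refine ((hasDerivAt_radialFrame_line hΓ hR y (z - y) t).sub ?_).hasDerivWithinAt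
    simpa using (hasDerivAt_id t).smul_const (radialFrameDeriv Γ y (z - y))
  have h2 := norm_image_sub_le_of_norm_deriv_le_segment_01' h1 (C := ε * ‖z - y‖) fun t ht ↦ ?_
  · rw [one_smul, one_smul, zero_smul, zero_smul, add_zero, sub_zero, add_sub_cancel,
      sub_right_comm] at h2
    exact h2
  · have h3 : dist (radialFrameDeriv Γ (y + t • (z - y))) (radialFrameDeriv Γ y) ≤ ε := by
      refine (hδε ?_).le
      rw [dist_eq_norm, add_sub_cancel_left, norm_smul, Real.norm_eq_abs, abs_of_nonneg ht.1]
      rw [Metric.mem_ball, dist_eq_norm] at hz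
      nlinarith [norm_nonneg (z - y), ht.2]
    refine (ContinuousLinearMap.le_opNorm
      (radialFrameDeriv Γ (y + t • (z - y)) - radialFrameDeriv Γ y) (z - y)).trans ?_
    exact mul_le_mul_of_nonneg_right ((dist_eq_norm _ _).symm.trans_le h3) (norm_nonneg _)

end Connection

/-! ### Metrics on a vector space -/

namespace PseudoRiemannianMetric

open Set Filter Topology LinearODE Connection

section VectorSpace

variable {E : Type*} [NormedAddCommGroup E] [NormedSpace ℝ E]

/- Shortcuts for the normed structures on the spaces of multilinear maps below. -/
noncomputable local instance normedAddCommGroupBilin : NormedAddCommGroup (E →L[ℝ] E →L[ℝ] ℝ) :=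
  ContinuousLinearMap.toNormedAddCommGroup

noncomputable local instance normedSpaceBilin : NormedSpace ℝ (E →L[ℝ] E →L[ℝ] ℝ) :=
  ContinuousLinearMap.toNormedSpace

noncomputable local instance normedAddCommGroupTrilin : NormedAddCommGroup (E →L[ℝ] E →L[ℝ] E →L[ℝ] ℝ) :=
  ContinuousLinearMap.toNormedAddCommGroup

noncomputable local instance normedSpaceTrilin : NormedSpace ℝ (E →L[ℝ] E →L[ℝ] E →L[ℝ] ℝ) :=
  ContinuousLinearMap.toNormedSpace

/-- A metric on a vector space, as a field of bilinear forms on this space. -/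
def form (g : PseudoRiemannianMetric E E) (x : E) : E →L[ℝ] E →L[ℝ] ℝ := g.val x

variable (g : PseudoRiemannianMetric E E)

theorem form_symm (x v w : E) : g.form x v w = g.form x w v := g.symm x v w

theorem inChart_vectorSpace (x : E) : g.inChart x = g.form := by
  funext y
  have h : (mfderiv 𝓘(ℝ, E) 𝓘(ℝ, E) (extChartAt 𝓘(ℝ, E) x).symm y : E →L[ℝ] E) = .id ℝ E := by
    have : ((extChartAt 𝓘(ℝ, E) x).symm : E → E) = id := by simp [chartAt_self_eq]
    rw [this]
    exact mfderiv_id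
  rw [inChart, h]
  rfl

theorem contDiff_form [FiniteDimensional ℝ E] : ContDiff ℝ ∞ g.form := by
  have h := g.contDiffOn_pullbackForm isOpen_univ (ψ := id) contMDiff_id.contMDiffOn
  have h2 : g.pullbackForm id = g.form := by
    funext y
    have h : (mfderiv 𝓘(ℝ, E) 𝓘(ℝ, E) (id : E → E) y : E →L[ℝ] E) = .id ℝ E := mfderiv_id
    rw [pullbackForm, h]
    rfl
  rwa [h2, contDiffOn_univ] at h

/-- The Christoffel symbols of the first kind of a field of bilinear forms. -/
noncomputable def christoffelFirst (B : E → E →L[ℝ] E →L[ℝ] ℝ) (y : E) :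
    E →L[ℝ] E →L[ℝ] E →L[ℝ] ℝ :=
  (1 / 2 : ℝ) • (fderiv ℝ B y + (fderiv ℝ B y).flip
    - ((ContinuousLinearMap.flipₗᵢ ℝ E E ℝ).toContinuousLinearEquiv :
        (E →L[ℝ] E →L[ℝ] ℝ) →L[ℝ] (E →L[ℝ] E →L[ℝ] ℝ)).comp (fderiv ℝ B y).flip)

theorem christoffelFirst_apply (B : E → E →L[ℝ] E →L[ℝ] ℝ) (y u v w : E) :
    christoffelFirst B y u v w =
      (fderiv ℝ B y u v w + fderiv ℝ B y v u w - fderiv ℝ B y w u v) / 2 := by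
  change (1 / 2 : ℝ) * (fderiv ℝ B y u v w + fderiv ℝ B y v u w - fderiv ℝ B y w u v) = _
  ring

theorem christoffel_eq (x u v w : E) :
    g.christoffel x u v w = christoffelFirst g.form x u v w := by
  rw [christoffelFirst_apply, christoffel, inChart_vectorSpace]
  simp [chartAt_self_eq]

/-- The Christoffel symbols of the second kind: the Levi-Civita connection is `d + Γ`. -/
noncomputable def gamma (y : E) : E →L[ℝ] E →L[ℝ] E :=
  (ContinuousLinearMap.compL ℝ E (E →L[ℝ] ℝ) E (g.form y).inverse).comp
    (christoffelFirst g.form y)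

theorem eq_of_form_eq {y v v' : E} (h : ∀ w, g.form y v w = g.form y v' w) : v = v' := by
  refine sub_eq_zero.1 (g.nondegenerate y (v - v') fun (w : E) ↦ ?_)
  change g.form y (v - v') w = 0
  rw [map_sub, _root_.sub_apply, h, sub_self]

theorem gamma_smul_left (y u : E) (c : ℝ) (v : E) : g.gamma y (c • u) v = c • g.gamma y u v := by
  rw [map_smul, _root_.smul_apply]

variable [FiniteDimensional ℝ E]

theorem isInvertible_form (y : E) : (g.form y).IsInvertible := by
  have hinj : Function.Injective (g.form y : E →ₗ[ℝ] E →L[ℝ] ℝ) := by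
    refine (injective_iff_map_eq_zero _).2 fun v hv ↦ g.nondegenerate y v fun w ↦ ?_
    exact DFunLike.congr_fun hv w
  have hdim : Module.finrank ℝ E = Module.finrank ℝ (E →L[ℝ] ℝ) := by
    rw [← LinearMap.toContinuousLinearMap.finrank_eq]
    exact (Subspace.dual_finrank_eq (K := ℝ) (V := E)).symm
  refine ⟨(LinearEquiv.ofInjectiveOfFinrankEq _ hinj hdim).toContinuousLinearEquiv, ?_⟩
  ext v w
  rfl

theorem form_gamma (y u v w : E) :
    g.form y (g.gamma y u v) w = christoffelFirst g.form y u v w := by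
  change g.form y ((g.form y).inverse (christoffelFirst g.form y u v)) w = _
  rw [(g.isInvertible_form y).self_apply_inverse]

theorem fderiv_form_symm (y u v w : E) :
    fderiv ℝ g.form y u v w = fderiv ℝ g.form y u w v := by
  have := g.fderiv_inChart_symm y u v w
  rwa [inChart_vectorSpace] at this

theorem gamma_symm (y u v : E) : g.gamma y u v = g.gamma y v u := by
  refine g.eq_of_form_eq (y := y) fun w ↦ ?_
  rw [form_gamma, form_gamma, christoffelFirst_apply, christoffelFirst_apply,
    g.fderiv_form_symm y w v u]
  ring

theorem contDiff_christoffelFirst : ContDiff ℝ ∞ (christoffelFirst g.form) := by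
  have h : ContDiff ℝ ∞ (fderiv ℝ g.form) := g.contDiff_form.fderiv_right (by simp)
  have h2 : ContDiff ℝ ∞ fun y ↦ (fderiv ℝ g.form y).flip :=
    (ContinuousLinearMap.flipₗᵢ ℝ E E (E →L[ℝ] ℝ)).contDiff.comp h
  have h3 : ContDiff ℝ ∞ fun y ↦ (((ContinuousLinearMap.flipₗᵢ ℝ E E ℝ).toContinuousLinearEquiv :
      (E →L[ℝ] E →L[ℝ] ℝ) →L[ℝ] (E →L[ℝ] E →L[ℝ] ℝ)).comp (fderiv ℝ g.form y).flip) :=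
    contDiff_const.clm_comp h2
  exact ((h.add h2).sub h3).const_smul (1 / 2 : ℝ)

theorem contDiff_gamma : ContDiff ℝ ∞ g.gamma := by
  have : CompleteSpace E := FiniteDimensional.complete ℝ E
  have h1 : ContDiff ℝ ∞ fun y ↦ (g.form y).inverse := contDiff_iff_contDiffAt.2 fun y ↦
    ((g.isInvertible_form y).contDiffAt_map_inverse).comp y g.contDiff_form.contDiffAt
  have h2 : ContDiff ℝ ∞ fun y ↦ ContinuousLinearMap.compL ℝ E (E →L[ℝ] ℝ) E (g.form y).inverse :=
    ContDiff.comp (g := ContinuousLinearMap.compL ℝ E (E →L[ℝ] ℝ) E)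
      (ContinuousLinearMap.contDiff _) h1
  exact h2.clm_comp g.contDiff_christoffelFirst

variable {g}

/-- On a vector space, parallelism is the equation `V' = -Γ(γ', V)`, with the Christoffel symbols of
the second kind. -/
theorem isParallelAt_vectorSpace_iff {γ V : ℝ → E} {t : ℝ} :
    g.IsParallelAt γ V t ↔
      ∃ γ', HasDerivAt γ γ' t ∧ HasDerivAt V (-g.gamma (γ t) γ' (V t)) t := by
  have e1 : ∀ x, (extChartAt 𝓘(ℝ, E) x : E → E) = id := fun x ↦ by simp [chartAt_self_eq]
  have e2 : ∀ x y v : E, mfderiv 𝓘(ℝ, E) 𝓘(ℝ, E) (extChartAt 𝓘(ℝ, E) x) y v = v := fun x y v ↦ by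
    rw [e1]
    exact DFunLike.congr_fun (mfderiv_id (I := 𝓘(ℝ, E)) (x := y)) v
  have key : g.IsParallelAt γ V t ↔ ∃ γ' V' : E, HasDerivAt γ γ' t ∧ HasDerivAt V V' t ∧
      ∀ w, g.form (γ t) V' w + christoffelFirst g.form (γ t) γ' (V t) w = 0 := by
    refine exists_congr fun γ' ↦ exists_congr fun V' ↦ and_congr ?_ (and_congr ?_ ?_)
    · rw [e1]; rfl
    · have : (fun s ↦ (mfderiv 𝓘(ℝ, E) 𝓘(ℝ, E) (extChartAt 𝓘(ℝ, E) (γ t)) (γ s) (V s) : E)) = V :=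
        funext fun s ↦ e2 _ _ _
      rw [this]
    · refine forall_congr' fun w ↦ ?_
      rw [← christoffel_eq]
      have h1 : g.inChart (γ t) (extChartAt 𝓘(ℝ, E) (γ t) (γ t)) V' w = g.form (γ t) V' w := by
        rw [inChart_vectorSpace, e1]; rfl
      have h2 : g.christoffel (γ t) γ'
          (mfderiv 𝓘(ℝ, E) 𝓘(ℝ, E) (extChartAt 𝓘(ℝ, E) (γ t)) (γ t) (V t)) w =
          g.christoffel (γ t) γ' (V t) w := by
        exact congrArg (fun a ↦ g.christoffel (γ t) γ' a w) (e2 _ _ _)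
      exact Eq.congr (congrArg₂ (· + ·) h1 h2) rfl
  rw [key]
  refine exists_congr fun γ' ↦ ⟨?_, ?_⟩
  · rintro ⟨V', h1, h2, h3⟩
    refine ⟨h1, ?_⟩
    have : V' = -g.gamma (γ t) γ' (V t) := by
      refine g.eq_of_form_eq (y := γ t) fun w ↦ ?_
      rw [map_neg, _root_.neg_apply, form_gamma]
      linarith [h3 w]
    rwa [← this]
  · rintro ⟨h1, h2⟩
    refine ⟨_, h1, h2, fun w ↦ ?_⟩
    rw [map_neg, _root_.neg_apply, form_gamma]
    ring

/-- The parallel transport along a straight segment. -/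
theorem isTransport_segment (y u : E) (a b : ℝ) {p q : E} (hp : y + a • u = p)
    (hq : y + b • u = q) : g.IsTransport p q
      (evol (lineCoeff g.gamma y u) b * evolInv (lineCoeff g.gamma y u) a) := by
  have : CompleteSpace E := FiniteDimensional.complete ℝ E
  have hc := continuous_lineCoeff g.contDiff_gamma y u
  refine .of_along (γ := fun t : ℝ ↦ y + (a + t * (b - a)) • u) ?_ (by simpa using hp)
    (by simpa using hq) fun (v : E) ↦ ?_
  · refine ContDiff.contMDiff ?_
    fun_prop
  · refine ⟨fun t ↦ (evol (lineCoeff g.gamma y u) (a + t * (b - a)) *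
      evolInv (lineCoeff g.gamma y u) a) v, fun t ↦ ?_, ?_, ?_⟩
    · have h1 : HasDerivAt (fun t : ℝ ↦ a + t * (b - a)) (b - a) t := by
        simpa using ((hasDerivAt_id t).mul_const (b - a)).const_add a
      refine isParallelAt_vectorSpace_iff.2 ⟨(b - a) • u, (h1.smul_const u).const_add y, ?_⟩
      have h2 := HasDerivAt.scomp (g₁ := evol (lineCoeff g.gamma y u))
        (h := fun t : ℝ ↦ a + t * (b - a)) t (hasDerivAt_evol hc _) h1
      refine (h2.mul_const (evolInv (lineCoeff g.gamma y u) a)).clm_apply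
        (hasDerivAt_const t v) |>.congr_deriv ?_
      rw [gamma_smul_left]
      simp [lineCoeff]
    · change (evol (lineCoeff g.gamma y u) (a + 0 * (b - a)) *
        evolInv (lineCoeff g.gamma y u) a) v = v
      rw [zero_mul, add_zero, evol_mul_evolInv hc]
      rfl
    · change (evol (lineCoeff g.gamma y u) (a + 1 * (b - a)) *
        evolInv (lineCoeff g.gamma y u) a) v = _
      rw [one_mul, add_sub_cancel]
      rfl

theorem exists_isTransport_vectorSpace (y z : E) : ∃ P : E →L[ℝ] E, g.IsTransport y z P := by
  exact ⟨_, isTransport_segment y (z - y) 0 1 (by simp) (by simp)⟩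

theorem loop_mem_holonomyGroup (x u v : E) (s t : ℝ) :
    loop g.gamma x u v s t ∈ g.holonomyGroup x := by
  have : CompleteSpace E := FiniteDimensional.complete ℝ E
  have hc := continuous_lineCoeff g.contDiff_gamma
  have h1 := isTransport_segment (g := g) x u 0 s (p := x) (by simp) rfl
  have h2 := isTransport_segment (g := g) (x + s • u) v 0 t (p := x + s • u) (by simp) rfl
  have h3 := isTransport_segment (g := g) (x + t • v) u s 0 (p := x + s • u + t • v)
    (q := x + t • v) (by abel) (by simp)
  have h4 := isTransport_segment (g := g) x v t 0 (q := x) rfl (by simp)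
  simp only [evol_zero (hc _ _), evolInv_zero (hc _ _), mul_one, one_mul] at h1 h2 h3 h4
  exact ((h1.trans h2).trans h3).trans h4

/-- The values of the curvature belong to the holonomy algebra. -/
theorem curv_mem_holonomySubmodule (x u v : E) :
    curv g.gamma x u v ∈ g.holonomySubmodule x := by
  have : CompleteSpace E := FiniteDimensional.complete ℝ E
  have h : ∀ s, loopVelocity g.gamma x u v s ∈ g.holonomySubmodule x := fun s ↦
    ⟨loop g.gamma x u v s, contDiff_loop g.contDiff_gamma x u v s,
      loop_zero g.contDiff_gamma x u v s, fun t ↦ loop_mem_holonomyGroup x u v s t,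
      hasDerivAt_loop g.contDiff_gamma x u v s⟩
  have h2 := Submodule.hasDerivAt_mem _ (hasDerivAt_loopVelocity g.contDiff_gamma x u v) h
  exact neg_mem_iff.1 h2

theorem fderiv_gamma_symm (y a u v : E) :
    fderiv ℝ g.gamma y a u v = fderiv ℝ g.gamma y a v u := by
  have hd : DifferentiableAt ℝ g.gamma y := g.contDiff_gamma.differentiable (by simp) y
  have h (u v : E) : HasFDerivAt (fun y ↦ g.gamma y u v)
      (((fderiv ℝ g.gamma y).flip u).flip v) y := by
    refine ((hd.hasFDerivAt.clm_apply (hasFDerivAt_const u _)).clm_apply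
      (hasFDerivAt_const v _)).congr_fderiv ?_
    ext a
    simp
  have h2 := (h u v).unique (by simpa only [g.gamma_symm _ u v] using h v u)
  exact DFunLike.congr_fun h2 a

/-- The first Bianchi identity. -/
theorem bianchi (y u v w : E) :
    curv g.gamma y u v w + curv g.gamma y v w u + curv g.gamma y w u v = 0 := by
  have h (u v w : E) : curv g.gamma y u v w = fderiv ℝ g.gamma y u v w - fderiv ℝ g.gamma y v u w
      + (g.gamma y u (g.gamma y v w) - g.gamma y v (g.gamma y u w)) := by
    simp only [curv, _root_.add_apply, _root_.sub_apply, add_sub_assoc]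
    rfl
  rw [h, h, h, fderiv_gamma_symm y u w v, fderiv_gamma_symm y v u w, fderiv_gamma_symm y w v u,
    g.gamma_symm y w v, g.gamma_symm y u w, g.gamma_symm y v u]
  abel

end VectorSpace

end PseudoRiemannianMetric

/-! ### Local isometries preserve parallelism -/

namespace PseudoRiemannianMetric

open Set Filter Topology LinearODE Connection

section Push

variable {E : Type*} [NormedAddCommGroup E] [NormedSpace ℝ E]

attribute [local instance] normedAddCommGroupBilin normedSpaceBilin normedAddCommGroupTrilin
  normedSpaceTrilin

theorem hasDerivAt_eval {F : Type*} [NormedAddCommGroup F] [NormedSpace ℝ F] {c : ℝ → E →L[ℝ] F}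
    {c' : E →L[ℝ] F} {t : ℝ} (hc : HasDerivAt c c' t) (v : E) :
    HasDerivAt (fun s ↦ c s v) (c' v) t :=
  (hc.clm_apply (hasDerivAt_const _ v)).congr_deriv (by simp)

theorem hasDerivAt_bilin {c : ℝ → E →L[ℝ] E →L[ℝ] ℝ} {c' G : E →L[ℝ] E →L[ℝ] ℝ} {v w : ℝ → E}
    {v' w' a b : E} {t : ℝ} (hc : HasDerivAt c c' t) (hv : HasDerivAt v v' t)
    (hw : HasDerivAt w w' t) (hG : c t = G) (ha : v t = a) (hb : w t = b) :
    HasDerivAt (fun s ↦ c s (v s) (w s)) (c' a b + G v' b + G a w') t := by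
  subst hG ha hb
  exact (hc.clm_apply hv).clm_apply hw

theorem hasDerivAt_comp_line {F : Type*} [NormedAddCommGroup F] [NormedSpace ℝ F] {f : E → F}
    {f' : E →L[ℝ] F} {y : E} (hf : HasFDerivAt f f' y) (u : E) :
    HasDerivAt (fun s : ℝ ↦ f (y + s • u)) (f' u) 0 := by
  have hl : HasDerivAt (fun s : ℝ ↦ y + s • u) u 0 := by
    simpa using ((hasDerivAt_id (0 : ℝ)).smul_const u).const_add y
  have h0 : y + (0 : ℝ) • u = y := by simp
  exact HasFDerivAt.comp_hasDerivAt (l := f) (f := fun s : ℝ ↦ y + s • u) 0 (by rwa [h0]) hl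

/-- The form in which the transformation law of the Christoffel symbols enters below. -/
theorem parallel_push_aux {G : E →L[ℝ] E →L[ℝ] ℝ} {T : E →L[ℝ] E} {a b d : E} {r : ℝ}
    (h : G (T b) d = r + G a d) : G (a + T (-b)) d + r = 0 := by
  rw [map_neg, map_add, map_neg, _root_.add_apply, _root_.neg_apply, h]
  ring

/-- The first derivative of a pulled back field of bilinear forms. -/
theorem fderiv_pullback_apply {T : E → E} {y : E} (hT : ContDiffAt ℝ ∞ T y)
    {B G : E → E →L[ℝ] E →L[ℝ] ℝ} (hB : DifferentiableAt ℝ B y) (hG : DifferentiableAt ℝ G (T y))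
    (h : ∀ᶠ z in 𝓝 y, ∀ v w, B z v w = G (T z) (fderiv ℝ T z v) (fderiv ℝ T z w)) (u v w : E) :
    fderiv ℝ B y u v w = fderiv ℝ G (T y) (fderiv ℝ T y u) (fderiv ℝ T y v) (fderiv ℝ T y w)
      + G (T y) (fderiv ℝ (fderiv ℝ T) y u v) (fderiv ℝ T y w)
      + G (T y) (fderiv ℝ T y v) (fderiv ℝ (fderiv ℝ T) y u w) := by
  have hl : HasDerivAt (fun s : ℝ ↦ y + s • u) u 0 := by
    simpa using ((hasDerivAt_id (0 : ℝ)).smul_const u).const_add y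
  have h0 : y + (0 : ℝ) • u = y := by simp
  have hT' : HasFDerivAt (fderiv ℝ T) (fderiv ℝ (fderiv ℝ T) y) y :=
    ((hT.fderiv_right (m := ∞) (by simp)).differentiableAt (by simp)).hasFDerivAt
  have h1 : HasDerivAt (fun s : ℝ ↦ B (y + s • u) v w) (fderiv ℝ B y u v w) 0 :=
    hasDerivAt_eval (hasDerivAt_eval (hasDerivAt_comp_line hB.hasFDerivAt u) v) w
  have h2 : HasDerivAt (fun s : ℝ ↦ G (T (y + s • u)))
      (fderiv ℝ G (T y) (fderiv ℝ T y u)) 0 :=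
    HasFDerivAt.comp_hasDerivAt (l := G) (f := fun s : ℝ ↦ T (y + s • u)) 0
      (by rw [h0]; exact hG.hasFDerivAt)
      (hasDerivAt_comp_line (hT.differentiableAt (by simp)).hasFDerivAt u)
  have h3 (v : E) : HasDerivAt (fun s : ℝ ↦ fderiv ℝ T (y + s • u) v)
      (fderiv ℝ (fderiv ℝ T) y u v) 0 := hasDerivAt_eval (hasDerivAt_comp_line hT' u) v
  have h4 := hasDerivAt_bilin h2 (h3 v) (h3 w) (G := G (T y)) (a := fderiv ℝ T y v)
    (b := fderiv ℝ T y w) (by rw [h0]) (by rw [h0]) (by rw [h0])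
  have h5 : ContinuousAt (fun s : ℝ ↦ y + s • u) 0 := hl.continuousAt
  have h6 : (fun s : ℝ ↦ B (y + s • u) v w) =ᶠ[𝓝 0] fun s ↦
      G (T (y + s • u)) (fderiv ℝ T (y + s • u) v) (fderiv ℝ T (y + s • u) w) := by
    have h7 : Tendsto (fun s : ℝ ↦ y + s • u) (𝓝 0) (𝓝 y) := by simpa [ContinuousAt] using h5
    exact (h7.eventually h).mono fun s hs ↦ hs v w
  exact h1.unique (h4.congr_of_eventuallyEq h6)

/-- The transformation law of the Christoffel symbols. -/
theorem christoffelFirst_pullback {T : E → E} {y : E} (hT : ContDiffAt ℝ ∞ T y)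
    {B G : E → E →L[ℝ] E →L[ℝ] ℝ} (hB : DifferentiableAt ℝ B y) (hG : DifferentiableAt ℝ G (T y))
    (hsymm : ∀ v w, G (T y) v w = G (T y) w v)
    (h : ∀ᶠ z in 𝓝 y, ∀ v w, B z v w = G (T z) (fderiv ℝ T z v) (fderiv ℝ T z w)) (u v w : E) :
    christoffelFirst B y u v w =
      christoffelFirst G (T y) (fderiv ℝ T y u) (fderiv ℝ T y v) (fderiv ℝ T y w)
      + G (T y) (fderiv ℝ (fderiv ℝ T) y u v) (fderiv ℝ T y w) := by
  have hs : ∀ a b, fderiv ℝ (fderiv ℝ T) y a b = fderiv ℝ (fderiv ℝ T) y b a := fun a b ↦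
    (hT.isSymmSndFDerivAt (by simp [ENat.LEInfty.out])).eq a b
  simp only [christoffelFirst_apply, fderiv_pullback_apply hT hB hG h]
  rw [hs v u, hs w u, hs w v, hsymm (fderiv ℝ (fderiv ℝ T) y u w),
    hsymm (fderiv ℝ T y u) (fderiv ℝ (fderiv ℝ T) y v w)]
  ring

variable {M : Type*} [TopologicalSpace M] [ChartedSpace E M] [IsManifold 𝓘(ℝ, E) ∞ M]
  {g : PseudoRiemannianMetric E M} [FiniteDimensional ℝ E]

/-- Local isometries carry parallel vector fields to parallel vector fields. -/
theorem IsParallelAt.push {ψ : E → M} (hψ : ContMDiff 𝓘(ℝ, E) 𝓘(ℝ, E) ∞ ψ)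
    {g' : PseudoRiemannianMetric E E} (hg' : g'.form = g.pullbackForm ψ)
    {σ W : ℝ → E} {t : ℝ} (h : g'.IsParallelAt σ W t) {γ : ℝ → M}
    (hγ : ∀ᶠ s in 𝓝 t, γ s = ψ (σ s)) {V : ℝ → E}
    (hV : ∀ᶠ s in 𝓝 t, V s = mfderiv 𝓘(ℝ, E) 𝓘(ℝ, E) ψ (σ s) (W s)) :
    g.IsParallelAt γ V t := by
  obtain ⟨σ', hσ, hW⟩ := isParallelAt_vectorSpace_iff.1 h
  let x := γ t
  have hx : x = ψ (σ t) := hγ.self_of_nhds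
  -- The representative of `ψ` in the chart at `γ t`, in which parallelism is defined.
  let T : E → E := fun y ↦ extChartAt 𝓘(ℝ, E) x (ψ y)
  have hsrc : ∀ᶠ y in 𝓝 (σ t), ψ y ∈ (chartAt E x).source :=
    hψ.continuous.continuousAt.preimage_mem_nhds (by rw [← hx]; exact chart_source_mem_nhds E x)
  have hT : ContDiffAt ℝ ∞ T (σ t) := by
    refine contMDiffAt_iff_contDiffAt.1 ?_
    refine ContMDiffAt.comp (σ t) (contMDiffAt_extChartAt' ?_) hψ.contMDiffAt
    exact hsrc.self_of_nhds
  have hTd {y : E} (hy : ψ y ∈ (chartAt E x).source) (v : E) : fderiv ℝ T y v =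
      mfderiv 𝓘(ℝ, E) 𝓘(ℝ, E) (extChartAt 𝓘(ℝ, E) x) (ψ y)
        (mfderiv 𝓘(ℝ, E) 𝓘(ℝ, E) ψ y v) := by
    rw [← mfderiv_eq_fderiv]
    exact mfderiv_comp_apply y (mdifferentiableAt_extChartAt hy)
      ((hψ y).mdifferentiableAt (by simp)) v
  have hTx : T (σ t) = extChartAt 𝓘(ℝ, E) x x := congrArg (extChartAt 𝓘(ℝ, E) x) hx.symm
  have hpull : ∀ᶠ z in 𝓝 (σ t), ∀ v w, g'.form z v w =
      g.inChart x (T z) (fderiv ℝ T z v) (fderiv ℝ T z w) := by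
    filter_upwards [hsrc] with z hz v w
    rw [hg', hTd hz, hTd hz]
    exact (inChart_mfderiv_extChartAt x hz _ _).symm
  have hG : DifferentiableAt ℝ (g.inChart x) (T (σ t)) := by
    rw [hTx]
    exact (g.contDiffAt_inChart x).differentiableAt (by simp)
  have hchr := christoffelFirst_pullback hT (g'.contDiff_form.differentiable (by simp) _) hG
    (g.inChart_symm x _) hpull σ' (W t)
  have hTfd : HasFDerivAt T (fderiv ℝ T (σ t)) (σ t) :=
    (hT.differentiableAt (by simp)).hasFDerivAt
  have hT' : HasFDerivAt (fderiv ℝ T) (fderiv ℝ (fderiv ℝ T) (σ t)) (σ t) :=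
    ((hT.fderiv_right (m := ∞) (by simp)).differentiableAt (by simp)).hasFDerivAt
  -- It suffices to test the equation on the vectors in the range of the differential of `T`, which is
  -- invertible because the pulled back form is nondegenerate.
  have hsurj : Function.Surjective (fderiv ℝ T (σ t)) := by
    refine LinearMap.injective_iff_surjective (f := (fderiv ℝ T (σ t) : E →ₗ[ℝ] E)).1 ?_
    refine (injective_iff_map_eq_zero _).2 fun v hv ↦ g'.nondegenerate (σ t) v fun (w : E) ↦ ?_
    refine (hpull.self_of_nhds v w).trans ?_
    rw [show fderiv ℝ T (σ t) v = 0 from hv, map_zero]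
    rfl
  have hev : ∀ᶠ s in 𝓝 t, ψ (σ s) ∈ (chartAt E x).source := hσ.continuousAt.eventually hsrc
  refine ⟨fderiv ℝ T (σ t) σ', fderiv ℝ (fderiv ℝ T) (σ t) σ' (W t)
    + fderiv ℝ T (σ t) (-g'.gamma (σ t) σ' (W t)), ?_, ?_, fun w ↦ ?_⟩
  · refine (HasFDerivAt.comp_hasDerivAt (l := T) t hTfd hσ).congr_of_eventuallyEq ?_
    filter_upwards [hγ] with s hs
    exact congrArg (extChartAt 𝓘(ℝ, E) x) hs
  · refine ((HasFDerivAt.comp_hasDerivAt (l := fderiv ℝ T) t hT' hσ).clm_apply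
      hW).congr_of_eventuallyEq ?_
    filter_upwards [hγ, hV, hev] with s hs hs' hs''
    change _ = fderiv ℝ T (σ s) (W s)
    rw [hTd hs'', ← hs']
    have aux : ∀ q q' : M, q = q' → ∀ v : E,
        (mfderiv 𝓘(ℝ, E) 𝓘(ℝ, E) (extChartAt 𝓘(ℝ, E) x) q v : E) =
          mfderiv 𝓘(ℝ, E) 𝓘(ℝ, E) (extChartAt 𝓘(ℝ, E) x) q' v := by
      rintro q _ rfl v; rfl
    exact aux _ _ hs _
  · obtain ⟨w, rfl⟩ := hsurj w
    have h1 : (mfderiv 𝓘(ℝ, E) 𝓘(ℝ, E) (extChartAt 𝓘(ℝ, E) x) (γ t) (V t) : E) =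
        fderiv ℝ T (σ t) (W t) := by
      rw [hTd hsrc.self_of_nhds]
      have aux : ∀ q q' : M, q = q' → ∀ v : E,
        (mfderiv 𝓘(ℝ, E) 𝓘(ℝ, E) (extChartAt 𝓘(ℝ, E) x) q v : E) =
          mfderiv 𝓘(ℝ, E) 𝓘(ℝ, E) (extChartAt 𝓘(ℝ, E) x) q' v := by
        rintro q _ rfl v; rfl
      refine (aux _ _ hx _).trans ?_
      exact congrArg _ hV.self_of_nhds
    have h2 : ∀ a b c : E, g.christoffel x a b c =
        christoffelFirst (g.inChart x) (T (σ t)) a b c := fun a b c ↦ by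
      rw [christoffelFirst_apply, hTx]; rfl
    have h3 : g.inChart x (T (σ t)) (fderiv ℝ T (σ t) (g'.gamma (σ t) σ' (W t)))
        (fderiv ℝ T (σ t) w) = christoffelFirst g'.form (σ t) σ' (W t) w := by
      rw [← hpull.self_of_nhds, form_gamma]
    refine (congrArg₂ (· + ·) (?_ : _ = g.inChart x (T (σ t))
      (fderiv ℝ (fderiv ℝ T) (σ t) σ' (W t) + fderiv ℝ T (σ t) (-g'.gamma (σ t) σ' (W t)))
      (fderiv ℝ T (σ t) w)) ((congrArg (fun a ↦ g.christoffel x (fderiv ℝ T (σ t) σ') a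
        (fderiv ℝ T (σ t) w)) h1).trans (h2 _ _ _))).trans ?_
    · rw [hTx]
    · exact parallel_push_aux (h3.trans (hchr w))

end Push

end PseudoRiemannianMetric

/-! ### Local parametrizations -/

namespace PseudoRiemannianMetric

open Set Filter Topology LinearODE Connection

section LocalParametrization

/-- A diffeomorphism from the whole of the model space `E` onto an open subset of `M`, with its
inverse. -/
structure LocalParametrization (E : Type*) [NormedAddCommGroup E] [NormedSpace ℝ E]
    (M : Type*) [TopologicalSpace M] [ChartedSpace E M] where
  /-- The parametrization. -/
  toFun : E → M
  /-- The inverse map; its values outside of the range of the parametrization are irrelevant. -/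
  invFun : M → E
  contMDiff_toFun : ContMDiff 𝓘(ℝ, E) 𝓘(ℝ, E) ∞ toFun
  contMDiffOn_invFun : ContMDiffOn 𝓘(ℝ, E) 𝓘(ℝ, E) ∞ invFun (range toFun)
  isOpen_range : IsOpen (range toFun)
  left_inv : ∀ y, invFun (toFun y) = y

/-- A ball in a chart, stretched to the whole space, is a local parametrization. -/
theorem exists_localParametrization {E : Type*} [NormedAddCommGroup E] [InnerProductSpace ℝ E]
    {M : Type*} [TopologicalSpace M] [ChartedSpace E M] [IsManifold 𝓘(ℝ, E) ∞ M] (x : M) :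
    ∃ ψ : LocalParametrization E M, ψ.toFun 0 = x := by
  let φ := extChartAt 𝓘(ℝ, E) x
  obtain ⟨r, hr, hball⟩ := Metric.isOpen_iff.1 (isOpen_extChartAt_target (I := 𝓘(ℝ, E)) x) (φ x)
    (mem_extChartAt_target x)
  let b := OpenPartialHomeomorph.univBall (φ x) r
  have hb : ∀ y, b y ∈ Metric.ball (φ x) r := fun y ↦ by
    rw [← OpenPartialHomeomorph.univBall_target (φ x) hr]
    exact b.map_source (by simp [b])
  have hrange : range (fun y ↦ φ.symm (b y)) = φ.source ∩ φ ⁻¹' Metric.ball (φ x) r := by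
    ext q
    constructor
    · rintro ⟨y, rfl⟩
      exact ⟨φ.map_target (hball (hb y)), by
        rw [mem_preimage, φ.right_inv (hball (hb y))]; exact hb y⟩
    · rintro ⟨h1, h2⟩
      refine ⟨b.symm (φ q), ?_⟩
      have : b (b.symm (φ q)) = φ q :=
        b.right_inv (by rw [OpenPartialHomeomorph.univBall_target (φ x) hr]; exact h2)
      simp only [this]
      exact φ.left_inv h1
  refine ⟨⟨fun y ↦ φ.symm (b y), fun q ↦ b.symm (φ q), ?_, ?_, ?_, fun y ↦ ?_⟩, ?_⟩
  · refine (contMDiffOn_extChartAt_symm (I := 𝓘(ℝ, E)) (n := ∞) x).comp_contMDiff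
      (OpenPartialHomeomorph.contDiff_univBall).contMDiff fun y ↦ hball (hb y)
  · rw [hrange]
    refine ContMDiffOn.comp (t := Metric.ball (φ x) r)
      (OpenPartialHomeomorph.contDiffOn_univBall_symm).contMDiffOn
      ((contMDiffOn_extChartAt (x := x)).mono fun q hq ↦ ?_) fun q hq ↦ hq.2
    exact (extChartAt_source 𝓘(ℝ, E) x).subset hq.1
  · rw [hrange, extChartAt_source]
    exact isOpen_extChartAt_preimage x Metric.isOpen_ball
  · simp only [φ.right_inv (hball (hb y))]
    exact b.left_inv (by simp [b])
  · simp only [b, OpenPartialHomeomorph.univBall_apply_zero]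
    exact extChartAt_to_inv x

variable {E : Type*} [NormedAddCommGroup E] [NormedSpace ℝ E] [FiniteDimensional ℝ E]
  {M : Type*} [TopologicalSpace M] [ChartedSpace E M] [IsManifold 𝓘(ℝ, E) ∞ M]
  {g : PseudoRiemannianMetric E M}

theorem IsTransport.congr {p q : M} {P Q : E →L[ℝ] E} (hP : g.IsTransport p q P) (h : P = Q) :
    g.IsTransport p q Q := h ▸ hP

namespace LocalParametrization

variable (ψ : LocalParametrization E M)

/-- The differential of a local parametrization, as an endomorphism of the model space. -/
noncomputable def diff (y : E) : E →L[ℝ] E := mfderiv 𝓘(ℝ, E) 𝓘(ℝ, E) ψ.toFun y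

theorem injective_diff (y : E) : Function.Injective (ψ.diff y) := by
  have h1 : MDifferentiableAt 𝓘(ℝ, E) 𝓘(ℝ, E) ψ.invFun (ψ.toFun y) :=
    (ψ.contMDiffOn_invFun.contMDiffAt (ψ.isOpen_range.mem_nhds ⟨y, rfl⟩)).mdifferentiableAt
      (by simp)
  have h2 : ψ.invFun ∘ ψ.toFun = id := funext ψ.left_inv
  have h3 := fun v ↦ mfderiv_comp_apply y h1 ((ψ.contMDiff_toFun y).mdifferentiableAt (by simp)) v
  rw [h2] at h3
  have h4 : ∀ v : E, v = mfderiv 𝓘(ℝ, E) 𝓘(ℝ, E) ψ.invFun (ψ.toFun y) (ψ.diff y v) := fun v ↦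
    (DFunLike.congr_fun (mfderiv_id (I := 𝓘(ℝ, E)) (x := y)) v).symm.trans (h3 v)
  intro v w hvw
  rw [h4 v, h4 w, hvw]

theorem exists_diffInv (y : E) :
    ∃ D : E →L[ℝ] E, D ∘L ψ.diff y = .id ℝ E ∧ ψ.diff y ∘L D = .id ℝ E :=
  exists_inverse_of_injective (ψ.injective_diff y)

/-- The inverse of the differential of a local parametrization. -/
noncomputable def diffInv (y : E) : E →L[ℝ] E := (ψ.exists_diffInv y).choose

theorem diffInv_diff (y v : E) : ψ.diffInv y (ψ.diff y v) = v :=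
  DFunLike.congr_fun (ψ.exists_diffInv y).choose_spec.1 v

theorem diff_diffInv (y v : E) : ψ.diff y (ψ.diffInv y v) = v :=
  DFunLike.congr_fun (ψ.exists_diffInv y).choose_spec.2 v

theorem pullbackForm_nondegenerate (y v : E) (hv : ∀ w, g.pullbackForm ψ.toFun y v w = 0) :
    v = 0 := by
  have h1 : ψ.diff y v = 0 := by
    refine g.nondegenerate (ψ.toFun y) (ψ.diff y v) fun (w : E) ↦ ?_
    have h2 : g.val (ψ.toFun y) (ψ.diff y v) (ψ.diff y (ψ.diffInv y w)) = 0 := hv (ψ.diffInv y w)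
    rwa [ψ.diff_diffInv y w] at h2
  exact ψ.injective_diff y (h1.trans (map_zero (ψ.diff y)).symm)

theorem pullbackForm_symm (y v w : E) :
    g.pullbackForm ψ.toFun y v w = g.pullbackForm ψ.toFun y w v :=
  g.symm (ψ.toFun y) (ψ.diff y v) (ψ.diff y w)

theorem contDiff_pullbackForm : ContDiff ℝ ∞ (g.pullbackForm ψ.toFun) :=
  contDiffOn_univ.1 (g.contDiffOn_pullbackForm isOpen_univ ψ.contMDiff_toFun.contMDiffOn)

variable (g) in
/-- The pullback of the metric, a metric on the model space. -/
noncomputable def pullback : PseudoRiemannianMetric E E :=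
  .ofModelSpace (g.pullbackForm ψ.toFun) ψ.pullbackForm_symm ψ.pullbackForm_nondegenerate
    ψ.contDiff_pullbackForm

theorem form_pullback : (ψ.pullback g).form = g.pullbackForm ψ.toFun := rfl

/-- A local parametrization intertwines the parallel transports. -/
theorem isTransport_push {y z : E} {P : E →L[ℝ] E} (hP : (ψ.pullback g).IsTransport y z P) :
    g.IsTransport (ψ.toFun y) (ψ.toFun z) (ψ.diff z ∘L P ∘L ψ.diffInv y) := by
  induction hP with
  | refl =>
    have h : ψ.diff y ∘L (.id ℝ E) ∘L ψ.diffInv y = .id ℝ E :=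
      ContinuousLinearMap.ext (ψ.diff_diffInv y)
    exact IsTransport.congr (P := .id ℝ E) .refl h.symm
  | step γ hγ P Q _ hQ ih =>
    have h1 : g.IsTransport (ψ.toFun (γ 0)) (ψ.toFun (γ 1))
        (ψ.diff (γ 1) ∘L Q ∘L ψ.diffInv (γ 0)) := by
      refine .of_along (γ := fun t ↦ ψ.toFun (γ t)) (ψ.contMDiff_toFun.comp hγ) rfl rfl
        fun (v : E) ↦ ?_
      obtain ⟨W, hW, hW0, hW1⟩ := hQ (ψ.diffInv (γ 0) v)
      refine ⟨fun t ↦ ψ.diff (γ t) (W t), fun t ↦ ?_, ?_, ?_⟩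
      · exact (hW t).push ψ.contMDiff_toFun ψ.form_pullback (.of_forall fun _ ↦ rfl)
          (.of_forall fun _ ↦ rfl)
      · exact (congrArg (ψ.diff (γ 0)) hW0).trans (ψ.diff_diffInv _ _)
      · exact congrArg (ψ.diff (γ 1)) hW1
    have h2 := ih.trans h1
    have h3 : (ψ.diff (γ 1) ∘L Q ∘L ψ.diffInv (γ 0)) ∘L (ψ.diff (γ 0) ∘L P ∘L ψ.diffInv y) =
        ψ.diff (γ 1) ∘L (Q ∘L P) ∘L ψ.diffInv y := by
      ext v
      exact congrArg (fun w ↦ ψ.diff (γ 1) (Q w)) (ψ.diffInv_diff (γ 0) (P (ψ.diffInv y v)))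
    exact h2.congr h3

/-- A local parametrization carries the holonomy algebra of the pulled back metric into that of `g`. -/
theorem holonomy_push {y : E} {A : E →L[ℝ] E} (hA : A ∈ (ψ.pullback g).holonomySubmodule y) :
    ψ.diff y ∘L A ∘L ψ.diffInv y ∈ g.holonomySubmodule (ψ.toFun y) := by
  obtain ⟨c, hc, hc0, hcm, hcA⟩ := hA
  refine ⟨fun t ↦ ψ.diff y ∘L c t ∘L ψ.diffInv y,
    contDiff_const.clm_comp (hc.clm_comp contDiff_const), ?_, fun t ↦ ψ.isTransport_push (hcm t),
    ?_⟩
  · simp only [hc0]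
    exact ContinuousLinearMap.ext (ψ.diff_diffInv y)
  · refine ((hasDerivAt_const (0 : ℝ) (ψ.diff y)).clm_comp
      (hcA.clm_comp (hasDerivAt_const (0 : ℝ) (ψ.diffInv y)))).congr_deriv ?_
    ext v
    simp

end LocalParametrization

/-- Any two points of a connected manifold are joined by a piecewise smooth path. -/
theorem exists_isTransport {E : Type*} [NormedAddCommGroup E] [InnerProductSpace ℝ E]
    [FiniteDimensional ℝ E] {M : Type*} [TopologicalSpace M] [ChartedSpace E M]
    [IsManifold 𝓘(ℝ, E) ∞ M] {g : PseudoRiemannianMetric E M} [ConnectedSpace M] (p q : M) :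
    ∃ P : E →L[ℝ] E, g.IsTransport p q P := by
  let R : Set M := {q | ∃ P : E →L[ℝ] E, g.IsTransport p q P}
  -- The set `R` of the points that can be reached is open and closed, since the points in the range of
  -- a local parametrization are joined by segments.
  have hstep : ∀ q, ∃ U ∈ 𝓝 q, ∀ a ∈ U, ∀ b ∈ U, a ∈ R → b ∈ R := fun q ↦ by
    obtain ⟨ψ, hψ⟩ := exists_localParametrization (E := E) q
    refine ⟨range ψ.toFun, ψ.isOpen_range.mem_nhds ⟨0, hψ⟩, ?_⟩
    rintro _ ⟨y, rfl⟩ _ ⟨z, rfl⟩ ⟨P, hP⟩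
    obtain ⟨Q, hQ⟩ := exists_isTransport_vectorSpace (g := ψ.pullback g) y z
    exact ⟨_, hP.trans (ψ.isTransport_push hQ)⟩
  have hopen : IsOpen R := isOpen_iff_mem_nhds.2 fun q hq ↦ by
    obtain ⟨U, hU, h⟩ := hstep q
    exact mem_of_superset hU fun b hb ↦ h q (mem_of_mem_nhds hU) b hb hq
  have hclosed : IsClosed R := by
    rw [← isOpen_compl_iff]
    refine isOpen_iff_mem_nhds.2 fun q hq ↦ ?_
    obtain ⟨U, hU, h⟩ := hstep q
    exact mem_of_superset hU fun b hb hb' ↦ hq (h b hb q (mem_of_mem_nhds hU) hb')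
  have huniv : R = univ := IsClopen.eq_univ ⟨hclosed, hopen⟩ ⟨p, .id ℝ E, .refl⟩
  have : q ∈ R := huniv ▸ mem_univ q
  exact this

end LocalParametrization

end PseudoRiemannianMetric

/-! ### Flat metrics have a countable holonomy group -/

theorem Submonoid.countable_closure {G : Type*} [Monoid G] {s : Set G} (hs : s.Countable) :
    (Submonoid.closure s : Set G).Countable := by
  have : Countable s := hs
  refine (Set.countable_range fun l : List s ↦ (l.map Subtype.val).prod).mono fun x hx ↦ ?_
  obtain ⟨l, hl, rfl⟩ := Submonoid.exists_list_of_mem_closure hx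
  lift l to List s using hl
  exact ⟨l, rfl⟩

/-- A continuous curve with countably many values is constant. -/
theorem Continuous.eq_of_countable {X : Type*} [MetricSpace X] {c : ℝ → X} (hc : Continuous c)
    {s : Set X} (hs : s.Countable) (h : ∀ t, c t ∈ s) (a b : ℝ) : c a = c b :=
  hs.isTotallyDisconnected (Set.range c) (Set.range_subset_iff.2 h) (isPreconnected_range hc)
    ⟨a, rfl⟩ ⟨b, rfl⟩

theorem IsOpen.eq_of_hasDerivAt_zero {s : Set ℝ} (hs : IsOpen s) (hs' : IsPreconnected s)
    {f : ℝ → ℝ} (hf : ∀ x ∈ s, HasDerivAt f 0 x) {x y : ℝ} (hx : x ∈ s) (hy : y ∈ s) :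
    f x = f y := by
  refine IsOpen.is_const_of_fderiv_eq_zero (𝕜 := ℝ) hs hs'
    (fun x hx ↦ (hf x hx).differentiableAt.differentiableWithinAt) (fun x hx ↦ ?_) hx hy
  ext
  simp [(hf x hx).deriv]

namespace PseudoRiemannianMetric

open Set Filter Topology LinearODE Connection

section Flat

variable {E : Type*} [NormedAddCommGroup E] [NormedSpace ℝ E] [FiniteDimensional ℝ E]
  {M : Type*} [TopologicalSpace M] [ChartedSpace E M] [IsManifold 𝓘(ℝ, E) ∞ M]
  {g : PseudoRiemannianMetric E M}

variable (g) in
/-- The metric is flat: its curvature vanishes in every local parametrization. -/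
def IsFlat : Prop :=
  ∀ (ψ : LocalParametrization E M) (y u v : E), curv (ψ.pullback g).gamma y u v = 0

namespace LocalParametrization

variable (ψ : LocalParametrization E M)

variable (g) in
/-- The frame of `M` on the range of `ψ` obtained by parallel transport along the images of the
rays from the origin. -/
noncomputable def frame (y : E) : E →L[ℝ] E :=
  ψ.diff y * radialFrame (ψ.pullback g).gamma y

variable (g) in
/-- The coefficients with respect to the frame of a tangent vector at `ψ y`. -/
noncomputable def coeff (y : E) : E →L[ℝ] E :=
  Ring.inverse (radialFrame (ψ.pullback g).gamma y) * ψ.diffInv y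

theorem coeff_mul_frame (y : E) : ψ.coeff g y * ψ.frame g y = 1 := by
  have : CompleteSpace E := FiniteDimensional.complete ℝ E
  have h1 : ψ.diffInv y * ψ.diff y = 1 := ContinuousLinearMap.ext (ψ.diffInv_diff y)
  have h2 := Ring.inverse_mul_cancel _ (isUnit_radialFrame (ψ.pullback g).contDiff_gamma y)
  rw [coeff, frame, mul_assoc, ← mul_assoc (ψ.diffInv y), h1, one_mul, h2]

theorem frame_mul_coeff (y : E) : ψ.frame g y * ψ.coeff g y = 1 := by
  have : CompleteSpace E := FiniteDimensional.complete ℝ E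
  have h1 : ψ.diff y * ψ.diffInv y = 1 := ContinuousLinearMap.ext (ψ.diff_diffInv y)
  have h2 := Ring.mul_inverse_cancel _ (isUnit_radialFrame (ψ.pullback g).contDiff_gamma y)
  rw [coeff, frame, mul_assoc, ← mul_assoc _ _ (ψ.diffInv y), h2, one_mul, h1]

theorem right_inv {q : M} (hq : q ∈ range ψ.toFun) : ψ.toFun (ψ.invFun q) = q := by
  obtain ⟨y, rfl⟩ := hq
  rw [ψ.left_inv]

/-- The frame vectors are parallel along every curve. -/
theorem isParallelAt_frame (hg : g.IsFlat) {γ : ℝ → M} (hγ : ContMDiff 𝓘(ℝ, ℝ) 𝓘(ℝ, E) ∞ γ)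
    {t : ℝ} (ht : γ t ∈ range ψ.toFun) (e : E) :
    g.IsParallelAt γ (fun s ↦ ψ.frame g (ψ.invFun (γ s)) e) t := by
  have : CompleteSpace E := FiniteDimensional.complete ℝ E
  have hev : ∀ᶠ s in 𝓝 t, γ s ∈ range ψ.toFun :=
    hγ.continuous.continuousAt.preimage_mem_nhds (ψ.isOpen_range.mem_nhds ht)
  have hσ : DifferentiableAt ℝ (fun s ↦ ψ.invFun (γ s)) t := by
    have h1 : ContMDiffAt 𝓘(ℝ, ℝ) 𝓘(ℝ, E) ∞ (fun s ↦ ψ.invFun (γ s)) t :=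
      ContMDiffAt.comp t (ψ.contMDiffOn_invFun.contMDiffAt (ψ.isOpen_range.mem_nhds ht))
        hγ.contMDiffAt
    exact (contMDiffAt_iff_contDiffAt.1 h1).differentiableAt (by simp)
  refine IsParallelAt.push (σ := fun s ↦ ψ.invFun (γ s))
    (W := fun s ↦ radialFrame (ψ.pullback g).gamma (ψ.invFun (γ s)) e) ψ.contMDiff_toFun
    ψ.form_pullback (isParallelAt_vectorSpace_iff.2 ⟨_, hσ.hasDerivAt, ?_⟩)
    (hev.mono fun s hs ↦ (ψ.right_inv hs).symm) (.of_forall fun s ↦ rfl)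
  have h2 := hasFDerivAt_radialFrame (ψ.pullback g).contDiff_gamma (hg ψ) (ψ.invFun (γ t))
  refine (hasDerivAt_eval (HasFDerivAt.comp_hasDerivAt
    (l := radialFrame (ψ.pullback g).gamma) t h2 hσ.hasDerivAt) e).congr_deriv ?_
  rw [radialFrameDeriv_apply]
  rfl

/-- The coefficients of a parallel vector field with respect to the frame are constant. -/
theorem coeff_eq (hg : g.IsFlat) {γ : ℝ → M} (hγ : ContMDiff 𝓘(ℝ, ℝ) 𝓘(ℝ, E) ∞ γ) {I : Set ℝ}
    (hI : IsOpen I) (hI' : IsPreconnected I) (h : ∀ s ∈ I, γ s ∈ range ψ.toFun) {V : ℝ → E}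
    (hV : ∀ s ∈ I, g.IsParallelAt γ V s) {a b : ℝ} (ha : a ∈ I) (hb : b ∈ I) :
    ψ.coeff g (ψ.invFun (γ a)) (V a) = ψ.coeff g (ψ.invFun (γ b)) (V b) := by
  let F : ℝ → E →L[ℝ] E := fun s ↦ ψ.frame g (ψ.invFun (γ s))
  let C : ℝ → E →L[ℝ] E := fun s ↦ ψ.coeff g (ψ.invFun (γ s))
  let G : ℝ → E →L[ℝ] E →L[ℝ] ℝ := fun s ↦ g.val (γ s)
  have hFC : ∀ s v, F s (C s v) = v := fun s v ↦ DFunLike.congr_fun (ψ.frame_mul_coeff _) v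
  have hCF : ∀ s v, C s (F s v) = v := fun s v ↦ DFunLike.congr_fun (ψ.coeff_mul_frame _) v
  have hF : ∀ e, ∀ s ∈ I, g.IsParallelAt γ (fun s ↦ F s e) s := fun e s hs ↦
    ψ.isParallelAt_frame hg hγ (h s hs) e
  -- The products with the parallel frame vectors are constant, and determine a vector.
  have h1 : ∀ W : ℝ → E, (∀ s ∈ I, g.IsParallelAt γ W s) → ∀ e, G a (W a) (F a e) =
      G b (W b) (F b e) := fun W hW e ↦
    hI.eq_of_hasDerivAt_zero hI' (f := fun s ↦ G s (W s) (F s e)) (fun s hs ↦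
      (hW s hs).hasDerivAt_val hγ.continuous.continuousAt (hF e s hs)) ha hb
  have h2 : F b (C a (V a)) = V b := by
    refine sub_eq_zero.1 (g.nondegenerate (γ b) (F b (C a (V a)) - V b) fun (w : E) ↦ ?_)
    have h3 := h1 (fun s ↦ F s (C a (V a))) (hF _) (C b w)
    have h4 := h1 V hV (C b w)
    change G b (F b (C a (V a)) - V b) w = 0
    simp only [hFC] at h3 h4
    rw [map_sub, _root_.sub_apply, ← h3, ← h4, sub_self]
  have h5 := congrArg (C b) h2
  rw [hCF] at h5
  exact h5

variable (g) in
/-- The change from the frame of `ψ'` to that of `ψ`, at the point `q`. -/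
noncomputable def transition (ψ ψ' : LocalParametrization E M) (q : M) : E →L[ℝ] E :=
  ψ.coeff g (ψ.invFun q) * ψ'.frame g (ψ'.invFun q)

/-- The transition functions of parallel frames are locally constant, hence have only countably many
values. -/
theorem countable_transition (hg : g.IsFlat) (ψ ψ' : LocalParametrization E M) :
    (transition g ψ ψ' '' (range ψ.toFun ∩ range ψ'.toFun)).Countable := by
  have : SecondCountableTopology E := secondCountable_of_proper
  let O : Set E := ψ'.toFun ⁻¹' range ψ.toFun
  have hO : IsOpen O := ψ.isOpen_range.preimage ψ'.contMDiff_toFun.continuous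
  -- Local constancy: compare the two frames along segments.
  have h1 : ∀ y ∈ O, ∃ r > 0, ∀ z ∈ Metric.ball y r,
      transition g ψ ψ' (ψ'.toFun z) = transition g ψ ψ' (ψ'.toFun y) := fun y hy ↦ by
    obtain ⟨r, hr, hball⟩ := Metric.isOpen_iff.1 hO y hy
    refine ⟨r, hr, fun z hz ↦ ?_⟩
    let l : ℝ → E := fun s ↦ y + s • (z - y)
    have hl : ContDiff ℝ ∞ l := by fun_prop
    let I : Set ℝ := l ⁻¹' Metric.ball y r
    have hl' : l = AffineMap.lineMap y z := by
      funext s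
      simp [l, AffineMap.lineMap_apply, add_comm]
    have hI : IsPreconnected I := by
      refine Convex.isPreconnected ?_
      simp only [I, hl']
      exact (convex_ball y r).affine_preimage (AffineMap.lineMap y z : ℝ →ᵃ[ℝ] E)
    have hγ : ContMDiff 𝓘(ℝ, ℝ) 𝓘(ℝ, E) ∞ fun s ↦ ψ'.toFun (l s) :=
      ψ'.contMDiff_toFun.comp hl.contMDiff
    refine ContinuousLinearMap.ext fun v ↦ ?_
    have h2 := ψ.coeff_eq hg hγ (Metric.isOpen_ball.preimage hl.continuous) hI
      (fun s hs ↦ hball hs) (V := fun s ↦ ψ'.frame g (ψ'.invFun (ψ'.toFun (l s))) v)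
      (fun s _ ↦ ψ'.isParallelAt_frame hg hγ ⟨_, rfl⟩ v) (a := 1) (b := 0)
      (by simpa [I, l] using hz) (by simpa [I, l] using hr)
    have h3 : l 1 = z := by simp [l]
    have h4 : l 0 = y := by simp [l]
    rw [h3, h4] at h2
    exact h2
  choose! r hr h2 using h1
  -- By the Lindelöf property, countably many of these balls cover `O`.
  obtain ⟨t, htO, ht, hcov⟩ := TopologicalSpace.countable_cover_nhdsWithin
    (f := fun y ↦ Metric.ball y (r y)) (s := O)
    fun y hy ↦ mem_nhdsWithin_of_mem_nhds (Metric.ball_mem_nhds y (hr y hy))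
  refine (ht.image fun y ↦ transition g ψ ψ' (ψ'.toFun y)).mono ?_
  rintro _ ⟨_, ⟨h3, z, rfl⟩, rfl⟩
  obtain ⟨y, hy, hz⟩ := mem_iUnion₂.1 (hcov (show z ∈ O from h3))
  exact ⟨y, hy, (h2 y (htO hy) z hz).symm⟩

end LocalParametrization

end Flat

end PseudoRiemannianMetric

namespace PseudoRiemannianMetric

open Set Filter Topology LinearODE Connection

section Flat

variable {E : Type*} [NormedAddCommGroup E] [InnerProductSpace ℝ E] [FiniteDimensional ℝ E]
  {M : Type*} [TopologicalSpace M] [ChartedSpace E M] [IsManifold 𝓘(ℝ, E) ∞ M]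
  {g : PseudoRiemannianMetric E M}

/-- With respect to parallel frames whose domains cover the manifold, every parallel transport is a
product of values of the transition functions. -/
theorem IsTransport.coeff_mem (hg : g.IsFlat) {ι : Type*} (ψ : ι → LocalParametrization E M)
    (hcov : ∀ q, ∃ i, q ∈ range (ψ i).toFun) {S : Submonoid (E →L[ℝ] E)}
    (hS : ∀ i j, ∀ q, q ∈ range (ψ i).toFun → q ∈ range (ψ j).toFun →
      (ψ i).transition g (ψ j) q ∈ S)
    {p q : M} {P : E →L[ℝ] E} (hP : g.IsTransport p q P) (i j : ι)
    (hp : p ∈ range (ψ i).toFun) (hq : q ∈ range (ψ j).toFun) :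
    (ψ j).coeff g ((ψ j).invFun q) * P * (ψ i).frame g ((ψ i).invFun p) ∈ S := by
  induction hP generalizing j with
  | refl =>
    refine (congrArg (· ∈ S) ?_).mp (hS j i p hq hp)
    rw [LocalParametrization.transition]
    rfl
  | step γ hγ P Q _ hQ ih =>
    let C : ι → M → E →L[ℝ] E := fun i q ↦ (ψ i).coeff g ((ψ i).invFun q)
    let F : ι → M → E →L[ℝ] E := fun i q ↦ (ψ i).frame g ((ψ i).invFun q)
    have hFC : ∀ i q v, F i q (C i q v) = v := fun i q v ↦
      DFunLike.congr_fun ((ψ i).frame_mul_coeff _) v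
    have hCF : ∀ i q v, C i q (F i q v) = v := fun i q v ↦
      DFunLike.congr_fun ((ψ i).coeff_mul_frame _) v
    obtain ⟨k, hk⟩ := hcov (γ 0)
    have hPk := ih k hk
    -- The times up to which the transport along `γ` is, in the frames, a constant element of `S`. This
    -- set is open and closed, because coefficients in a single frame do not change.
    let R : Set ℝ := {t | ∃ j, γ t ∈ range (ψ j).toFun ∧ ∃ A ∈ S, ∀ V : ℝ → E,
      (∀ s, g.IsParallelAt γ V s) → C j (γ t) (V t) = A (C k (γ 0) (V 0))}
    -- The condition on `t` does not depend on the frame.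
    have hchange : ∀ t i j, γ t ∈ range (ψ i).toFun → γ t ∈ range (ψ j).toFun →
        (∃ A ∈ S, ∀ V : ℝ → E, (∀ s, g.IsParallelAt γ V s) →
          C i (γ t) (V t) = A (C k (γ 0) (V 0))) →
        ∃ A ∈ S, ∀ V : ℝ → E, (∀ s, g.IsParallelAt γ V s) →
          C j (γ t) (V t) = A (C k (γ 0) (V 0)) := by
      rintro t i j hi hj ⟨A, hA, h⟩
      refine ⟨_, S.mul_mem (hS j i (γ t) hj hi) hA, fun V hV ↦ ?_⟩
      change _ = C j (γ t) (F i (γ t) (A (C k (γ 0) (V 0))))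
      rw [← h V hV, hFC]
    have hstep : ∀ t, ∃ U ∈ 𝓝 t, ∀ a ∈ U, ∀ b ∈ U, a ∈ R → b ∈ R := fun t ↦ by
      obtain ⟨l, hl⟩ := hcov (γ t)
      have hO : IsOpen (γ ⁻¹' range (ψ l).toFun) := (ψ l).isOpen_range.preimage hγ.continuous
      obtain ⟨r, hr, hball⟩ := Metric.isOpen_iff.1 hO t hl
      refine ⟨Metric.ball t r, Metric.ball_mem_nhds t hr, ?_⟩
      rintro a ha b hb ⟨i, hi, h⟩
      obtain ⟨A, hA, h⟩ := hchange a i l hi (hball ha) h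
      refine ⟨l, hball hb, A, hA, fun V hV ↦ ?_⟩
      rw [← h V hV]
      exact (ψ l).coeff_eq hg hγ Metric.isOpen_ball (convex_ball t r).isPreconnected
        (fun s hs ↦ hball hs) (fun s _ ↦ hV s) hb ha
    have hopen : IsOpen R := isOpen_iff_mem_nhds.2 fun q hq ↦ by
      obtain ⟨U, hU, h⟩ := hstep q
      exact mem_of_superset hU fun b hb ↦ h q (mem_of_mem_nhds hU) b hb hq
    have hclosed : IsClosed R := by
      rw [← isOpen_compl_iff]
      refine isOpen_iff_mem_nhds.2 fun q hq ↦ ?_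
      obtain ⟨U, hU, h⟩ := hstep q
      exact mem_of_superset hU fun b hb hb' ↦ hq (h b hb q (mem_of_mem_nhds hU) hb')
    have huniv : R = univ := IsClopen.eq_univ ⟨hclosed, hopen⟩
      ⟨0, k, hk, 1, S.one_mem, fun V _ ↦ rfl⟩
    obtain ⟨l, hl, h⟩ : (1 : ℝ) ∈ R := huniv ▸ mem_univ _
    obtain ⟨A, hA, h⟩ := hchange 1 l j hl hq h
    refine (congrArg (· ∈ S) ?_).mp (S.mul_mem hA hPk)
    refine ContinuousLinearMap.ext fun v ↦ ?_
    obtain ⟨V, hV, hV0, hV1⟩ := hQ (P (F i p v))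
    have h1 := h V hV
    change A (C k (γ 0) (P (F i p v))) = C j (γ 1) (Q (P (F i p v)))
    exact ((congrArg (fun x : E ↦ A (C k (γ 0) x)) hV0).symm.trans h1.symm).trans
      (congrArg (C j (γ 1)) hV1)

/-- The holonomy group of a flat metric is countable, so its Lie algebra is zero. -/
theorem IsFlat.eq_zero_of_mem_holonomyAlgebra [SecondCountableTopology M] (hg : g.IsFlat) {p : M}
    {A : E →L[ℝ] E} (hA : A ∈ g.holonomyAlgebra p) : A = 0 := by
  choose ψ hψ using fun x : M ↦ exists_localParametrization (E := E) x
  have hmem : ∀ x, x ∈ range (ψ x).toFun := fun x ↦ ⟨0, hψ x⟩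
  obtain ⟨s, hs, hcov⟩ := TopologicalSpace.countable_cover_nhds
    (f := fun x ↦ range (ψ x).toFun) fun x ↦ (ψ x).isOpen_range.mem_nhds (hmem x)
  have : Countable s := hs
  -- The transition functions of countably many frames whose domains cover `M`.
  let T : Set (E →L[ℝ] E) := ⋃ i : s, ⋃ j : s,
    (ψ i).transition g (ψ j) '' (range (ψ i).toFun ∩ range (ψ j).toFun)
  have hT : T.Countable := countable_iUnion fun i ↦ countable_iUnion fun j ↦
    (ψ i).countable_transition hg (ψ j)
  have hcov' : ∀ q, ∃ i : s, q ∈ range (ψ i).toFun := fun q ↦ by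
    obtain ⟨x, hx, hq⟩ := mem_iUnion₂.1 (hcov ▸ mem_univ q)
    exact ⟨⟨x, hx⟩, hq⟩
  have hS : ∀ i j : s, ∀ q, q ∈ range (ψ i).toFun → q ∈ range (ψ j).toFun →
      (ψ i).transition g (ψ j) q ∈ Submonoid.closure T := fun i j q hq hq' ↦ by
    refine Submonoid.subset_closure (mem_iUnion.2 ⟨i, mem_iUnion.2 ⟨j, q, ⟨hq, hq'⟩, rfl⟩⟩)
  obtain ⟨i, hi⟩ := hcov' p
  let F := (ψ i).frame g ((ψ i).invFun p)
  let C := (ψ i).coeff g ((ψ i).invFun p)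
  have hFC : F * C = 1 := (ψ i).frame_mul_coeff _
  obtain ⟨c, hc, hc0, hcm, hcA⟩ := hA
  have h1 : ∀ t, c t ∈ (fun X ↦ F * X * C) '' (Submonoid.closure T : Set (E →L[ℝ] E)) := fun t ↦ by
    refine ⟨C * c t * F, IsTransport.coeff_mem hg (fun i : s ↦ ψ i) hcov' hS (hcm t) i i hi hi, ?_⟩
    change F * (C * c t * F) * C = c t
    calc F * (C * c t * F) * C = (F * C) * c t * (F * C) := by noncomm_ring
      _ = c t := by rw [hFC, one_mul, mul_one]
  have h2 : ∀ t, c t = c 0 := fun t ↦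
    hc.continuous.eq_of_countable ((Submonoid.countable_closure hT).image _) h1 t 0
  have h3 : c = fun _ ↦ c 0 := funext h2
  rw [h3] at hcA
  exact hcA.unique (hasDerivAt_const _ _)

/-- If the holonomy algebra is spanned by a complex structure and the dimension is at least three,
then the metric is flat, by the first Bianchi identity. -/
theorem isFlat_of_holonomy_complexStructure [ConnectedSpace M] (hdim : 3 ≤ Module.finrank ℝ E)
    {p : M} {J : E →L[ℝ] E} (hJ : J * J = -1)
    (h : ∀ A ∈ g.holonomyAlgebra p, ∃ r : ℝ, A = r • J) : g.IsFlat := by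
  intro ψ y u v
  have : CompleteSpace E := FiniteDimensional.complete ℝ E
  obtain ⟨P, hP⟩ := exists_isTransport (g := g) p (ψ.toFun y)
  obtain ⟨P', hP', hPP', hP'P⟩ := hP.exists_inverse
  let D := ψ.diff y
  let D' := ψ.diffInv y
  have hD1 : D' * D = 1 := ContinuousLinearMap.ext (ψ.diffInv_diff y)
  have hD2 : D * D' = 1 := ContinuousLinearMap.ext (ψ.diff_diffInv y)
  have hP1 : P' * P = 1 := hPP'
  have hP2 : P * P' = 1 := hP'P
  -- The complex structure `J`, transported to `y`.
  let K : E →L[ℝ] E := D' * P * J * P' * D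
  have hK : K * K = -1 := by
    calc K * K = D' * P * J * (P' * (D * D') * P) * J * P' * D := by noncomm_ring
      _ = D' * (P * (J * J) * P') * D := by rw [hD2, mul_one, hP1]; noncomm_ring
      _ = -1 := by
        rw [hJ, mul_neg, neg_mul, mul_one, hP2, mul_neg, neg_mul, mul_one, hD1]
  -- The curvature at `y`, transported to `p`, belongs to the holonomy algebra.
  have hcurv : ∀ u v, ∃ r : ℝ, curv (ψ.pullback g).gamma y u v = r • K := fun u v ↦ by
    have h1 := ψ.holonomy_push (curv_mem_holonomySubmodule (g := ψ.pullback g) y u v)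
    obtain ⟨r, hr⟩ := h _ (hP.conj_mem hP' hPP' h1)
    refine ⟨r, ?_⟩
    have h2 : P' * (D * curv (ψ.pullback g).gamma y u v * D') * P = r • J := hr
    calc curv (ψ.pullback g).gamma y u v
        = (D' * D) * curv (ψ.pullback g).gamma y u v * (D' * D) := by
          rw [hD1, one_mul, mul_one]
      _ = D' * ((P * P') * (D * curv (ψ.pullback g).gamma y u v * D') * (P * P')) * D := by
          rw [hP2, one_mul, mul_one]; noncomm_ring
      _ = D' * P * (P' * (D * curv (ψ.pullback g).gamma y u v * D') * P) * P' * D := by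
          noncomm_ring
      _ = r • K := by
          rw [h2]; simp only [K, mul_smul_comm, smul_mul_assoc]
  choose κ hκ using hcurv
  have hKK : ∀ w, K (K w) = -w := fun w ↦ DFunLike.congr_fun hK w
  -- Apply `K` to the Bianchi identity for a vector outside of the plane of `u` and `v`.
  obtain ⟨w, hw⟩ : ∃ w, w ∉ Submodule.span ℝ {u, v} := by
    by_contra! hcon
    have h1 : Submodule.span ℝ ({u, v} : Set E) = ⊤ := Submodule.eq_top_iff'.2 hcon
    classical
    have h2 := finrank_span_finset_le_card (R := ℝ) ({u, v} : Finset E)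
    rw [Finset.coe_pair, Set.finrank, h1, finrank_top] at h2
    have h3 := Finset.card_le_two (a := u) (b := v)
    omega
  have h1 := bianchi (g := ψ.pullback g) y u v w
  rw [hκ, hκ, hκ] at h1
  have h2 := congrArg K h1
  simp only [map_add, map_zero, _root_.smul_apply, map_smul, hKK] at h2
  have h3 : κ u v = 0 := by
    by_contra hne
    refine hw ?_
    have h4 : w = (-(κ u v)⁻¹ * κ v w) • u + (-(κ u v)⁻¹ * κ w u) • v := by
      have h5 : κ u v • w = -(κ v w • u) - κ w u • v := by
        rw [← sub_eq_zero, ← neg_eq_zero, ← h2]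
        module
      calc w = (κ u v)⁻¹ • (κ u v • w) := by rw [smul_smul, inv_mul_cancel₀ hne, one_smul]
        _ = _ := by rw [h5]; module
    rw [h4]
    exact Submodule.add_mem _
      (Submodule.smul_mem _ _ (Submodule.subset_span (by simp)))
      (Submodule.smul_mem _ _ (Submodule.subset_span (by simp)))
  rw [hκ, h3, zero_smul]

end Flat

end PseudoRiemannianMetric

/-! ### A subalgebra of `so(4)` that is not a Riemannian holonomy algebra -/

/-- The standard complex structure of `ℝ⁴`. -/
def complexStructure : Matrix (Fin 4) (Fin 4) ℝ :=
  !![0, -1, 0, 0; 1, 0, 0, 0; 0, 0, 0, -1; 0, 0, 1, 0]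

theorem complexStructure_mul_self : complexStructure * complexStructure = -1 := by
  ext i j
  fin_cases i <;> fin_cases j <;>
    simp [complexStructure, Matrix.mul_apply, Fin.sum_univ_four]

theorem complexStructure_mem_so : complexStructure ∈ LieAlgebra.Orthogonal.so (Fin 4) ℝ := by
  rw [LieAlgebra.Orthogonal.mem_so]
  ext i j
  fin_cases i <;> fin_cases j <;> simp [complexStructure]

/-- The line in `so(4)` spanned by the standard complex structure, a copy of `u(1)`. -/
def complexStructureLine : LieSubalgebra ℝ (LieAlgebra.Orthogonal.so (Fin 4) ℝ) where
  __ := Submodule.span ℝ {(⟨complexStructure, complexStructure_mem_so⟩ :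
    LieAlgebra.Orthogonal.so (Fin 4) ℝ)}
  lie_mem' := by
    intro x y hx hy
    obtain ⟨a, rfl⟩ := Submodule.mem_span_singleton.1 hx
    obtain ⟨b, rfl⟩ := Submodule.mem_span_singleton.1 hy
    simp only [smul_lie, lie_smul, lie_self, smul_zero]
    exact Submodule.zero_mem _

theorem mem_complexStructureLine {C : LieAlgebra.Orthogonal.so (Fin 4) ℝ} :
    C ∈ complexStructureLine ↔
      ∃ r : ℝ, r • (⟨complexStructure, complexStructure_mem_so⟩ :
        LieAlgebra.Orthogonal.so (Fin 4) ℝ) = C :=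
  Submodule.mem_span_singleton

namespace PseudoRiemannianMetric

/-- No holonomy algebra on a connected second countable manifold of dimension four is the line spanned
by a complex structure: the metric would be flat, and then its holonomy algebra would be zero. -/
theorem holonomyMatrices_ne_complexStructureLine {M : Type*} [TopologicalSpace M]
    [SecondCountableTopology M] [ConnectedSpace M]
    [ChartedSpace (EuclideanSpace ℝ (Fin 4)) M]
    [IsManifold 𝓘(ℝ, EuclideanSpace ℝ (Fin 4)) ∞ M]
    (g : PseudoRiemannianMetric (EuclideanSpace ℝ (Fin 4)) M) (p : M)
    (b : Module.Basis (Fin 4) ℝ (TangentSpace 𝓘(ℝ, EuclideanSpace ℝ (Fin 4)) p)) :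
    g.holonomyMatrices p b ≠ {B | ∃ C ∈ complexStructureLine, B = C.1} := by
  intro h
  let b' : Module.Basis (Fin 4) ℝ (EuclideanSpace ℝ (Fin 4)) := b
  let J : EuclideanSpace ℝ (Fin 4) →L[ℝ] EuclideanSpace ℝ (Fin 4) :=
    LinearMap.toContinuousLinearMap (Matrix.toLin b' b' complexStructure)
  have hJ : J * J = -1 := by
    refine ContinuousLinearMap.coe_injective ?_
    change Matrix.toLin b' b' complexStructure ∘ₗ Matrix.toLin b' b' complexStructure = -LinearMap.id
    rw [← Matrix.toLin_mul, complexStructure_mul_self, map_neg, Matrix.toLin_one]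
  have hflat : g.IsFlat := by
    refine isFlat_of_holonomy_complexStructure (by simp) hJ (p := p) fun A hA ↦ ?_
    have h1 : LinearMap.toMatrix b' b' (A : _ →ₗ[ℝ] _) ∈ g.holonomyMatrices p b := ⟨A, hA, rfl⟩
    rw [h] at h1
    obtain ⟨C, hC, h2⟩ := h1
    obtain ⟨r, rfl⟩ := mem_complexStructureLine.1 hC
    refine ⟨r, ContinuousLinearMap.coe_injective ?_⟩
    refine (LinearMap.toMatrix b' b').injective ?_
    rw [h2]
    change r • complexStructure = LinearMap.toMatrix b' b' (r • Matrix.toLin b' b' complexStructure)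
    rw [map_smul, LinearMap.toMatrix_toLin]
  have h3 : complexStructure ∈ g.holonomyMatrices p b := by
    rw [h]
    exact ⟨⟨_, complexStructure_mem_so⟩, mem_complexStructureLine.2 ⟨1, one_smul _ _⟩, rfl⟩
  obtain ⟨A, hA, h4⟩ := h3
  rw [hflat.eq_zero_of_mem_holonomyAlgebra hA] at h4
  have h5 : complexStructure = LinearMap.toMatrix b' b' 0 := h4
  rw [map_zero] at h5
  have h6 := congrFun (congrFun h5 1) 0
  simp [complexStructure] at h6

end PseudoRiemannianMetric

/-! ### The Christoffel symbols of the polynomial metric -/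

namespace PolynomialMetric

open Set Filter Topology LinearODE Connection PseudoRiemannianMetric

variable {n N : ℕ} (A : Fin N → Matrix (Fin n) (Fin n) ℝ)

/-- The coefficients of `e₁, …, eₙ`. -/
def ePart (v : Idx n → ℝ) : Fin n → ℝ := fun i ↦ v (Idx.e i)

/-- The matrix polynomial `a(t) = ∑ A_α t^α`, for which `u = a(xⁿ⁺³) x`. -/
def poly (t : ℝ) : Matrix (Fin n) (Fin n) ℝ := ∑ α : Fin N, t ^ (α.1 + 1) • A α

/-- The first derivative of `poly`. -/
def polyDeriv (t : ℝ) : Matrix (Fin n) (Fin n) ℝ := ∑ α : Fin N, ((α.1 + 1) * t ^ α.1) • A α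

theorem hasDerivAt_poly (i j : Fin n) (t : ℝ) :
    HasDerivAt (fun t ↦ poly A t i j) (polyDeriv A t i j) t := by
  simp only [poly, polyDeriv, Matrix.sum_apply, Matrix.smul_apply, smul_eq_mul]
  refine HasDerivAt.fun_sum fun α _ ↦ (HasDerivAt.mul_const ?_ _)
  simpa using hasDerivAt_pow (α.1 + 1) t

theorem continuous_poly (i j : Fin n) : Continuous (fun t ↦ poly A t i j) := by
  simp only [poly, Matrix.sum_apply, Matrix.smul_apply, smul_eq_mul]
  fun_prop

theorem poly_zero : poly A 0 = 0 := by simp [poly]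

theorem uFun_eq (i : Fin n) (y : Idx n → ℝ) :
    uFun A i y = (poly A (y (Idx.q 0)) *ᵥ ePart y) i := by
  simp only [uFun, poly, Matrix.mulVec, dotProduct, Matrix.sum_apply, Matrix.smul_apply,
    smul_eq_mul, Finset.sum_mul, ePart]
  rw [Finset.sum_comm]
  exact Finset.sum_congr rfl fun j _ ↦ Finset.sum_congr rfl fun α _ ↦ by ring

theorem fFun_eq (y : Idx n → ℝ) : fFun y = ePart y ⬝ᵥ ePart y := by
  simp only [fFun, ePart, dotProduct, pow_two]

theorem form_polynomialMetric (y v w : Idx n → ℝ) : (polynomialMetric A).form y v w =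
    (v (Idx.p 0) * w (Idx.q 0) + v (Idx.q 0) * w (Idx.p 0))
      + (v (Idx.p 1) * w (Idx.q 1) + v (Idx.q 1) * w (Idx.p 1)) + ePart v ⬝ᵥ ePart w
      + (poly A (y (Idx.q 0)) *ᵥ ePart y) ⬝ᵥ (w (Idx.q 1) • ePart v + v (Idx.q 1) • ePart w)
      + (ePart y ⬝ᵥ ePart y) * (v (Idx.q 0) * w (Idx.q 0) + v (Idx.q 1) * w (Idx.q 1)) := by
  refine (metricForm_apply A y v w).trans ?_
  simp only [uFun_eq, fFun_eq]
  have h : ∑ i, (poly A (y (Idx.q 0)) *ᵥ ePart y) i *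
      (v (Idx.e i) * w (Idx.q 1) + v (Idx.q 1) * w (Idx.e i)) =
      (poly A (y (Idx.q 0)) *ᵥ ePart y) ⬝ᵥ (w (Idx.q 1) • ePart v + v (Idx.q 1) • ePart w) := by
    refine Finset.sum_congr rfl fun i _ ↦ ?_
    simp only [ePart, Pi.add_apply, Pi.smul_apply, smul_eq_mul]
    ring
  rw [h, show ∑ i, v (Idx.e i) * w (Idx.e i) = ePart v ⬝ᵥ ePart w from rfl]
  ring

/-- The first derivative of the functions `uⁱ`. -/
def uDeriv (y u : Idx n → ℝ) : Fin n → ℝ :=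
  poly A (y (Idx.q 0)) *ᵥ ePart u + u (Idx.q 0) • (polyDeriv A (y (Idx.q 0)) *ᵥ ePart y)

theorem hasDerivAt_dotProduct {v w : ℝ → Fin n → ℝ} {v' w' a b : Fin n → ℝ} {t : ℝ}
    (hv : ∀ i, HasDerivAt (fun s ↦ v s i) (v' i) t) (hw : ∀ i, HasDerivAt (fun s ↦ w s i) (w' i) t)
    (ha : v t = a) (hb : w t = b) :
    HasDerivAt (fun s ↦ v s ⬝ᵥ w s) (v' ⬝ᵥ b + a ⬝ᵥ w') t := by
  subst ha hb
  simp only [dotProduct, ← Finset.sum_add_distrib]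
  exact HasDerivAt.fun_sum fun i _ ↦ (hv i).mul (hw i)

theorem hasDerivAt_mulVec {a : ℝ → Matrix (Fin n) (Fin n) ℝ} {v : ℝ → Fin n → ℝ}
    {a' m : Matrix (Fin n) (Fin n) ℝ} {v' b : Fin n → ℝ} {t : ℝ}
    (ha : ∀ i j, HasDerivAt (fun s ↦ a s i j) (a' i j) t)
    (hv : ∀ i, HasDerivAt (fun s ↦ v s i) (v' i) t) (hm : a t = m) (hb : v t = b) (i : Fin n) :
    HasDerivAt (fun s ↦ (a s *ᵥ v s) i) ((a' *ᵥ b + m *ᵥ v') i) t := by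
  subst hm hb
  simp only [Matrix.mulVec, Pi.add_apply]
  exact hasDerivAt_dotProduct (ha i) hv rfl rfl

variable {A}

theorem hasDerivAt_coord_line (y u : Idx n → ℝ) (k : Idx n) :
    HasDerivAt (fun s : ℝ ↦ (y + s • u) k) (u k) 0 := by
  simpa using ((hasDerivAt_id (0 : ℝ)).mul_const (u k)).const_add (y k)

attribute [local instance] normedAddCommGroupBilin normedSpaceBilin normedAddCommGroupTrilin
  normedSpaceTrilin

theorem hasDerivAt_form_line (g : PseudoRiemannianMetric (Idx n → ℝ) (Idx n → ℝ))
    (y u v w : Idx n → ℝ) :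
    HasDerivAt (fun s : ℝ ↦ g.form (y + s • u) v w) (fderiv ℝ g.form y u v w) 0 :=
  hasDerivAt_eval (hasDerivAt_eval (hasDerivAt_comp_line
    ((g.contDiff_form.differentiable (by simp) y).hasFDerivAt) u) v) w

/-- The derivative of the polynomial metric at `y` in the direction of `u`. -/
theorem fderiv_form (y u v w : Idx n → ℝ) : fderiv ℝ (polynomialMetric A).form y u v w =
    uDeriv A y u ⬝ᵥ (w (Idx.q 1) • ePart v + v (Idx.q 1) • ePart w)
      + 2 * (ePart y ⬝ᵥ ePart u) * (v (Idx.q 0) * w (Idx.q 0) + v (Idx.q 1) * w (Idx.q 1)) := by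
  have h1 := hasDerivAt_form_line (polynomialMetric A) y u v w
  have hx : ∀ i, HasDerivAt (fun s : ℝ ↦ ePart (y + s • u) i) (ePart u i) 0 := fun i ↦
    hasDerivAt_coord_line y u _
  have h0 : y + (0 : ℝ) • u = y := by simp
  have h2 : ∀ i, HasDerivAt (fun s : ℝ ↦ (poly A ((y + s • u) (Idx.q 0)) *ᵥ ePart (y + s • u)) i)
      (uDeriv A y u i) 0 := fun i ↦ by
    refine (hasDerivAt_mulVec (m := poly A (y (Idx.q 0))) (b := ePart y)
      (a := fun s : ℝ ↦ poly A ((y + s • u) (Idx.q 0)))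
      (v := fun s : ℝ ↦ ePart (y + s • u)) (a' := u (Idx.q 0) • polyDeriv A (y (Idx.q 0)))
      (fun i j ↦ ?_) hx (by rw [h0]) (by rw [h0]) i).congr_deriv ?_
    · exact HasDerivAt.scomp (g₁ := fun t ↦ poly A t i j) (h := fun s : ℝ ↦ (y + s • u) (Idx.q 0)) 0
        (by rw [h0]; exact hasDerivAt_poly A i j _) (hasDerivAt_coord_line y u _)
    · rw [uDeriv, Matrix.smul_mulVec, add_comm]
  have h3 := (((hasDerivAt_const (0 : ℝ) ((v (Idx.p 0) * w (Idx.q 0) + v (Idx.q 0) * w (Idx.p 0))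
      + (v (Idx.p 1) * w (Idx.q 1) + v (Idx.q 1) * w (Idx.p 1)) + ePart v ⬝ᵥ ePart w)).add
    (hasDerivAt_dotProduct (w := fun _ ↦ w (Idx.q 1) • ePart v + v (Idx.q 1) • ePart w)
      (w' := 0) h2 (fun i ↦ hasDerivAt_const _ _) rfl rfl)).add
    ((hasDerivAt_dotProduct hx hx (a := ePart y) (b := ePart y) (by rw [h0]) (by rw [h0])).mul_const
      (v (Idx.q 0) * w (Idx.q 0) + v (Idx.q 1) * w (Idx.q 1))))
  have h4 : (fun s : ℝ ↦ (polynomialMetric A).form (y + s • u) v w) = _ :=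
    funext fun s ↦ form_polynomialMetric A _ v w
  rw [h4] at h1
  refine (h1.unique h3).trans ?_
  rw [dotProduct_zero, dotProduct_comm (ePart u)]
  ring

/-- The Christoffel symbols of the first kind of the polynomial metric, at an arbitrary point. -/
theorem christoffelFirst_eq (y u v w : Idx n → ℝ) :
    christoffelFirst (polynomialMetric A).form y u v w =
      (uDeriv A y u ⬝ᵥ (w (Idx.q 1) • ePart v + v (Idx.q 1) • ePart w)
        + uDeriv A y v ⬝ᵥ (w (Idx.q 1) • ePart u + u (Idx.q 1) • ePart w)
        - uDeriv A y w ⬝ᵥ (v (Idx.q 1) • ePart u + u (Idx.q 1) • ePart v)) / 2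
      + (ePart y ⬝ᵥ ePart u) * (v (Idx.q 0) * w (Idx.q 0) + v (Idx.q 1) * w (Idx.q 1))
      + (ePart y ⬝ᵥ ePart v) * (u (Idx.q 0) * w (Idx.q 0) + u (Idx.q 1) * w (Idx.q 1))
      - (ePart y ⬝ᵥ ePart w) * (u (Idx.q 0) * v (Idx.q 0) + u (Idx.q 1) * v (Idx.q 1)) := by
  rw [christoffelFirst_apply, fderiv_form, fderiv_form, fderiv_form]
  ring

theorem transpose_poly (hA : ∀ α, (A α)ᵀ = -A α) (t : ℝ) : (poly A t)ᵀ = -poly A t := by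
  simp [poly, Matrix.transpose_sum, hA]

theorem transpose_polyDeriv (hA : ∀ α, (A α)ᵀ = -A α) (t : ℝ) :
    (polyDeriv A t)ᵀ = -polyDeriv A t := by
  simp [polyDeriv, Matrix.transpose_sum, hA]

theorem mulVec_dotProduct_of_skew {a : Matrix (Fin n) (Fin n) ℝ} (ha : aᵀ = -a)
    (v w : Fin n → ℝ) : (a *ᵥ v) ⬝ᵥ w = -((a *ᵥ w) ⬝ᵥ v) := by
  rw [dotProduct_comm (a *ᵥ v), Matrix.dotProduct_mulVec, ← Matrix.mulVec_transpose, ha,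
    Matrix.neg_mulVec, neg_dotProduct]

end PolynomialMetric

/-! ### The curvature in terms of the Christoffel symbols of the first kind -/

namespace PseudoRiemannianMetric

open Set Filter Topology LinearODE Connection

variable {E : Type*} [NormedAddCommGroup E] [NormedSpace ℝ E] [FiniteDimensional ℝ E]
  {g : PseudoRiemannianMetric E E}

attribute [local instance] normedAddCommGroupBilin normedSpaceBilin normedAddCommGroupTrilin
  normedSpaceTrilin

theorem fderiv_form_eq_gamma (x u a b : E) :
    fderiv ℝ g.form x u a b = g.form x (g.gamma x u a) b + g.form x (g.gamma x u b) a := by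
  rw [form_gamma, form_gamma, christoffelFirst_apply, christoffelFirst_apply,
    g.fderiv_form_symm x u b a]
  ring

/-- The derivative of the Christoffel symbols of the first kind in terms of those of the second. -/
theorem christoffelFirst_deriv_eq {x u v z w : E} {k : ℝ}
    (h : HasDerivAt (fun s : ℝ ↦ christoffelFirst g.form (x + s • u) v z w) k 0) :
    k = g.form x (g.gamma x u (g.gamma x v z)) w + g.form x (g.gamma x u w) (g.gamma x v z)
      + g.form x (fderiv ℝ g.gamma x u v z) w := by
  have h0 : x + (0 : ℝ) • u = x := by simp
  have h1 := hasDerivAt_comp_line (g.contDiff_form.differentiable (by simp) x).hasFDerivAt u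
  have h2 := hasDerivAt_eval (hasDerivAt_eval (hasDerivAt_comp_line
    (g.contDiff_gamma.differentiable (by simp) x).hasFDerivAt u) v) z
  have h3 := hasDerivAt_bilin h1 h2 (hasDerivAt_const (0 : ℝ) w) (G := g.form x)
    (a := g.gamma x v z) (b := w) (by rw [h0]) (by rw [h0]) rfl
  have h4 : (fun s : ℝ ↦ christoffelFirst g.form (x + s • u) v z w) = fun s : ℝ ↦
      g.form (x + s • u) (g.gamma (x + s • u) v z) w := funext fun s ↦ (g.form_gamma _ _ _ _).symm
  rw [h4] at h
  rw [h.unique h3, fderiv_form_eq_gamma, map_zero, add_zero]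

/-- The curvature in terms of the Christoffel symbols of the first kind. -/
theorem form_curv {x u v z w : E} {k l : ℝ}
    (hk : HasDerivAt (fun s : ℝ ↦ christoffelFirst g.form (x + s • u) v z w) k 0)
    (hl : HasDerivAt (fun s : ℝ ↦ christoffelFirst g.form (x + s • v) u z w) l 0) :
    g.form x (curv g.gamma x u v z) w = k - l - g.form x (g.gamma x v z) (g.gamma x u w)
      + g.form x (g.gamma x u z) (g.gamma x v w) := by
  have h : curv g.gamma x u v z = fderiv ℝ g.gamma x u v z - fderiv ℝ g.gamma x v u z
      + (g.gamma x u (g.gamma x v z) - g.gamma x v (g.gamma x u z)) := by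
    simp only [curv, _root_.add_apply, _root_.sub_apply, add_sub_assoc]
    rfl
  rw [h, christoffelFirst_deriv_eq hk, christoffelFirst_deriv_eq hl,
    g.form_symm x (g.gamma x v z), g.form_symm x (g.gamma x u z)]
  simp only [map_add, map_sub, _root_.add_apply, _root_.sub_apply]
  ring

end PseudoRiemannianMetric

/-! ### The curvature of the polynomial metric along the axis of `xⁿ⁺³` -/

namespace PolynomialMetric

open Set Filter Topology LinearODE Connection PseudoRiemannianMetric

variable {n N : ℕ} {A : Fin N → Matrix (Fin n) (Fin n) ℝ}

/-- The points of the axis of the coordinate `xⁿ⁺³`. -/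
def axis (t : ℝ) : Idx n → ℝ := Pi.single (Idx.q 0) t

/-- The vector with coefficients `x` at `e₁, …, eₙ`, and zero elsewhere. -/
def eVec (x : Fin n → ℝ) : Idx n → ℝ := Sum.elim 0 (Sum.elim x 0)

@[simp] theorem ePart_axis (t : ℝ) : ePart (axis t : Idx n → ℝ) = 0 := by
  funext i
  simp [ePart, axis]

@[simp] theorem axis_q_zero (t : ℝ) : (axis t : Idx n → ℝ) (Idx.q 0) = t := by simp [axis]

@[simp] theorem ePart_eVec (x : Fin n → ℝ) : ePart (eVec x) = x := rfl

@[simp] theorem eVec_p (x : Fin n → ℝ) (a : Fin 2) : eVec x (Idx.p a) = 0 := rfl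

@[simp] theorem eVec_q (x : Fin n → ℝ) (a : Fin 2) : eVec x (Idx.q a) = 0 := rfl

@[simp] theorem ePart_add (v w : Idx n → ℝ) : ePart (v + w) = ePart v + ePart w := rfl

@[simp] theorem ePart_smul (r : ℝ) (v : Idx n → ℝ) : ePart (r • v) = r • ePart v := rfl

theorem form_axis (t : ℝ) (v w : Idx n → ℝ) : (polynomialMetric A).form (axis t) v w =
    (v (Idx.p 0) * w (Idx.q 0) + v (Idx.q 0) * w (Idx.p 0))
      + (v (Idx.p 1) * w (Idx.q 1) + v (Idx.q 1) * w (Idx.p 1)) + ePart v ⬝ᵥ ePart w := by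
  rw [form_polynomialMetric]
  simp

/-- The Christoffel symbols along the axis. -/
theorem gamma_axis (hA : ∀ α, (A α)ᵀ = -A α) (t : ℝ) (u v : Idx n → ℝ) :
    (polynomialMetric A).gamma (axis t) u v =
      eVec (v (Idx.q 1) • (poly A t *ᵥ ePart u) + u (Idx.q 1) • (poly A t *ᵥ ePart v)) := by
  refine (polynomialMetric A).eq_of_form_eq (y := axis t) fun w ↦ ?_
  have h := mulVec_dotProduct_of_skew (transpose_poly hA t)
  rw [form_gamma, christoffelFirst_eq, form_axis]
  simp only [uDeriv, ePart_axis, axis_q_zero, mulVec_zero, smul_zero, add_zero, zero_dotProduct,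
    zero_mul, sub_zero, dotProduct_add, dotProduct_smul, add_dotProduct, smul_dotProduct,
    smul_eq_mul, ePart_eVec, eVec_p, eVec_q, zero_add]
  rw [h (ePart v) (ePart u), h (ePart w) (ePart u), h (ePart w) (ePart v)]
  ring

variable (A) in
/-- The second derivative of the functions `uⁱ` at the points of the axis. -/
def uDeriv₂ (t : ℝ) (u v : Idx n → ℝ) : Fin n → ℝ :=
  u (Idx.q 0) • (polyDeriv A t *ᵥ ePart v) + v (Idx.q 0) • (polyDeriv A t *ᵥ ePart u)

/-- The functions `uⁱ` are products of a polynomial in `xⁿ⁺³` and a linear function of the `xⁱ`, so only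
mixed second derivatives are left where all `xⁱ` vanish. -/
theorem hasDerivAt_uDeriv (t : ℝ) (u v : Idx n → ℝ) (i : Fin n) :
    HasDerivAt (fun s : ℝ ↦ uDeriv A (axis t + s • u) v i) (uDeriv₂ A t u v i) 0 := by
  have hq : ∀ s : ℝ, (axis t + s • u : Idx n → ℝ) (Idx.q 0) = t + s * u (Idx.q 0) := fun s ↦ by
    simp
  have hτ : HasDerivAt (fun s : ℝ ↦ t + s * u (Idx.q 0)) (u (Idx.q 0)) 0 := by
    simpa using ((hasDerivAt_id (0 : ℝ)).mul_const (u (Idx.q 0))).const_add t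
  have hp (i j) : HasDerivAt (fun s : ℝ ↦ poly A (t + s * u (Idx.q 0)) i j)
      ((u (Idx.q 0) • polyDeriv A t) i j) 0 := by
    refine HasDerivAt.scomp (g₁ := fun t ↦ poly A t i j) (h := fun s : ℝ ↦ t + s * u (Idx.q 0))
      (g₁' := polyDeriv A t i j) 0 ?_ hτ
    rw [zero_mul, add_zero]
    exact hasDerivAt_poly A i j t
  have h1 : HasDerivAt (fun s : ℝ ↦ (poly A (t + s * u (Idx.q 0)) *ᵥ ePart v) i)
      ((u (Idx.q 0) • (polyDeriv A t *ᵥ ePart v)) i) 0 := by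
    refine (hasDerivAt_mulVec (v := fun _ ↦ ePart v) (v' := 0) hp
      (fun i ↦ hasDerivAt_const _ _) rfl rfl i).congr_deriv ?_
    rw [mulVec_zero, add_zero, Matrix.smul_mulVec]
  have h2 : HasDerivAt (fun s : ℝ ↦
      v (Idx.q 0) * (s * (polyDeriv A (t + s * u (Idx.q 0)) *ᵥ ePart u) i))
      (v (Idx.q 0) * (polyDeriv A t *ᵥ ePart u) i) 0 := by
    have h3 : Differentiable ℝ fun s : ℝ ↦
        (polyDeriv A (t + s * u (Idx.q 0)) *ᵥ ePart u) i := by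
      simp only [Matrix.mulVec, dotProduct, polyDeriv, Matrix.sum_apply, Matrix.smul_apply,
        smul_eq_mul]
      fun_prop
    refine (((hasDerivAt_id (0 : ℝ)).mul (h3 0).hasDerivAt).const_mul (v (Idx.q 0))).congr_deriv ?_
    simp
  refine ((h1.add h2).congr_of_eventuallyEq (.of_forall fun s ↦ ?_)).congr_deriv ?_
  · simp only [uDeriv, hq, ePart_add, ePart_smul, ePart_axis, zero_add, Matrix.mulVec_smul]
    rfl
  · rfl

/-- The derivative of the Christoffel symbols of the first kind at the points of the axis. -/
theorem hasDerivAt_christoffelFirst (t : ℝ) (u v z w : Idx n → ℝ) :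
    HasDerivAt (fun s : ℝ ↦ christoffelFirst (polynomialMetric A).form (axis t + s • u) v z w)
      ((uDeriv₂ A t u v ⬝ᵥ (w (Idx.q 1) • ePart z + z (Idx.q 1) • ePart w)
        + uDeriv₂ A t u z ⬝ᵥ (w (Idx.q 1) • ePart v + v (Idx.q 1) • ePart w)
        - uDeriv₂ A t u w ⬝ᵥ (z (Idx.q 1) • ePart v + v (Idx.q 1) • ePart z)) / 2
      + (ePart u ⬝ᵥ ePart v) * (z (Idx.q 0) * w (Idx.q 0) + z (Idx.q 1) * w (Idx.q 1))
      + (ePart u ⬝ᵥ ePart z) * (v (Idx.q 0) * w (Idx.q 0) + v (Idx.q 1) * w (Idx.q 1))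
      - (ePart u ⬝ᵥ ePart w) * (v (Idx.q 0) * z (Idx.q 0) + v (Idx.q 1) * z (Idx.q 1))) 0 := by
  have hd (a b : Idx n → ℝ) (c d : ℝ) (b' : Idx n → ℝ) : HasDerivAt (fun s : ℝ ↦
      uDeriv A (axis t + s • u) a ⬝ᵥ (c • ePart b + d • ePart b'))
      (uDeriv₂ A t u a ⬝ᵥ (c • ePart b + d • ePart b')) 0 := by
    refine (hasDerivAt_dotProduct (w := fun _ ↦ c • ePart b + d • ePart b') (w' := 0)
      (hasDerivAt_uDeriv t u a) (fun i ↦ hasDerivAt_const _ _) rfl rfl).congr_deriv ?_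
    rw [dotProduct_zero, add_zero]
  have hx (a : Idx n → ℝ) : HasDerivAt (fun s : ℝ ↦ ePart (axis t + s • u) ⬝ᵥ ePart a)
      (ePart u ⬝ᵥ ePart a) 0 := by
    refine (hasDerivAt_dotProduct (v := fun s : ℝ ↦ ePart (axis t + s • u)) (w := fun _ ↦ ePart a)
      (w' := 0) (v' := ePart u)
      (fun i ↦ hasDerivAt_coord_line _ u _) (fun i ↦ hasDerivAt_const _ _) rfl rfl).congr_deriv ?_
    rw [dotProduct_zero, add_zero]
  simp only [christoffelFirst_eq]
  exact (((((hd v z _ _ w).add (hd z v _ _ w)).sub (hd w v _ _ z)).div_const 2).add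
    ((hx v).mul_const _)).add ((hx z).mul_const _) |>.sub ((hx w).mul_const _)

/-- The endomorphism with a given matrix. -/
noncomputable def op {ι : Type*} [Fintype ι] [DecidableEq ι] : Matrix ι ι ℝ →ₗ[ℝ] ((ι → ℝ) →L[ℝ] (ι → ℝ)) :=
  LinearMap.toContinuousLinearMap.toLinearMap ∘ₗ (Matrix.toLin' (R := ℝ)).toLinearMap

@[simp] theorem op_apply {ι : Type*} [Fintype ι] [DecidableEq ι] (Z : Matrix ι ι ℝ) (v : ι → ℝ) :
    op Z v = Z *ᵥ v := rfl

theorem gMatrix_mulVec_p_zero (B : Matrix (Fin n) (Fin n) ℝ) (X Y : Fin n → ℝ) (c : ℝ)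
    (v : Idx n → ℝ) : (gMatrix B X Y c *ᵥ v) (Idx.p 0) = -(X ⬝ᵥ ePart v) - c * v (Idx.q 1) := by
  simp [gMatrix, Matrix.mulVec, dotProduct, Fintype.sum_sum_type, ePart]
  ring

theorem gMatrix_mulVec_p_one (B : Matrix (Fin n) (Fin n) ℝ) (X Y : Fin n → ℝ) (c : ℝ)
    (v : Idx n → ℝ) : (gMatrix B X Y c *ᵥ v) (Idx.p 1) = -(Y ⬝ᵥ ePart v) + c * v (Idx.q 0) := by
  simp [gMatrix, Matrix.mulVec, dotProduct, Fintype.sum_sum_type, ePart]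

theorem gMatrix_mulVec_q (B : Matrix (Fin n) (Fin n) ℝ) (X Y : Fin n → ℝ) (c : ℝ)
    (v : Idx n → ℝ) (a : Fin 2) : (gMatrix B X Y c *ᵥ v) (Idx.q a) = 0 := by
  simp [gMatrix, Matrix.mulVec, dotProduct, Fintype.sum_sum_type]

theorem ePart_gMatrix_mulVec (B : Matrix (Fin n) (Fin n) ℝ) (X Y : Fin n → ℝ) (c : ℝ)
    (v : Idx n → ℝ) : ePart (gMatrix B X Y c *ᵥ v) =
      B *ᵥ ePart v + v (Idx.q 0) • X + v (Idx.q 1) • Y := by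
  funext i
  simp [gMatrix, Matrix.mulVec, dotProduct, Fintype.sum_sum_type, ePart]
  ring

theorem form_axis_gMatrix (t : ℝ) (B : Matrix (Fin n) (Fin n) ℝ) (X Y : Fin n → ℝ) (c : ℝ)
    (z w : Idx n → ℝ) : (polynomialMetric A).form (axis t) (op (gMatrix B X Y c) z) w =
      (-(X ⬝ᵥ ePart z) - c * z (Idx.q 1)) * w (Idx.q 0)
      + (-(Y ⬝ᵥ ePart z) + c * z (Idx.q 0)) * w (Idx.q 1)
      + ((B *ᵥ ePart z) ⬝ᵥ ePart w + z (Idx.q 0) * (X ⬝ᵥ ePart w)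
        + z (Idx.q 1) * (Y ⬝ᵥ ePart w)) := by
  rw [form_axis, op_apply, gMatrix_mulVec_p_zero, gMatrix_mulVec_p_one, gMatrix_mulVec_q,
    gMatrix_mulVec_q, ePart_gMatrix_mulVec]
  simp only [add_dotProduct, smul_dotProduct, smul_eq_mul]
  ring

/-- The basis vector `qₐ`. -/
def qVec (a : Fin 2) : Idx n → ℝ := Pi.single (Idx.q a) 1

@[simp] theorem ePart_qVec (a : Fin 2) : ePart (qVec a : Idx n → ℝ) = 0 := by
  funext i
  simp [ePart, qVec]

@[simp] theorem qVec_apply (a b : Fin 2) :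
    (qVec a : Idx n → ℝ) (Idx.q b) = if b = a then 1 else 0 := by
  simp [qVec, Pi.single_apply]

theorem curv_axis_q_q (hA : ∀ α, (A α)ᵀ = -A α) (t : ℝ) :
    curv (polynomialMetric A).gamma (axis t) (qVec 0) (qVec 1) =
      op (gMatrix (polyDeriv A t) 0 0 0) := by
  refine ContinuousLinearMap.ext fun z ↦ (polynomialMetric A).eq_of_form_eq (y := axis t) fun w ↦ ?_
  rw [form_curv (hasDerivAt_christoffelFirst t _ _ _ _) (hasDerivAt_christoffelFirst t _ _ _ _),
    form_axis_gMatrix, gamma_axis hA, gamma_axis hA, gamma_axis hA, gamma_axis hA]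
  have h := mulVec_dotProduct_of_skew (transpose_polyDeriv hA t)
  simp [uDeriv₂, form_axis, h (ePart w)]

theorem curv_axis_e_q_zero (hA : ∀ α, (A α)ᵀ = -A α) (t : ℝ) (k : Fin n → ℝ) :
    curv (polynomialMetric A).gamma (axis t) (eVec k) (qVec 0) =
      op (gMatrix 0 (-k) (-((1 / 2 : ℝ) • (polyDeriv A t *ᵥ k))) 0) := by
  refine ContinuousLinearMap.ext fun z ↦ (polynomialMetric A).eq_of_form_eq (y := axis t) fun w ↦ ?_
  rw [form_curv (hasDerivAt_christoffelFirst t _ _ _ _) (hasDerivAt_christoffelFirst t _ _ _ _),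
    form_axis_gMatrix, gamma_axis hA, gamma_axis hA, gamma_axis hA, gamma_axis hA]
  have h := mulVec_dotProduct_of_skew (transpose_polyDeriv hA t)
  simp [uDeriv₂, form_axis, h (ePart w), h (ePart z), Matrix.mulVec_smul]
  ring

theorem curv_axis_e_q_one (hA : ∀ α, (A α)ᵀ = -A α) (t : ℝ) (k : Fin n → ℝ) :
    curv (polynomialMetric A).gamma (axis t) (eVec k) (qVec 1) =
      op (gMatrix 0 ((1 / 2 : ℝ) • (polyDeriv A t *ᵥ k))
        (-(k + poly A t *ᵥ (poly A t *ᵥ k))) 0) := by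
  refine ContinuousLinearMap.ext fun z ↦ (polynomialMetric A).eq_of_form_eq (y := axis t) fun w ↦ ?_
  rw [form_curv (hasDerivAt_christoffelFirst t _ _ _ _) (hasDerivAt_christoffelFirst t _ _ _ _),
    form_axis_gMatrix, gamma_axis hA, gamma_axis hA, gamma_axis hA, gamma_axis hA]
  have h := mulVec_dotProduct_of_skew (transpose_polyDeriv hA t)
  have h' := mulVec_dotProduct_of_skew (transpose_poly hA t)
  simp [uDeriv₂, form_axis, h' (ePart w), h' (ePart z),
    dotProduct_comm (poly A t *ᵥ k) (poly A t *ᵥ ePart w), Matrix.mulVec_smul,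
    -Matrix.mulVec_mulVec]
  ring

end PolynomialMetric

/-! ### The holonomy algebra of the polynomial metric contains `𝔤^𝔥` -/

open Polynomial in
/-- A subspace that contains all values of a vector-valued polynomial contains its coefficients. -/
theorem Submodule.mem_of_forall_sum_pow_smul_mem {V : Type*} [AddCommGroup V] [Module ℝ V]
    (S : Submodule ℝ V) {N : ℕ} {B : Fin N → V} (h : ∀ t : ℝ, ∑ α, t ^ α.1 • B α ∈ S)
    (α : Fin N) : B α ∈ S := by
  by_contra hα
  obtain ⟨f, hf, hS⟩ := S.exists_le_ker_of_notMem hα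
  let p : ℝ[X] := ∑ α : Fin N, monomial α.1 (f (B α))
  have hp : p = 0 := by
    refine Polynomial.funext fun t ↦ ?_
    have h1 : f (∑ α, t ^ α.1 • B α) = 0 := hS (h t)
    simp only [map_sum, map_smul, smul_eq_mul] at h1
    simp only [p, eval_finsetSum, eval_monomial, eval_zero]
    rw [← h1]
    exact Finset.sum_congr rfl fun _ _ ↦ mul_comm _ _
  have h2 : p.coeff α.1 = f (B α) := by
    simp only [p, finsetSum_coeff, coeff_monomial]
    rw [Finset.sum_eq_single α (fun β _ hβ ↦ if_neg fun h ↦ hβ (Fin.ext h)) (by simp)]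
    simp
  rw [hp, coeff_zero] at h2
  exact hf h2.symm

namespace PolynomialMetric

open Set Filter Topology LinearODE Connection PseudoRiemannianMetric

variable {n N : ℕ} {A : Fin N → Matrix (Fin n) (Fin n) ℝ}

theorem axis_eq_smul (t : ℝ) : (axis t : Idx n → ℝ) = t • qVec 0 := by
  funext i
  simp [axis, qVec, Pi.single_apply]

/-- Constant vector fields are parallel along the axis. -/
theorem isTransport_axis (hA : ∀ α, (A α)ᵀ = -A α) (a b : ℝ) :
    (polynomialMetric A).IsTransport (axis a) (axis b) (.id ℝ (Idx n → ℝ)) := by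
  refine .of_along (γ := fun s : ℝ ↦ axis (a + s * (b - a))) ?_ (by simp) (by simp)
    fun (v : Idx n → ℝ) ↦ ?_
  · simp only [axis_eq_smul]
    refine ContDiff.contMDiff ?_
    fun_prop
  · refine ⟨fun _ ↦ v, fun s ↦ ?_, rfl, rfl⟩
    refine isParallelAt_vectorSpace_iff.2 ⟨(b - a) • qVec 0, ?_, ?_⟩
    · simp only [axis_eq_smul]
      refine HasDerivAt.smul_const ?_ _
      simpa using ((hasDerivAt_id s).mul_const (b - a)).const_add a
    · rw [gamma_axis hA]
      have h : eVec (0 : Fin n → ℝ) = 0 := by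
        funext i
        rcases i with i | i | i <;> rfl
      simpa [h] using hasDerivAt_const s v

/-- The curvature at the points of the axis contributes to the holonomy algebra at the origin without any
conjugation. -/
theorem mem_of_mem_axis (hA : ∀ α, (A α)ᵀ = -A α) {t : ℝ} {Z : (Idx n → ℝ) →L[ℝ] (Idx n → ℝ)}
    (hZ : Z ∈ (polynomialMetric A).holonomySubmodule (axis t)) :
    Z ∈ (polynomialMetric A).holonomySubmodule 0 := by
  have h0 : axis 0 = (0 : Idx n → ℝ) := by simp [axis]
  have h1 := isTransport_axis hA 0 t
  have h2 := isTransport_axis hA t 0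
  rw [← h0]
  exact h1.conj_mem h2 rfl hZ

variable (A) in
/-- The matrices of the elements of the holonomy algebra at the origin. -/
noncomputable def holonomyMatrixSubmodule : Submodule ℝ (Matrix (Idx n) (Idx n) ℝ) :=
  ((polynomialMetric A).holonomySubmodule 0).comap op

theorem commutator_mem_matrix {Z W : Matrix (Idx n) (Idx n) ℝ}
    (hZ : Z ∈ holonomyMatrixSubmodule A) (hW : W ∈ holonomyMatrixSubmodule A) :
    ⁅Z, W⁆ ∈ holonomyMatrixSubmodule A := by
  have h := commutator_mem (g := polynomialMetric A) (p := 0) (A := op Z) (B := op W) hZ hW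
  have h2 : op Z * op W - op W * op Z = op ⁅Z, W⁆ := by
    refine ContinuousLinearMap.ext fun v ↦ ?_
    change Z *ᵥ (W *ᵥ v) - W *ᵥ (Z *ᵥ v) = ⁅Z, W⁆ *ᵥ v
    rw [Ring.lie_def, Matrix.sub_mulVec, Matrix.mulVec_mulVec, Matrix.mulVec_mulVec]
  rw [h2] at h
  exact h

theorem gMatrix_polyDeriv_mem (hA : ∀ α, (A α)ᵀ = -A α) (t : ℝ) :
    gMatrix (polyDeriv A t) 0 0 0 ∈ holonomyMatrixSubmodule A := by
  have h := curv_mem_holonomySubmodule (g := polynomialMetric A) (axis t) (qVec 0) (qVec 1)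
  rw [curv_axis_q_q hA] at h
  exact mem_of_mem_axis hA h

/-- The linear map `B ↦ gMatrix B 0 0 0`. -/
def gMatrixA (n : ℕ) : Matrix (Fin n) (Fin n) ℝ →ₗ[ℝ] Matrix (Idx n) (Idx n) ℝ where
  toFun B := gMatrix B 0 0 0
  map_add' B C := by simp [gMatrix_add]
  map_smul' r B := by simp [gMatrix_smul]

/-- The linear map `Y ↦ gMatrix 0 0 Y 0`. -/
def gMatrixY (n : ℕ) : (Fin n → ℝ) →ₗ[ℝ] Matrix (Idx n) (Idx n) ℝ where
  toFun Y := gMatrix 0 0 Y 0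
  map_add' B C := by simp [gMatrix_add]
  map_smul' r B := by simp [gMatrix_smul]

/-- The curvature `R(∂ₙ₊₃, ∂ₙ₊₄)` along the axis is the polynomial `a'(t)`, from which its coefficients,
and with them all of `𝔥`, are recovered. -/
theorem gMatrix_coeff_mem (hA : ∀ α, (A α)ᵀ = -A α) (α : Fin N) :
    gMatrix (A α) 0 0 0 ∈ holonomyMatrixSubmodule A := by
  let S : Submodule ℝ (Matrix (Fin n) (Fin n) ℝ) := (holonomyMatrixSubmodule A).comap (gMatrixA n)
  have h (t : ℝ) : ∑ α : Fin N, t ^ α.1 • ((α.1 : ℝ) + 1) • A α ∈ S := by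
    have h1 : polyDeriv A t ∈ S := gMatrix_polyDeriv_mem hA t
    rw [polyDeriv] at h1
    simpa only [smul_smul, mul_comm] using h1
  have h2 : ((α.1 : ℝ) + 1) ≠ 0 := by positivity
  have h3 : A α ∈ S := (S.smul_mem_iff h2).1
    (S.mem_of_forall_sum_pow_smul_mem (B := fun α : Fin N ↦ ((α.1 : ℝ) + 1) • A α) h α)
  exact h3

theorem gMatrix_e_q_zero_mem (hA : ∀ α, (A α)ᵀ = -A α) (t : ℝ) (k : Fin n → ℝ) :
    gMatrix 0 (-k) (-((1 / 2 : ℝ) • (polyDeriv A t *ᵥ k))) 0 ∈ holonomyMatrixSubmodule A := by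
  have h := curv_mem_holonomySubmodule (g := polynomialMetric A) (axis t) (eVec k) (qVec 0)
  rw [curv_axis_e_q_zero hA] at h
  exact mem_of_mem_axis hA h

theorem gMatrix_e_q_one_mem (hA : ∀ α, (A α)ᵀ = -A α) (t : ℝ) (k : Fin n → ℝ) :
    gMatrix 0 ((1 / 2 : ℝ) • (polyDeriv A t *ᵥ k)) (-(k + poly A t *ᵥ (poly A t *ᵥ k))) 0 ∈
      holonomyMatrixSubmodule A := by
  have h := curv_mem_holonomySubmodule (g := polynomialMetric A) (axis t) (eVec k) (qVec 1)
  rw [curv_axis_e_q_one hA] at h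
  exact mem_of_mem_axis hA h

open Polynomial in
/-- A vector `y` for which the polynomial `a(t) y` is bounded is annihilated by `a(t)`, since
`a(0) = 0`. -/
theorem poly_mulVec_eq_zero {y : Fin n → ℝ} {C : ℝ}
    (h : ∀ t i, (poly A t *ᵥ y) i ^ 2 ≤ C) (t : ℝ) : poly A t *ᵥ y = 0 := by
  funext i
  let p : ℝ[X] := ∑ α : Fin N, monomial (α.1 + 1) ((A α *ᵥ y) i)
  have hp : ∀ t, p.eval t = (poly A t *ᵥ y) i := fun t ↦ by
    simp only [p, eval_finsetSum, eval_monomial, poly, Matrix.sum_mulVec, Finset.sum_apply,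
      Matrix.smul_mulVec, Pi.smul_apply, smul_eq_mul]
    exact Finset.sum_congr rfl fun _ _ ↦ mul_comm _ _
  have h1 : p.degree ≤ 0 := by
    refine (Polynomial.isBoundedUnder_abs_atTop_iff p).1 ⟨1 + C, ?_⟩
    refine eventually_map.2 (.of_forall fun t ↦ ?_)
    rw [hp]
    have := h t i
    rcases abs_cases ((poly A t *ᵥ y) i) with ⟨h2, _⟩ | ⟨h2, _⟩ <;> rw [h2] <;>
      nlinarith [sq_nonneg ((poly A t *ᵥ y) i - 1), sq_nonneg ((poly A t *ᵥ y) i + 1)]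
  have h2 := Polynomial.eq_C_of_degree_le_zero h1
  have h3 : p.eval t = p.eval 0 := by rw [h2]; simp
  rw [hp, hp, poly_zero, Matrix.zero_mulVec] at h3
  exact h3

/-- Combinations of curvature operators give `gMatrix 0 0 Y 0` for all `Y` in the range of
`1 + a(t)² + a'(t)² / 4`, for all `t`. A vector `y` orthogonal to these ranges satisfies
`|y|² = |a(t) y|² + |a'(t) y|² / 4` for all `t`; hence the polynomial `a(t) y` is bounded, so
`a(t) y = 0`, and `y = 0`. -/
theorem gMatrix_Y_mem (hA : ∀ α, (A α)ᵀ = -A α) (Y : Fin n → ℝ) :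
    gMatrix 0 0 Y 0 ∈ holonomyMatrixSubmodule A := by
  let W := (holonomyMatrixSubmodule A).comap (gMatrixY n)
  have hW : ∀ t k, k + poly A t *ᵥ (poly A t *ᵥ k)
      + (1 / 4 : ℝ) • (polyDeriv A t *ᵥ (polyDeriv A t *ᵥ k)) ∈ W := fun t k ↦ by
    have h := neg_mem (add_mem (gMatrix_e_q_one_mem hA t k)
      (gMatrix_e_q_zero_mem hA t ((1 / 2 : ℝ) • (polyDeriv A t *ᵥ k))))
    rw [gMatrix_add, ← neg_one_smul ℝ, gMatrix_smul] at h
    change gMatrix 0 0 _ 0 ∈ holonomyMatrixSubmodule A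
    convert h using 2
    · simp
    · simp
    · simp only [Matrix.mulVec_smul]
      module
    · simp
  suffices h : W = ⊤ by
    have : Y ∈ W := h ▸ Submodule.mem_top
    exact this
  by_contra hne
  obtain ⟨f, hf, hWf⟩ := W.exists_le_ker_of_lt_top (lt_top_iff_ne_top.2 hne)
  -- The vector that represents a functional which vanishes on `W`.
  let y : Fin n → ℝ := fun i ↦ f (Pi.single i 1)
  have hfy : ∀ v, f v = v ⬝ᵥ y := fun v ↦ by
    rw [LinearMap.pi_apply_eq_sum_univ f v]
    simp only [dotProduct, smul_eq_mul, y]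
    refine Finset.sum_congr rfl fun i _ ↦ ?_
    congr 2
    funext j
    simp [Pi.single_apply, eq_comm]
  have key : ∀ t, y ⬝ᵥ y = (poly A t *ᵥ y) ⬝ᵥ (poly A t *ᵥ y)
      + (1 / 4 : ℝ) * ((polyDeriv A t *ᵥ y) ⬝ᵥ (polyDeriv A t *ᵥ y)) := fun t ↦ by
    have h1 : f _ = 0 := hWf (hW t y)
    rw [hfy, add_dotProduct, add_dotProduct, smul_dotProduct,
      mulVec_dotProduct_of_skew (transpose_poly hA t),
      mulVec_dotProduct_of_skew (transpose_polyDeriv hA t)] at h1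
    simp only [smul_eq_mul] at h1
    linarith
  have hbound : ∀ t i, (poly A t *ᵥ y) i ^ 2 ≤ y ⬝ᵥ y := fun t i ↦ by
    have h1 : (poly A t *ᵥ y) i ^ 2 ≤ (poly A t *ᵥ y) ⬝ᵥ (poly A t *ᵥ y) := by
      rw [pow_two]
      exact Finset.single_le_sum (f := fun i ↦ (poly A t *ᵥ y) i * (poly A t *ᵥ y) i)
        (fun j _ ↦ mul_self_nonneg _) (Finset.mem_univ i)
    have h2 : 0 ≤ (polyDeriv A t *ᵥ y) ⬝ᵥ (polyDeriv A t *ᵥ y) :=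
      Finset.sum_nonneg fun j _ ↦ mul_self_nonneg _
    rw [key t]
    linarith
  have h3 : ∀ t, poly A t *ᵥ y = 0 := poly_mulVec_eq_zero hbound
  have h4 : polyDeriv A 0 *ᵥ y = 0 := by
    funext i
    have h5 := hasDerivAt_mulVec (hasDerivAt_poly A · · 0) (v := fun _ ↦ y) (v' := 0)
      (fun i ↦ hasDerivAt_const _ _) rfl rfl i
    simp only [h3, mulVec_zero, add_zero] at h5
    exact h5.unique (hasDerivAt_const _ _)
  have h6 := key 0
  rw [h3, h4, zero_dotProduct, mul_zero, add_zero, dotProduct_self_eq_zero] at h6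
  refine hf (LinearMap.ext fun v ↦ ?_)
  rw [hfy, h6, dotProduct_zero]
  rfl

theorem gMatrix_X_mem (hA : ∀ α, (A α)ᵀ = -A α) (X : Fin n → ℝ) :
    gMatrix 0 X 0 0 ∈ holonomyMatrixSubmodule A := by
  have h := add_mem (gMatrix_e_q_zero_mem hA 0 (-X))
    (gMatrix_Y_mem hA ((1 / 2 : ℝ) • (polyDeriv A 0 *ᵥ (-X))))
  rw [gMatrix_add] at h
  simpa using h

theorem gMatrix_c_mem (hA : ∀ α, (A α)ᵀ = -A α) (hn : 1 ≤ n) (c : ℝ) :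
    gMatrix (0 : Matrix (Fin n) (Fin n) ℝ) 0 0 c ∈ holonomyMatrixSubmodule A := by
  let e : Fin n → ℝ := Pi.single ⟨0, hn⟩ 1
  have h := commutator_mem_matrix (gMatrix_X_mem hA (c • e)) (gMatrix_Y_mem hA e)
  rw [gMatrix_lie (by simp) (by simp)] at h
  simp only [Matrix.zero_mulVec, sub_self, lie_self] at h
  simpa [e] using h

theorem gMatrix_mem_holonomyMatrixSubmodule (hA : ∀ α, (A α)ᵀ = -A α) (hn : 1 ≤ n)
    {B : Matrix (Fin n) (Fin n) ℝ} (hB : B ∈ Submodule.span ℝ (range A)) (X Y : Fin n → ℝ)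
    (c : ℝ) : gMatrix B X Y c ∈ holonomyMatrixSubmodule A := by
  have h1 : B ∈ (holonomyMatrixSubmodule A).comap (gMatrixA n) := by
    refine (Submodule.span_le.2 ?_) hB
    rintro _ ⟨α, rfl⟩
    exact gMatrix_coeff_mem hA α
  have h2 := add_mem (add_mem (add_mem (show gMatrix B 0 0 0 ∈ _ from h1) (gMatrix_X_mem hA X))
    (gMatrix_Y_mem hA Y)) (gMatrix_c_mem hA hn c)
  simpa [gMatrix_add] using h2

end PolynomialMetric

/-! ### Spectral projections and the derivative of the determinant -/

namespace MatrixEvolution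

open Set Filter Topology
open scoped Matrix.Norms.Operator

/-- The spectral projections of a Hermitian matrix. -/
theorem exists_spectral_projections {n : ℕ} {H : Matrix (Fin n) (Fin n) ℂ} (hH : H.IsHermitian) :
    ∃ (T : Finset ℝ) (P : ℝ → Matrix (Fin n) (Fin n) ℂ), (∀ μ, P μ * P μ = P μ) ∧
      ∑ μ ∈ T, (μ : ℂ) • P μ = H ∧ ∀ M, Commute M H → ∀ μ, Commute M (P μ) := by
  let U : Matrix (Fin n) (Fin n) ℂ := hH.eigenvectorUnitary
  let U' : Matrix (Fin n) (Fin n) ℂ := star U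
  have h1 : U * U' = 1 := Unitary.coe_mul_star_self hH.eigenvectorUnitary
  have h2 : U' * U = 1 := Unitary.coe_star_mul_self hH.eigenvectorUnitary
  let d := hH.eigenvalues
  have hspec : H = U * diagonal (fun i ↦ (d i : ℂ)) * U' := by
    conv_lhs => rw [hH.spectral_theorem]
    rfl
  let D (μ : ℝ) : Matrix (Fin n) (Fin n) ℂ := diagonal fun i ↦ if d i = μ then 1 else 0
  refine ⟨Finset.univ.image d, fun μ ↦ U * D μ * U', fun μ ↦ ?_, ?_, fun M hM μ ↦ ?_⟩
  · have h3 : D μ * D μ = D μ := by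
      simp only [D, diagonal_mul_diagonal]
      congr 1
      funext i
      split_ifs <;> simp
    calc U * D μ * U' * (U * D μ * U') = U * D μ * (U' * U) * D μ * U' := by noncomm_ring
      _ = U * (D μ * D μ) * U' := by rw [h2]; noncomm_ring
      _ = U * D μ * U' := by rw [h3]
  · have h3 : ∑ μ ∈ Finset.univ.image d, (μ : ℂ) • D μ = diagonal fun i ↦ (d i : ℂ) := by
      ext i j
      rw [Matrix.sum_apply]
      by_cases hij : i = j
      · subst hij
        simp only [D, Matrix.smul_apply, diagonal_apply_eq, smul_eq_mul, mul_ite, mul_one, mul_zero]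
        rw [Finset.sum_ite_eq, if_pos (Finset.mem_image_of_mem _ (Finset.mem_univ _))]
      · simp [D, diagonal_apply_ne _ hij]
    rw [hspec, ← h3, Finset.mul_sum, Finset.sum_mul]
    exact Finset.sum_congr rfl fun μ _ ↦ by rw [mul_smul_comm, smul_mul_assoc]
  -- In the eigenbasis `M` commutes with a diagonal matrix, so it is zero between different eigenvalues.
  · let N := U' * M * U
    have hMN : M = U * N * U' := by
      calc M = (U * U') * M * (U * U') := by rw [h1, one_mul, mul_one]
        _ = U * N * U' := by simp only [N]; noncomm_ring
    have h3 : N * diagonal (fun i ↦ (d i : ℂ)) = diagonal (fun i ↦ (d i : ℂ)) * N := by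
      have h4 : U' * (M * H) * U = U' * (H * M) * U := by rw [hM.eq]
      rw [hspec] at h4
      calc N * diagonal (fun i ↦ (d i : ℂ))
          = U' * (M * (U * diagonal (fun i ↦ (d i : ℂ)) * U')) * U := by
            calc _ = U' * M * U * diagonal (fun i ↦ (d i : ℂ)) * (U' * U) := by
                  rw [h2, mul_one]
              _ = _ := by noncomm_ring
        _ = _ := h4
        _ = diagonal (fun i ↦ (d i : ℂ)) * N := by
            calc _ = (U' * U) * diagonal (fun i ↦ (d i : ℂ)) * (U' * M * U) := by noncomm_ring
              _ = _ := by rw [h2, one_mul]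
    have h5 : N * D μ = D μ * N := by
      ext i j
      have h6 := congrFun (congrFun h3 i) j
      simp only [mul_diagonal, diagonal_mul, D] at h6 ⊢
      by_cases hij : d i = d j
      · rw [hij, mul_comm]
      · have h7 : N i j = 0 := by
          have h8 : ((d i : ℂ) - d j) * N i j = 0 := by linear_combination -h6
          refine (mul_eq_zero.1 h8).resolve_left fun h9 ↦ hij ?_
          exact_mod_cast sub_eq_zero.1 h9
        rw [h7, zero_mul, mul_zero]
    change M * (U * D μ * U') = U * D μ * U' * M
    calc M * (U * D μ * U') = U * N * (U' * U) * D μ * U' := by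
          nth_rewrite 1 [hMN]; noncomm_ring
      _ = U * (N * D μ) * U' := by rw [h2]; noncomm_ring
      _ = U * D μ * (U' * U) * N * U' := by rw [h5, h2]; noncomm_ring
      _ = U * D μ * U' * (U * N * U') := by noncomm_ring
      _ = U * D μ * U' * M := by rw [← hMN]

theorem contDiff_det {n : ℕ} : ContDiff ℝ ∞ (det : Matrix (Fin n) (Fin n) ℂ → ℂ) := by
  have h (i j : Fin n) : ContDiff ℝ ∞ fun M : Matrix (Fin n) (Fin n) ℂ ↦ M i j := by
    let l : Matrix (Fin n) (Fin n) ℂ →ₗ[ℝ] ℂ :=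
      { toFun := fun M ↦ M i j, map_add' := fun _ _ ↦ rfl, map_smul' := fun _ _ ↦ rfl }
    exact (LinearMap.toContinuousLinearMap l).contDiff
  simp only [funext (det_apply (R := ℂ) (n := Fin n))]
  refine ContDiff.sum fun σ _ ↦ ContDiff.const_smul _ (contDiff_prod fun i _ ↦ h _ _)

/-- Jacobi's formula, at an arbitrary matrix `W`, in the direction of `K W`. -/
theorem fderiv_det_mul {n : ℕ} (K W : Matrix (Fin n) (Fin n) ℂ) :
    fderiv ℝ (det : Matrix (Fin n) (Fin n) ℂ → ℂ) W (K * W) = trace K * det W := by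
  have hl : HasDerivAt (fun s : ℝ ↦ W + s • (K * W)) (K * W) 0 := by
    exact (((hasDerivAt_id (0 : ℝ)).smul_const (K * W)).const_add W).congr_deriv (one_smul _ _)
  have h1 : HasDerivAt (fun s : ℝ ↦ det (W + s • (K * W)))
      (fderiv ℝ (det : Matrix (Fin n) (Fin n) ℂ → ℂ) W (K * W)) 0 := by
    refine HasFDerivAt.comp_hasDerivAt (l := (det : Matrix (Fin n) (Fin n) ℂ → ℂ)) 0 ?_ hl
    rw [zero_smul, add_zero]
    exact (contDiff_det.differentiable (by simp) W).hasFDerivAt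
  have h2 : HasDerivAt (fun s : ℂ ↦ det (1 + s • K)) (trace K) 0 := by
    let q := (det (1 + (Polynomial.X : Polynomial ℂ) • K.map Polynomial.C)).divX.divX
    have h3 : HasDerivAt (fun s : ℂ ↦ 1 + trace K * s + q.eval s * s ^ 2) (trace K) 0 := by
      refine ((((hasDerivAt_id (0 : ℂ)).const_mul (trace K)).const_add 1).add
        ((q.hasDerivAt 0).mul (hasDerivAt_pow 2 (0 : ℂ)))).congr_deriv ?_
      simp
    exact h3.congr_of_eventuallyEq (.of_forall fun s ↦ Matrix.det_one_add_smul s K)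
  have h4 : HasDerivAt (fun s : ℝ ↦ det (1 + (s : ℂ) • K)) (trace K) 0 :=
    HasDerivAt.comp_ofReal (z := 0) (by simpa using h2)
  have h5 : (fun s : ℝ ↦ det (W + s • (K * W))) = fun s : ℝ ↦ det (1 + (s : ℂ) • K) * det W := by
    funext s
    rw [← det_mul, add_mul, one_mul, smul_mul_assoc]
    rfl
  rw [h5] at h1
  exact h1.unique (h4.mul_const _)

end MatrixEvolution

/-! ### The group generated by a Lie algebra of skew-symmetric matrices -/

namespace MatrixEvolution

open Set Filter Topology LinearODE
open scoped Matrix.Norms.Operator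

/-- A linear equation whose coefficients preserve a subspace preserves this subspace: project to a
complement. -/
theorem _root_.LinearODE.mem_of_mem {F : Type*} [NormedAddCommGroup F] [NormedSpace ℝ F]
    [FiniteDimensional ℝ F] {L : ℝ → F →L[ℝ] F} (hL : Continuous L) {X : ℝ → F}
    (hX : ∀ t, HasDerivAt X (L t (X t)) t) {S : Submodule ℝ F} (hS : ∀ t, ∀ x ∈ S, L t x ∈ S)
    (h0 : X 0 ∈ S) (t : ℝ) : X t ∈ S := by
  have : CompleteSpace F := FiniteDimensional.complete ℝ F
  obtain ⟨S', hS'⟩ := S.exists_isCompl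
  let pr : F →L[ℝ] F := LinearMap.toContinuousLinearMap (S'.projection S hS'.symm)
  have hpr : ∀ x, pr x = 0 ↔ x ∈ S := fun x ↦ S'.projection_apply_eq_zero_iff hS'.symm
  have hpr' : ∀ x, x - pr x ∈ S := fun x ↦ by
    rw [← hpr, map_sub, sub_eq_zero]
    exact (DFunLike.congr_fun (Submodule.isIdempotentElem_projection hS'.symm).eq x).symm
  have h1 : (fun t ↦ pr (X t)) = fun _ ↦ 0 := by
    refine solution_unique (L := fun t ↦ pr ∘L L t) (by fun_prop) (t₀ := 0) (fun t ↦ ?_) (fun t ↦ ?_)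
      ((hpr _).2 h0)
    · refine (HasFDerivAt.comp_hasDerivAt (l := pr) t pr.hasFDerivAt (hX t)).congr_deriv ?_
      change pr (L t (X t)) = pr (L t (pr (X t)))
      have h2 := (hpr _).2 (hS t _ (hpr' (X t)))
      rw [map_sub, map_sub, sub_eq_zero] at h2
      exact h2
    · simpa using hasDerivAt_const t (0 : F)
  exact (hpr _).1 (congrFun h1 t)

theorem hasDerivAt_linearMap {F G : Type*} [NormedAddCommGroup F] [NormedSpace ℝ F]
    [FiniteDimensional ℝ F] [NormedAddCommGroup G] [NormedSpace ℝ G] (l : F →ₗ[ℝ] G) {c : ℝ → F}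
    {c' : F} {t : ℝ} (h : HasDerivAt c c' t) : HasDerivAt (fun s ↦ l (c s)) (l c') t :=
  HasFDerivAt.comp_hasDerivAt (l := LinearMap.toContinuousLinearMap l) t
    (LinearMap.toContinuousLinearMap l).hasFDerivAt h

variable {n : ℕ}

theorem hasDerivAt_transpose {c : ℝ → Matrix (Fin n) (Fin n) ℝ} {c' : Matrix (Fin n) (Fin n) ℝ}
    {t : ℝ} (h : HasDerivAt c c' t) : HasDerivAt (fun s ↦ (c s)ᵀ) c'ᵀ t :=
  hasDerivAt_linearMap (transposeLinearEquiv (Fin n) (Fin n) ℝ ℝ).toLinearMap h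

/-- The monoid generated by the time-one values of the solutions of `U' = ξ U`, `U(0) = 1`, where
`ξ` runs over the continuous curves in `S`. If `S` is a Lie algebra, this is the connected Lie
group with this Lie algebra. -/
noncomputable def evolutionMonoid (S : Submodule ℝ (Matrix (Fin n) (Fin n) ℝ)) :
    Submonoid (Matrix (Fin n) (Fin n) ℝ) :=
  Submonoid.closure {M | ∃ ξ : ℝ → Matrix (Fin n) (Fin n) ℝ,
    Continuous ξ ∧ (∀ t, ξ t ∈ S) ∧ M = evol ξ 1}

variable {S : Submodule ℝ (Matrix (Fin n) (Fin n) ℝ)} {M : Matrix (Fin n) (Fin n) ℝ}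

theorem transpose_evol_mul_mul (hS : ∀ Y ∈ S, Yᵀ = -Y) {m : Matrix (Fin n) (Fin n) ℝ}
    (hm : ∀ Y ∈ S, m * Y = Y * m) {ξ : ℝ → Matrix (Fin n) (Fin n) ℝ} (hξ : Continuous ξ)
    (hξS : ∀ t, ξ t ∈ S) (t : ℝ) : (evol ξ t)ᵀ * m * evol ξ t = m := by
  have h : ∀ t, HasDerivAt (fun t ↦ (evol ξ t)ᵀ * m * evol ξ t) 0 t := fun t ↦ by
    refine (((hasDerivAt_transpose (hasDerivAt_evol hξ t)).mul_const m).mul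
      (hasDerivAt_evol hξ t)).congr_deriv ?_
    rw [transpose_mul, hS _ (hξS t)]
    calc _ = (evol ξ t)ᵀ * (m * ξ t - ξ t * m) * evol ξ t := by noncomm_ring
      _ = 0 := by rw [hm _ (hξS t)]; simp
  have h1 := is_const_of_deriv_eq_zero (fun t ↦ (h t).differentiableAt) (fun t ↦ (h t).deriv) t 0
  simpa [evol_zero hξ] using h1

theorem transpose_mul_self (hS : ∀ Y ∈ S, Yᵀ = -Y) (hM : M ∈ evolutionMonoid S) : Mᵀ * M = 1 := by
  induction hM using Submonoid.closure_induction with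
  | mem M h =>
    obtain ⟨ξ, hξ, hξS, rfl⟩ := h
    simpa using transpose_evol_mul_mul hS (m := 1) (by simp) hξ hξS 1
  | one => simp
  | mul M N _ _ hM hN =>
    calc (M * N)ᵀ * (M * N) = Nᵀ * (Mᵀ * M) * N := by rw [transpose_mul]; noncomm_ring
      _ = 1 := by rw [hM, mul_one, hN]

/-- What commutes with the Lie algebra commutes with the group. -/
theorem commute_of_mem (hS : ∀ Y ∈ S, Yᵀ = -Y) {m : Matrix (Fin n) (Fin n) ℝ}
    (hm : ∀ Y ∈ S, m * Y = Y * m) (hM : M ∈ evolutionMonoid S) : m * M = M * m := by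
  induction hM using Submonoid.closure_induction with
  | mem M h =>
    have h0 := mul_eq_one_comm.1 (transpose_mul_self hS (Submonoid.subset_closure h))
    obtain ⟨ξ, hξ, hξS, rfl⟩ := h
    have h1 := transpose_evol_mul_mul hS hm hξ hξS 1
    calc m * evol ξ 1 = (evol ξ 1 * (evol ξ 1)ᵀ) * m * evol ξ 1 := by rw [h0, one_mul]
      _ = evol ξ 1 * ((evol ξ 1)ᵀ * m * evol ξ 1) := by noncomm_ring
      _ = evol ξ 1 * m := by rw [h1]
  | one => simp
  | mul M N _ _ hM hN => rw [← mul_assoc, hM, mul_assoc, hN, mul_assoc]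

/-- The group normalizes its Lie algebra. -/
theorem conj_mem (hS : ∀ Y ∈ S, Yᵀ = -Y) (hlie : ∀ Y ∈ S, ∀ Z ∈ S, Y * Z - Z * Y ∈ S)
    (hM : M ∈ evolutionMonoid S) {y : Matrix (Fin n) (Fin n) ℝ} (hy : y ∈ S) :
    M * y * Mᵀ ∈ S := by
  induction hM using Submonoid.closure_induction generalizing y with
  | mem M h =>
    obtain ⟨ξ, hξ, hξS, rfl⟩ := h
    -- Along the evolution of `ξ`, the conjugate of `y` solves the linear equation `X' = [ξ, X]`.
    let ad : ℝ → Matrix (Fin n) (Fin n) ℝ →L[ℝ] Matrix (Fin n) (Fin n) ℝ := fun t ↦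
      ContinuousLinearMap.mul ℝ _ (ξ t) - (ContinuousLinearMap.mul ℝ _).flip (ξ t)
    refine mem_of_mem (L := ad) (X := fun t ↦ evol ξ t * y * (evol ξ t)ᵀ) (by fun_prop)
      (fun t ↦ ?_) (fun t x hx ↦ hlie _ (hξS t) _ hx) (by simpa [evol_zero hξ] using hy) 1
    refine (((hasDerivAt_evol hξ t).mul_const y).mul
      (hasDerivAt_transpose (hasDerivAt_evol hξ t))).congr_deriv ?_
    rw [transpose_mul, hS _ (hξS t)]
    change _ = ξ t * (evol ξ t * y * (evol ξ t)ᵀ) - (evol ξ t * y * (evol ξ t)ᵀ) * ξ t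
    noncomm_ring
  | one => simpa using hy
  | mul M N _ _ hM hN =>
    have h := hM (hN hy)
    rw [transpose_mul]
    simpa only [mul_assoc] using h

/-- A real matrix as a complex one. -/
noncomputable def toComplex : Matrix (Fin n) (Fin n) ℝ →ₗ[ℝ] Matrix (Fin n) (Fin n) ℂ where
  toFun M := M.map (algebraMap ℝ ℂ)
  map_add' M N := by ext; simp
  map_smul' r M := by ext; simp

theorem toComplex_mul (M N : Matrix (Fin n) (Fin n) ℝ) :
    toComplex (M * N) = toComplex M * toComplex N :=
  Matrix.map_mul

theorem toComplex_one : toComplex (1 : Matrix (Fin n) (Fin n) ℝ) = 1 :=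
  Matrix.map_one _ (map_zero _) (map_one _)

theorem trace_toComplex (M : Matrix (Fin n) (Fin n) ℝ) : trace (toComplex M) = ((trace M : ℝ) : ℂ) := by
  simp [toComplex, trace]

/-- The determinant of the compression of `M` to the range of a projection `P`. -/
noncomputable def blockDet (P : Matrix (Fin n) (Fin n) ℂ) (M : Matrix (Fin n) (Fin n) ℝ) : ℂ :=
  det (P * toComplex M + (1 - P))

variable {P : Matrix (Fin n) (Fin n) ℂ}

theorem blockDet_one : blockDet P 1 = 1 := by
  rw [blockDet, toComplex_one, mul_one, add_sub_cancel, det_one]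

theorem blockDet_mul (hP : P * P = P) {M N : Matrix (Fin n) (Fin n) ℝ}
    (hM : Commute (toComplex M) P) : blockDet P (M * N) = blockDet P M * blockDet P N := by
  rw [blockDet, blockDet, blockDet, ← det_mul, toComplex_mul]
  congr 1
  calc P * (toComplex M * toComplex N) + (1 - P)
      = (toComplex M * P) * toComplex N + (1 - P) := by rw [hM.eq]; noncomm_ring
    _ = toComplex M * (P * P) * toComplex N + toComplex M * (P - P * P)
        + (P - P * P) * toComplex N + (1 - P - P + P * P) := by rw [hP]; noncomm_ring
    _ = (toComplex M * P) * (P * toComplex N) + (toComplex M * P) * (1 - P)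
        + (1 - P) * (P * toComplex N) + (1 - P) * (1 - P) := by noncomm_ring
    _ = (P * toComplex M + (1 - P)) * (P * toComplex N + (1 - P)) := by rw [hM.eq]; noncomm_ring

/-- The logarithmic derivative of the block determinant along a curve with `c' = K c` is the trace of the
block of `K`. -/
theorem hasDerivAt_blockDet {c : ℝ → Matrix (Fin n) (Fin n) ℝ} {K : Matrix (Fin n) (Fin n) ℝ}
    {t : ℝ} (hP : P * P = P) (hK : Commute (toComplex K) P) (hc : HasDerivAt c (K * c t) t) :
    HasDerivAt (fun s ↦ blockDet P (c s)) (trace (P * toComplex K) * blockDet P (c t)) t := by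
  have h1 : HasDerivAt (fun s ↦ P * toComplex (c s) + (1 - P))
      (P * toComplex (K * c t)) t :=
    ((hasDerivAt_linearMap toComplex hc).const_mul P).add_const _
  have h2 : P * toComplex (K * c t) = (P * toComplex K) * (P * toComplex (c t) + (1 - P)) := by
    rw [toComplex_mul]
    calc P * (toComplex K * toComplex (c t)) = (P * P) * toComplex K * toComplex (c t)
          + (P * toComplex K - (P * P) * toComplex K) := by rw [hP]; noncomm_ring
      _ = P * (P * toComplex K) * toComplex (c t) + (P * toComplex K - P * (P * toComplex K)) := by
        noncomm_ring
      _ = P * (toComplex K * P) * toComplex (c t) + (P * toComplex K - P * (toComplex K * P)) := by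
        rw [hK.eq]
      _ = _ := by noncomm_ring
  rw [h2] at h1
  have h3 := HasFDerivAt.comp_hasDerivAt (l := (det : Matrix (Fin n) (Fin n) ℂ → ℂ)) t
    (contDiff_det.differentiable (by simp) _).hasFDerivAt h1
  exact h3.congr_deriv (fderiv_det_mul _ _)

/-- On the group, the block determinants have logarithms given by the integrals of the traces. -/
theorem exists_log_blockDet {T : Finset ℝ}
    {P : ℝ → Matrix (Fin n) (Fin n) ℂ} (hP : ∀ μ, P μ * P μ = P μ)
    (hSP : ∀ Y ∈ S, ∀ μ, Commute (toComplex Y) (P μ))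
    (hMP : ∀ M ∈ evolutionMonoid S, ∀ μ, Commute (toComplex M) (P μ))
    (hT : ∀ Y ∈ S, ∑ μ ∈ T, (μ : ℂ) * trace (P μ * toComplex Y) = 0)
    (hM : M ∈ evolutionMonoid S) :
    ∃ θ : ℝ → ℂ, (∀ μ, blockDet (P μ) M = Complex.exp (θ μ)) ∧ ∑ μ ∈ T, (μ : ℂ) * θ μ = 0 := by
  induction hM using Submonoid.closure_induction with
  | mem M h =>
    obtain ⟨ξ, hξ, hξS, rfl⟩ := h
    let k : ℝ → ℝ → ℂ := fun μ t ↦ trace (P μ * toComplex (ξ t))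
    have hk : ∀ μ, Continuous (k μ) := fun μ ↦ by
      let l : Matrix (Fin n) (Fin n) ℝ →ₗ[ℝ] ℂ :=
        { toFun := fun Y ↦ trace (P μ * toComplex Y)
          map_add' := fun Y Z ↦ by rw [map_add, mul_add, trace_add]
          map_smul' := fun r Y ↦ by rw [map_smul, mul_smul_comm, trace_smul]; rfl }
      exact (LinearMap.toContinuousLinearMap l).continuous.comp hξ
    refine ⟨fun μ ↦ ∫ t in (0 : ℝ)..1, k μ t, fun μ ↦ ?_, ?_⟩
    · have h1 : ∀ t, HasDerivAt (fun t ↦ blockDet (P μ) (evol ξ t) *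
          Complex.exp (-∫ s in (0 : ℝ)..t, k μ s)) 0 t := fun t ↦ by
        have h2 := hasDerivAt_blockDet (hP μ) (hSP _ (hξS t) μ) (hasDerivAt_evol hξ t)
        have h3 : HasDerivAt (fun t ↦ ∫ s in (0 : ℝ)..t, k μ s) (k μ t) t :=
          intervalIntegral.integral_hasDerivAt_right ((hk μ).intervalIntegrable _ _)
            (hk μ).stronglyMeasurable.stronglyMeasurableAtFilter (hk μ).continuousAt
        refine (h2.mul h3.neg.cexp).congr_deriv ?_
        simp only [k]
        ring
      have h2 := is_const_of_deriv_eq_zero (fun t ↦ (h1 t).differentiableAt)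
        (fun t ↦ (h1 t).deriv) 1 0
      rw [evol_zero hξ, blockDet_one, intervalIntegral.integral_same, neg_zero, Complex.exp_zero,
        one_mul, Complex.exp_neg] at h2
      exact eq_of_mul_inv_eq_one h2
    · simp only [← intervalIntegral.integral_const_mul]
      rw [← intervalIntegral.integral_finsetSum (f := fun (μ : ℝ) t ↦ (μ : ℂ) * k μ t) fun μ _ ↦
        (continuous_const.mul (hk μ)).intervalIntegrable _ _]
      simp only [k, fun t ↦ hT _ (hξS t), intervalIntegral.integral_zero]
  | one => exact ⟨0, fun μ ↦ by simp [blockDet_one], by simp⟩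
  | mul M N hM _ ihM ihN =>
    obtain ⟨θ, h1, h2⟩ := ihM
    obtain ⟨θ', h3, h4⟩ := ihN
    refine ⟨θ + θ', fun μ ↦ ?_, ?_⟩
    · rw [blockDet_mul (hP μ) (hMP M hM μ), h1, h3, Pi.add_apply, Complex.exp_add]
    · simp only [Pi.add_apply, mul_add, Finset.sum_add_distrib, h2, h4, add_zero]

end MatrixEvolution

/-! ### Velocities of curves in the group -/

namespace MatrixEvolution

open Set Filter Topology LinearODE
open scoped Matrix.Norms.Operator

variable {n : ℕ} {S : Submodule ℝ (Matrix (Fin n) (Fin n) ℝ)}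

theorem eq_zero_of_trace_mul_self {m : Matrix (Fin n) (Fin n) ℝ} (hm : mᵀ = -m)
    (h : trace (m * m) = 0) : m = 0 := by
  have h1 : trace (mᴴ * m) = 0 := by
    rw [conjTranspose_eq_transpose_of_trivial, hm, neg_mul, trace_neg, h, neg_zero]
  exact trace_conjTranspose_mul_self_eq_zero_iff.1 h1

/-- Orthogonal decomposition with respect to the trace form. -/
theorem exists_trace_orthogonal (hS : ∀ Y ∈ S, Yᵀ = -Y) (X : Matrix (Fin n) (Fin n) ℝ) :
    ∃ Y ∈ S, ∃ m, X = Y + m ∧ ∀ Z ∈ S, trace (m * Z) = 0 := by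
  let B : LinearMap.BilinForm ℝ (Matrix (Fin n) (Fin n) ℝ) := LinearMap.mk₂ ℝ
    (fun M N ↦ trace (M * N)) (fun M M' N ↦ by rw [add_mul, trace_add])
    (fun r M N ↦ by rw [smul_mul_assoc, trace_smul])
    (fun M N N' ↦ by rw [mul_add, trace_add]) (fun r M N ↦ by rw [mul_smul_comm, trace_smul])
  have hB : ∀ M N, B M N = trace (M * N) := fun M N ↦ rfl
  have hrefl : B.IsRefl := fun M N h ↦ by rw [hB, trace_mul_comm, ← hB]; exact h
  have hnd : (B.restrict S).Nondegenerate := by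
    refine ⟨fun M hM ↦ ?_, fun M hM ↦ ?_⟩
    · exact Subtype.ext (eq_zero_of_trace_mul_self (hS _ M.2) (hM M))
    · exact Subtype.ext (eq_zero_of_trace_mul_self (hS _ M.2) (hM M))
  have hc := LinearMap.BilinForm.isCompl_orthogonal_of_restrict_nondegenerate hrefl hnd
  obtain ⟨Y, hY, m, hm, rfl⟩ := Submodule.mem_sup.1 (hc.sup_eq_top ▸ Submodule.mem_top (x := X))
  refine ⟨Y, hY, m, rfl, fun Z hZ ↦ ?_⟩
  rw [trace_mul_comm]
  exact hm Z hZ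

theorem continuous_blockDet (P : Matrix (Fin n) (Fin n) ℂ) : Continuous (blockDet P) := by
  have h1 : Continuous (toComplex (n := n)) := (LinearMap.toContinuousLinearMap toComplex).continuous
  have h2 : Continuous (det : Matrix (Fin n) (Fin n) ℂ → ℂ) := contDiff_det.continuous
  exact h2.comp ((continuous_const.mul h1).add continuous_const)

/-- If the trace form vanishes on `m` and `S`, then it vanishes on `m` and the velocity `X` of a
curve in the group: the function `∑ μ log D_μ`, where `D_μ` is the determinant on the eigenspace of
`i m` with eigenvalue `μ`, takes countably many values along the curve, and its derivative at the
identity is `i tr (m X)`. -/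
theorem trace_mul_eq_zero (hS : ∀ Y ∈ S, Yᵀ = -Y) {m X : Matrix (Fin n) (Fin n) ℝ} (hm : mᵀ = -m)
    (hmS : ∀ Y ∈ S, m * Y = Y * m) (htr : ∀ Y ∈ S, trace (m * Y) = 0) (hmX : m * X = X * m)
    {c : ℝ → Matrix (Fin n) (Fin n) ℝ} (hc : Continuous c) (h0 : c 0 = 1)
    (hcm : ∀ t, c t ∈ evolutionMonoid S) (hcX : HasDerivAt c X 0) : trace (m * X) = 0 := by
  let H : Matrix (Fin n) (Fin n) ℂ := Complex.I • toComplex m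
  have hH : H.IsHermitian := by
    ext i j
    have h1 : m j i = -m i j := congrFun (congrFun hm i) j
    simp [H, toComplex, h1]
  obtain ⟨T, P, hP, hsum, hcomm⟩ := exists_spectral_projections hH
  have hcomm' : ∀ M : Matrix (Fin n) (Fin n) ℝ, m * M = M * m → ∀ μ,
      Commute (toComplex M) (P μ) := fun M hM μ ↦ by
    refine hcomm _ ?_ μ
    change toComplex M * (Complex.I • toComplex m) = (Complex.I • toComplex m) * toComplex M
    rw [mul_smul_comm, smul_mul_assoc, ← toComplex_mul, ← toComplex_mul, hM]
  have htrace : ∀ M : Matrix (Fin n) (Fin n) ℝ,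
      ∑ μ ∈ T, (μ : ℂ) * trace (P μ * toComplex M) = Complex.I * ((trace (m * M) : ℝ) : ℂ) :=
      fun M ↦ by
    have h1 : ∑ μ ∈ T, (μ : ℂ) * trace (P μ * toComplex M) = trace (H * toComplex M) := by
      rw [← hsum, Finset.sum_mul, trace_sum]
      exact Finset.sum_congr rfl fun μ _ ↦ by rw [smul_mul_assoc, trace_smul, smul_eq_mul]
    rw [h1, smul_mul_assoc, ← toComplex_mul, trace_smul, trace_toComplex, smul_eq_mul]
  let D : ℝ → ℝ → ℂ := fun μ t ↦ blockDet (P μ) (c t)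
  have hD : ∀ μ, Continuous (D μ) := fun μ ↦ (continuous_blockDet (P μ)).comp hc
  have hD0 : ∀ μ, D μ 0 = 1 := fun μ ↦ by simp only [D, h0, blockDet_one]
  have hev : ∀ᶠ t in 𝓝 (0 : ℝ), ∀ μ ∈ T, D μ t ∈ Complex.slitPlane := by
    refine (Finset.eventually_all T).2 fun μ _ ↦ (hD μ).continuousAt.eventually ?_
    rw [hD0]
    exact Complex.isOpen_slitPlane.mem_nhds Complex.one_mem_slitPlane
  obtain ⟨δ, hδ, hball⟩ := Metric.eventually_nhds_iff_ball.1 hev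
  let L : ℝ → ℂ := fun t ↦ ∑ μ ∈ T, (μ : ℂ) * Complex.log (D μ t)
  have hL : ContinuousOn L (Metric.ball 0 δ) := by
    refine continuousOn_finsetSum _ fun μ hμ ↦ continuousOn_const.mul ?_
    exact (hD μ).continuousOn.clog fun t ht ↦ hball t ht μ hμ
  have hcount : (range fun k : T → ℤ ↦ ∑ μ : T, ((μ : ℝ) : ℂ) *
      (k μ * (2 * Real.pi * Complex.I))).Countable := countable_range _
  have hmem : L '' Metric.ball 0 δ ⊆ range fun k : T → ℤ ↦ ∑ μ : T, ((μ : ℝ) : ℂ) *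
      (k μ * (2 * Real.pi * Complex.I)) := by
    rintro _ ⟨t, _, rfl⟩
    obtain ⟨θ, hθ, hθ0⟩ := exists_log_blockDet hP (fun Y hY ↦ hcomm' Y (hmS Y hY))
      (fun M hM ↦ hcomm' M (commute_of_mem hS hmS hM))
      (fun Y hY ↦ (htrace Y).trans (by rw [htr Y hY]; simp)) (hcm t)
    -- On the group, `D_μ = exp θ_μ` with `∑ μ θ_μ = 0`; the principal logarithm of `D_μ` differs from `θ_μ`
    -- by an integral multiple of `2 π i`.
    have h1 : ∀ μ, ∃ k : ℤ, Complex.log (D μ t) = θ μ + k * (2 * Real.pi * Complex.I) := fun μ ↦ by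
      refine Complex.exp_eq_exp_iff_exists_int.1 ?_
      have h2 : D μ t = Complex.exp (θ μ) := hθ μ
      rw [h2, Complex.exp_log (Complex.exp_ne_zero _)]
    choose k hk using h1
    refine ⟨fun μ ↦ k μ, ?_⟩
    have h2 : L t = ∑ μ ∈ T, (μ : ℂ) * θ μ + ∑ μ ∈ T, (μ : ℂ) * (k μ * (2 * Real.pi * Complex.I)) := by
      simp only [L, hk, mul_add, Finset.sum_add_distrib]
    rw [h2, hθ0, zero_add]
    exact Finset.sum_coe_sort T fun μ ↦ (μ : ℂ) * (k μ * (2 * Real.pi * Complex.I))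
  -- A continuous function with countably many values on an interval is constant.
  have hconst : ∀ t ∈ Metric.ball (0 : ℝ) δ, L t = L 0 := fun t ht ↦
    hcount.isTotallyDisconnected _ hmem ((convex_ball (0 : ℝ) δ).isPreconnected.image L hL)
      (mem_image_of_mem L ht) (mem_image_of_mem L (Metric.mem_ball_self hδ))
  have hderiv : HasDerivAt L (∑ μ ∈ T, (μ : ℂ) * trace (P μ * toComplex X)) 0 := by
    refine HasDerivAt.fun_sum fun μ hμ ↦ HasDerivAt.const_mul _ ?_
    have h1 : HasDerivAt (D μ) (trace (P μ * toComplex X)) 0 := by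
      have h2 : HasDerivAt c (X * c 0) 0 := by rwa [h0, mul_one]
      refine (hasDerivAt_blockDet (hP μ) (hcomm' X hmX μ) h2).congr_deriv ?_
      rw [h0, blockDet_one, mul_one]
    refine (h1.clog_real (by rw [hD0]; exact Complex.one_mem_slitPlane)).congr_deriv ?_
    rw [hD0, div_one]
  have hderiv' : HasDerivAt L 0 0 := by
    refine (hasDerivAt_const (0 : ℝ) (L 0)).congr_of_eventuallyEq ?_
    filter_upwards [Metric.ball_mem_nhds (0 : ℝ) hδ] with t ht using hconst t ht
  have h1 := hderiv.unique hderiv'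
  rw [htrace] at h1
  exact_mod_cast (mul_eq_zero.1 h1).resolve_left Complex.I_ne_zero

/-- The velocity at the identity of a curve in the group belongs to the Lie algebra. The group
need not be closed. Split the velocity into its part `Y` in the Lie algebra and its part `m` orthogonal
to it for the trace form. Since the group normalizes the Lie algebra, `m` normalizes it too, so `m`
commutes with it; then `trace_mul_eq_zero` gives `tr (m²) = 0`. -/
theorem mem_of_hasDerivAt (hS : ∀ Y ∈ S, Yᵀ = -Y) (hlie : ∀ Y ∈ S, ∀ Z ∈ S, Y * Z - Z * Y ∈ S)
    {X : Matrix (Fin n) (Fin n) ℝ} {c : ℝ → Matrix (Fin n) (Fin n) ℝ} (hc : Continuous c)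
    (h0 : c 0 = 1) (hcm : ∀ t, c t ∈ evolutionMonoid S) (hcX : HasDerivAt c X 0) : X ∈ S := by
  have hX : Xᵀ = -X := by
    have h1 := (hasDerivAt_transpose hcX).mul hcX
    have h2 : (fun t ↦ (c t)ᵀ) * c = fun _ ↦ 1 := funext fun t ↦ transpose_mul_self hS (hcm t)
    rw [h2, h0, transpose_one, one_mul, mul_one] at h1
    exact eq_neg_of_add_eq_zero_left (h1.unique (hasDerivAt_const _ _))
  obtain ⟨Y, hY, m, rfl, hm⟩ := exists_trace_orthogonal hS X
  have hmskew : mᵀ = -m := by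
    rw [transpose_add, hS Y hY, neg_add] at hX
    exact add_left_cancel hX
  have hXS : ∀ y ∈ S, (Y + m) * y - y * (Y + m) ∈ S := fun y hy ↦ by
    have h1 := (hcX.mul_const y).mul (hasDerivAt_transpose hcX)
    have h2 := Submodule.hasDerivAt_mem S h1 fun t ↦ conj_mem hS hlie (hcm t) hy
    rw [h0, transpose_one, mul_one, one_mul, hX, mul_neg, ← sub_eq_add_neg] at h2
    exact h2
  have hmS : ∀ y ∈ S, m * y = y * m := fun y hy ↦ by
    have h1 : m * y - y * m ∈ S := by
      have h2 := sub_mem (hXS y hy) (hlie Y hY y hy)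
      have h3 : (Y + m) * y - y * (Y + m) - (Y * y - y * Y) = m * y - y * m := by noncomm_ring
      rwa [h3] at h2
    refine sub_eq_zero.1 (eq_zero_of_trace_mul_self (hS _ h1) ?_)
    have h4 : ∀ z ∈ S, trace ((m * y - y * m) * z) = 0 := fun z hz ↦ by
      have h5 := hm _ (hlie y hy z hz)
      have h6 : trace (y * m * z) = trace (m * (z * y)) := by
        rw [mul_assoc, trace_mul_comm, mul_assoc]
      rw [sub_mul, trace_sub, h6, ← trace_sub, mul_assoc, ← mul_sub, h5]
    exact h4 _ h1
  have h1 := trace_mul_eq_zero hS hmskew hmS hm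
    (by rw [mul_add, add_mul, hmS Y hY]) hc h0 hcm hcX
  rw [mul_add, trace_add, hm Y hY, zero_add] at h1
  rw [eq_zero_of_trace_mul_self hmskew h1, add_zero]
  exact hY

end MatrixEvolution

/-! ### The holonomy of the polynomial metric: the upper bound -/

namespace PolynomialMetric

open Set Filter Topology LinearODE Connection PseudoRiemannianMetric MatrixEvolution
open scoped Matrix.Norms.Operator

variable {n N : ℕ} {A : Fin N → Matrix (Fin n) (Fin n) ℝ}

/-- The Christoffel symbols have no components along `q₁, q₂`, since the constant fields `p₁, p₂`
are parallel. -/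
theorem gamma_q (y u v : Idx n → ℝ) (a : Fin 2) :
    (polynomialMetric A).gamma y u v (Idx.q a) = 0 := by
  have h := (polynomialMetric A).form_gamma y u v (Pi.single (Idx.p a) 1)
  have he : ePart (Pi.single (Idx.p a) 1 : Idx n → ℝ) = 0 := by
    funext i
    simp [ePart]
  have hu : uDeriv A y (Pi.single (Idx.p a) 1) = 0 := by simp [uDeriv, he]
  rw [christoffelFirst_eq, form_polynomialMetric, he, hu] at h
  fin_cases a <;> simpa using h

/-- On the orthogonal complement of `span {p₁, p₂}` the connection acts modulo `p₁, p₂` by the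
matrices `a(xⁿ⁺³)`, which belong to `𝔥`. -/
theorem ePart_gamma (hA : ∀ α, (A α)ᵀ = -A α) (y u : Idx n → ℝ) {v : Idx n → ℝ}
    (hv : ∀ a, v (Idx.q a) = 0) :
    ePart ((polynomialMetric A).gamma y u v) =
      u (Idx.q 1) • (poly A (y (Idx.q 0)) *ᵥ ePart v) := by
  refine dotProduct_eq _ _ fun x ↦ ?_
  have h := (polynomialMetric A).form_gamma y u v (eVec x)
  rw [christoffelFirst_eq, form_polynomialMetric, gamma_q, gamma_q] at h
  simp only [hv, eVec_p, eVec_q, ePart_eVec, uDeriv, zero_smul, mul_zero, add_zero,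
    dotProduct_zero, zero_add, sub_zero, dotProduct_smul, smul_eq_mul] at h
  rw [h, mulVec_dotProduct_of_skew (transpose_poly hA _) x, smul_dotProduct, smul_eq_mul]
  ring

/-- The part of the parallel transports of the polynomial metric that is seen modulo `p₁, p₂`: the
coefficients of `q₁, q₂` do not change, and on the vectors without such coefficients the group with
the Lie algebra `S` acts. -/
theorem transportAlong_ePart (hA : ∀ α, (A α)ᵀ = -A α)
    {S : Submodule ℝ (Matrix (Fin n) (Fin n) ℝ)} (hS : ∀ α, A α ∈ S) {γ : ℝ → Idx n → ℝ}
    (hγ : ContDiff ℝ ∞ γ) {Q : (Idx n → ℝ) →L[ℝ] (Idx n → ℝ)}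
    (hQ : (polynomialMetric A).IsTransportAlong γ Q) :
    (∀ v a, Q v (Idx.q a) = v (Idx.q a)) ∧
      ∃ b ∈ evolutionMonoid S, ∀ v, (∀ a, v (Idx.q a) = 0) → ePart (Q v) = b *ᵥ ePart v := by
  -- The coefficient of the equation of parallel transport modulo `p₁, p₂`.
  let ξ : ℝ → Matrix (Fin n) (Fin n) ℝ := fun t ↦
    -(deriv γ t (Idx.q 1) • poly A (γ t (Idx.q 0)))
  have hγ' : Continuous (deriv γ) := hγ.continuous_deriv (by simp)
  have hγc : Continuous γ := hγ.continuous
  have hξ : Continuous ξ := by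
    have h1 : Continuous fun t ↦ poly A (γ t (Idx.q 0)) :=
      continuous_pi fun i ↦ continuous_pi fun j ↦
        (continuous_poly A i j).comp ((continuous_apply (Idx.q 0 : Idx n)).comp hγc)
    exact (((continuous_apply (Idx.q 1 : Idx n)).comp hγ').smul h1).neg
  have hξS : ∀ t, ξ t ∈ S := fun t ↦ neg_mem (S.smul_mem _ (sum_mem fun α _ ↦ S.smul_mem _ (hS α)))
  have hpar : ∀ V : ℝ → Idx n → ℝ, (∀ t, (polynomialMetric A).IsParallelAt γ V t) →
      ∀ t k, HasDerivAt (fun s ↦ V s k)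
        (-(polynomialMetric A).gamma (γ t) (deriv γ t) (V t) k) t := fun V hV t k ↦ by
    obtain ⟨γ', h1, h2⟩ := isParallelAt_vectorSpace_iff.1 (hV t)
    rw [← h1.deriv] at h2
    exact hasDerivAt_pi.1 h2 k
  have hq : ∀ V : ℝ → Idx n → ℝ, (∀ t, (polynomialMetric A).IsParallelAt γ V t) →
      ∀ t a, V t (Idx.q a) = V 0 (Idx.q a) := fun V hV t a ↦ by
    have h1 : ∀ t, HasDerivAt (fun s ↦ V s (Idx.q a)) 0 t := fun t ↦
      (hpar V hV t _).congr_deriv (by rw [gamma_q, neg_zero])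
    exact is_const_of_deriv_eq_zero (fun t ↦ (h1 t).differentiableAt) (fun t ↦ (h1 t).deriv) t 0
  refine ⟨fun (v : Idx n → ℝ) a ↦ ?_, evol ξ 1, Submonoid.subset_closure ⟨ξ, hξ, hξS, rfl⟩,
    fun v hv ↦ ?_⟩
  · obtain ⟨V, hV, hV0, hV1⟩ := hQ v
    have h1 := hq V hV 1 a
    rw [hV0, hV1] at h1
    exact h1
  · obtain ⟨V, hV, hV0, hV1⟩ := hQ v
    have hVq : ∀ t a, V t (Idx.q a) = 0 := fun t a ↦ by rw [hq V hV, hV0, hv]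
    have hV' : ∀ t i, HasDerivAt (fun s ↦ ePart (V s) i) ((ξ t *ᵥ ePart (V t)) i) t := fun t i ↦ by
      refine (hpar V hV t (Idx.e i)).congr_deriv ?_
      rw [Matrix.neg_mulVec, Matrix.smul_mulVec, ← ePart_gamma hA (γ t) (deriv γ t) (hVq t)]
      rfl
    have hE : ∀ t i j, HasDerivAt (fun s ↦ evolInv ξ s i j) ((-(evolInv ξ t * ξ t)) i j) t :=
      fun t i j ↦ hasDerivAt_linearMap (Matrix.entryLinearMap ℝ ℝ i j) (hasDerivAt_evolInv hξ t)
    -- The vector `U⁻¹ V`, where `U` is the evolution of `ξ`, is constant.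
    have hconst : ∀ i, (evolInv ξ 1 *ᵥ ePart (V 1)) i = (evolInv ξ 0 *ᵥ ePart (V 0)) i := fun i ↦ by
      have h1 : ∀ t, HasDerivAt (fun s ↦ (evolInv ξ s *ᵥ ePart (V s)) i) 0 t := fun t ↦ by
        refine (hasDerivAt_mulVec (hE t) (hV' t) rfl rfl i).congr_deriv ?_
        rw [Matrix.neg_mulVec, Matrix.mulVec_mulVec, neg_add_cancel]
        rfl
      exact is_const_of_deriv_eq_zero (fun t ↦ (h1 t).differentiableAt) (fun t ↦ (h1 t).deriv) 1 0
    have h1 := congrArg (evol ξ 1 *ᵥ ·) (funext hconst)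
    simp only [Matrix.mulVec_mulVec, evol_mul_evolInv hξ, evolInv_zero hξ, Matrix.one_mulVec] at h1
    rw [hV0, hV1] at h1
    exact h1

theorem transport_ePart (hA : ∀ α, (A α)ᵀ = -A α)
    {S : Submodule ℝ (Matrix (Fin n) (Fin n) ℝ)} (hS : ∀ α, A α ∈ S) {x y : Idx n → ℝ}
    {P : (Idx n → ℝ) →L[ℝ] (Idx n → ℝ)} (hP : (polynomialMetric A).IsTransport x y P) :
    (∀ v a, P v (Idx.q a) = v (Idx.q a)) ∧
      ∃ b ∈ evolutionMonoid S, ∀ v, (∀ a, v (Idx.q a) = 0) → ePart (P v) = b *ᵥ ePart v := by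
  induction hP with
  | refl => exact ⟨fun v a ↦ rfl, 1, one_mem _, fun v _ ↦ (Matrix.one_mulVec _).symm⟩
  | step γ hγ P Q hP hQ ih =>
    obtain ⟨h1, b, hb, h2⟩ := ih
    obtain ⟨h3, b', hb', h4⟩ := transportAlong_ePart hA hS (contMDiff_iff_contDiff.1 hγ) hQ
    refine ⟨fun v a ↦ (h3 (P v) a).trans (h1 v a), b' * b, mul_mem hb' hb, fun v hv ↦ ?_⟩
    refine (h4 (P v) fun a ↦ (h1 v a).trans (hv a)).trans ?_
    exact (congrArg (b' *ᵥ ·) (h2 v hv)).trans (Matrix.mulVec_mulVec _ _ _)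

/-- The block at `e₁, …, eₙ` of a linear map. -/
def eBlock (n : ℕ) : ((Idx n → ℝ) →L[ℝ] (Idx n → ℝ)) →ₗ[ℝ] Matrix (Fin n) (Fin n) ℝ where
  toFun T := Matrix.of fun i j ↦ T (eVec (Pi.single j 1)) (Idx.e i)
  map_add' _ _ := rfl
  map_smul' _ _ := rfl

/-- The elements of the holonomy algebra are skew-adjoint, since parallel transports are isometries. -/
theorem skew_entry {Z : (Idx n → ℝ) →L[ℝ] (Idx n → ℝ)}
    (hZ : Z ∈ (polynomialMetric A).holonomyAlgebra 0) (v w : Idx n → ℝ) :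
    (polynomialMetric A).form 0 (Z v) w + (polynomialMetric A).form 0 v (Z w) = 0 := by
  obtain ⟨c, hc, h0, hcP, hcZ⟩ := hZ
  have h1 := hasDerivAt_bilin (hasDerivAt_const (0 : ℝ) ((polynomialMetric A).form 0))
    (hasDerivAt_eval hcZ v) (hasDerivAt_eval hcZ w) rfl (a := v) (b := w) (by rw [h0]; rfl)
    (by rw [h0]; rfl)
  have h2 : (fun t ↦ (polynomialMetric A).form 0 (c t v) (c t w)) = fun _ ↦
      (polynomialMetric A).form 0 v w := funext fun t ↦ IsTransport.val_eq (hcP t) v w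
  rw [h2] at h1
  have h3 := h1.unique (hasDerivAt_const _ _)
  simpa using h3

/-- The elements of the holonomy algebra have their block at `e₁, …, eₙ` in `𝔥`, and their rows at
`q₁, q₂` are zero. -/
theorem eBlock_mem (hA : ∀ α, (A α)ᵀ = -A α)
    {S : Submodule ℝ (Matrix (Fin n) (Fin n) ℝ)} (hS : ∀ α, A α ∈ S) (hskew : ∀ Y ∈ S, Yᵀ = -Y)
    (hlie : ∀ Y ∈ S, ∀ Z ∈ S, Y * Z - Z * Y ∈ S) {Z : (Idx n → ℝ) →L[ℝ] (Idx n → ℝ)}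
    (hZ : Z ∈ (polynomialMetric A).holonomyAlgebra 0) :
    eBlock n Z ∈ S ∧ ∀ v a, Z v (Idx.q a) = 0 := by
  obtain ⟨c, hc, h0, hcP, hcZ⟩ := hZ
  refine ⟨?_, fun v a ↦ ?_⟩
  · refine mem_of_hasDerivAt (c := fun t ↦ eBlock n (c t)) hskew hlie ?_ ?_ (fun t ↦ ?_)
      (hasDerivAt_linearMap (eBlock n) hcZ)
    · exact (LinearMap.toContinuousLinearMap (eBlock n)).continuous.comp hc.continuous
    · ext i j
      rw [h0]
      change (Pi.single j 1 : Fin n → ℝ) i = _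
      rw [Pi.single_apply, Matrix.one_apply]
    · obtain ⟨-, b, hb, h⟩ := transport_ePart hA hS (hcP t)
      have h1 : eBlock n (c t) = b := by
        ext i j
        have h2 := congrFun (h (eVec (Pi.single j 1)) fun a ↦ rfl) i
        rw [ePart_eVec, Matrix.mulVec_single_one] at h2
        exact h2
      rwa [h1]
  · have h1 := hasDerivAt_pi.1 (hasDerivAt_eval hcZ v) (Idx.q a)
    have h2 : (fun t ↦ c t v (Idx.q a)) = fun _ ↦ v (Idx.q a) :=
      funext fun t ↦ (transport_ePart hA hS (hcP t)).1 v a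
    rw [h2] at h1
    exact h1.unique (hasDerivAt_const _ _)

/-- A matrix that is skew-adjoint for `η` and has zero rows at `q₁, q₂` has the shape `gMatrix`. -/
theorem eq_gMatrix {Z : (Idx n → ℝ) →L[ℝ] (Idx n → ℝ)} (hq : ∀ v a, Z v (Idx.q a) = 0)
    (hZ : ∀ v w, (polynomialMetric A).form 0 (Z v) w + (polynomialMetric A).form 0 v (Z w) = 0) :
    LinearMap.toMatrix (Pi.basisFun ℝ (Idx n)) (Pi.basisFun ℝ (Idx n))
        (Z : (Idx n → ℝ) →ₗ[ℝ] (Idx n → ℝ)) =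
      gMatrix (eBlock n Z) (fun i ↦ Z (Pi.single (Idx.q 0) 1) (Idx.e i))
        (fun i ↦ Z (Pi.single (Idx.q 1) 1) (Idx.e i)) (Z (Pi.single (Idx.q 0) 1) (Idx.p 1)) := by
  have h0 : axis 0 = (0 : Idx n → ℝ) := by simp [axis]
  have he (k : Fin n) : (eVec (Pi.single k 1) : Idx n → ℝ) = Pi.single (Idx.e k) 1 := by
    ext (i | i | i) <;> simp [eVec, Pi.single_apply]
  have key (k l : Idx n) : (polynomialMetric A).form (axis 0) (Z (Pi.single k 1)) (Pi.single l 1)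
      + (polynomialMetric A).form (axis 0) (Pi.single k 1) (Z (Pi.single l 1)) = 0 := by
    rw [h0]
    exact hZ _ _
  simp only [form_axis, hq, ePart, dotProduct, mul_zero, zero_mul, add_zero] at key
  -- Skew-adjointness determines the rows at `p₁, p₂` from the other entries.
  have hpp (i j : Fin 2) : Z (Pi.single (Idx.p j) 1) (Idx.p i) = 0 := by
    have h1 := key (Idx.p j) (Idx.q i)
    fin_cases i <;> simpa [Pi.single_apply, hq] using h1
  have hpe (i : Fin 2) (j : Fin n) : Z (Pi.single (Idx.e j) 1) (Idx.p i) =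
      -Z (Pi.single (Idx.q i) 1) (Idx.e j) := by
    have h1 := key (Idx.e j) (Idx.q i)
    refine eq_neg_of_add_eq_zero_left ?_
    fin_cases i <;> simpa [Pi.single_apply, hq] using h1
  have hpq (i j : Fin 2) : Z (Pi.single (Idx.q j) 1) (Idx.p i) =
      -Z (Pi.single (Idx.q i) 1) (Idx.p j) := by
    have h1 := key (Idx.q j) (Idx.q i)
    refine eq_neg_of_add_eq_zero_left ?_
    fin_cases i <;> fin_cases j <;> simpa [Pi.single_apply, hq, add_comm] using h1
  have hep (i : Fin n) (j : Fin 2) : Z (Pi.single (Idx.p j) 1) (Idx.e i) = 0 := by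
    have h1 := key (Idx.p j) (Idx.e i)
    fin_cases j <;> simpa [Pi.single_apply, hq] using h1
  ext i j
  rw [LinearMap.toMatrix_apply]
  simp only [Pi.basisFun_apply, Pi.basisFun_repr]
  change Z (Pi.single j 1) i = _
  obtain i | i | i := i
  · obtain j | j | j := j
    · exact (hpp i j).trans rfl
    · rw [hpe]
      fin_cases i <;> rfl
    · have hdiag (a : Fin 2) : Z (Pi.single (Idx.q a) 1) (Idx.p a) = 0 := by linarith [hpq a a]
      fin_cases i <;> fin_cases j
      · exact hdiag 0
      · exact hpq 0 1
      · rfl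
      · exact hdiag 1
  · obtain j | j | j := j
    · exact (hep i j).trans rfl
    · rw [← he]; rfl
    · fin_cases j <;> rfl
  · rw [hq]
    obtain j | j | j := j <;> rfl

/-- The holonomy algebra of the polynomial metric. -/
theorem holonomyMatrices_eq (hn : 1 ≤ n) (h : LieSubalgebra ℝ (LieAlgebra.Orthogonal.so (Fin n) ℝ))
    (A : Module.Basis (Fin N) ℝ h) :
    (polynomialMetric fun α ↦ (A α).1.1).holonomyMatrices 0 (Pi.basisFun ℝ (Idx n)) =
      gAlgebra h := by
  let l : h.toSubmodule →ₗ[ℝ] Matrix (Fin n) (Fin n) ℝ :=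
    (LieAlgebra.Orthogonal.so (Fin n) ℝ).toSubmodule.subtype ∘ₗ h.toSubmodule.subtype
  have hA : ∀ α, ((A α).1.1)ᵀ = -(A α).1.1 := fun α ↦ so_transpose _
  refine Subset.antisymm ?_ ?_
  · rintro _ ⟨Z, hZ, rfl⟩
    obtain ⟨⟨C, hC⟩, hq⟩ := eBlock_mem (S := LinearMap.range l) hA (fun α ↦ ⟨A α, rfl⟩)
      (by rintro _ ⟨C, rfl⟩; exact so_transpose C.1)
      (by rintro _ ⟨C, rfl⟩ _ ⟨D, rfl⟩; exact ⟨⟨⁅C.1, D.1⁆, h.lie_mem C.2 D.2⟩, rfl⟩) hZ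
    have h1 := eq_gMatrix (A := fun α ↦ (A α).1.1) hq (skew_entry hZ)
    rw [← hC] at h1
    exact ⟨C.1, C.2, _, _, _, h1⟩
  · rintro _ ⟨C, hC, X, Y, c, rfl⟩
    have h1 : C.1 ∈ Submodule.span ℝ (range fun α ↦ (A α).1.1) := by
      have h2 : l ⟨C, hC⟩ ∈ (Submodule.span ℝ (range A)).map l :=
        Submodule.mem_map_of_mem (by rw [A.span_eq]; trivial)
      rw [Submodule.map_span, ← range_comp] at h2
      exact h2
    refine ⟨op (gMatrix C.1 X Y c), gMatrix_mem_holonomyMatrixSubmodule hA hn h1 X Y c, ?_⟩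
    exact (LinearMap.toMatrix'_toLin' (gMatrix C.1 X Y c)).symm

end PolynomialMetric

/-! ### The signature of the polynomial metric -/

namespace PolynomialMetric

open PseudoRiemannianMetric

variable {n N : ℕ} {A : Fin N → Matrix (Fin n) (Fin n) ℝ}

/-- An orthogonal frame at a point where the functions `f`, `uⁱ` have the values `f`, `u`: the
vectors `q'ₐ - pₐ / 2`, `eᵢ` and `q'ₐ + pₐ / 2`, where
`q'₁ = q₁ - (f / 2) p₁` and `q'₂ = q₂ - ∑ uⁱ eᵢ + ((∑ (uⁱ)² - f) / 2) p₂` are isotropic, orthogonal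
to each other and to all `eᵢ`, and dual to `p₁, p₂`. -/
noncomputable def frame (f : ℝ) (u : Fin n → ℝ) : Idx n → Idx n → ℝ :=
  let pq₁ (s : ℝ) : Idx n → ℝ := Sum.elim ![-(f / 2) + s / 2, 0] (Sum.elim 0 ![1, 0])
  let pq₂ (s : ℝ) : Idx n → ℝ :=
    Sum.elim ![0, (u ⬝ᵥ u - f) / 2 + s / 2] (Sum.elim (-u) ![0, 1])
  Sum.elim ![pq₁ (-1), pq₂ (-1)] (Sum.elim (fun i ↦ eVec (Pi.single i 1)) ![pq₁ 1, pq₂ 1])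

theorem form_frame (x : Idx n → ℝ) (k l : Idx n) :
    (polynomialMetric A).form x
        (frame (ePart x ⬝ᵥ ePart x) (poly A (x (Idx.q 0)) *ᵥ ePart x) k)
        (frame (ePart x ⬝ᵥ ePart x) (poly A (x (Idx.q 0)) *ᵥ ePart x) l) =
      if k = l then Sum.elim (fun _ ↦ -1) (fun _ ↦ 1) k else 0 := by
  rw [form_polynomialMetric]
  generalize ePart x ⬝ᵥ ePart x = f
  generalize poly A (x (Idx.q 0)) *ᵥ ePart x = u
  have h1 (a b : Fin 2 → ℝ) (e : Fin n → ℝ) :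
    ePart (Sum.elim a (Sum.elim e b)) = e := rfl
  obtain k | k | k := k <;> obtain l | l | l := l <;> try fin_cases k
  all_goals try fin_cases l
  all_goals simp [frame, h1, Pi.single_apply, eq_comm]
  all_goals ring

theorem hasSignature : (polynomialMetric A).HasSignature 2 (n + 2) := fun (x : Idx n → ℝ) ↦ by
  let F := frame (ePart x ⬝ᵥ ePart x) (poly A (x (Idx.q 0)) *ᵥ ePart x)
  have hF : LinearIndependent ℝ F := Fintype.linearIndependent_iff.2 fun c hc k ↦ by
    have h1 : (polynomialMetric A).form x (∑ l, c l • F l) (F k) = 0 := by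
      rw [hc, map_zero]
      rfl
    simp only [map_sum, map_smul, _root_.sum_apply, _root_.smul_apply, F, form_frame] at h1
    rw [Finset.sum_eq_single k (by simp +contextual) (by simp), if_pos rfl] at h1
    obtain k | k := k <;> simpa using h1
  have hcard : Fintype.card (Idx n) = Module.finrank ℝ (Idx n → ℝ) := by simp
  have : Nonempty (Idx n) := ⟨Idx.p 0⟩
  let e : Idx n ≃ Fin 2 ⊕ Fin (n + 2) := (Equiv.refl _).sumCongr finSumFinEquiv
  let b := (basisOfLinearIndependentOfCardEqFinrank hF hcard).reindex e
  have hb : ∀ i, b i = F (e.symm i) := fun i ↦ by simp [b]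
  refine ⟨b, fun i j ↦ ?_⟩
  change (polynomialMetric A).form x (b i) (b j) = _
  rw [hb, hb, form_frame]
  simp only [e.symm.injective.eq_iff]
  obtain i | i := i <;> rfl

end PolynomialMetric

theorem mainTheorem1 :
    (∀ (n : ℕ), 1 ≤ n →
      ∀ (h : LieSubalgebra ℝ (LieAlgebra.Orthogonal.so (Fin n) ℝ)) (N : ℕ)
        (A : Module.Basis (Fin N) ℝ h),
        (polynomialMetric fun α ↦ (A α).1.1).HasSignature 2 (n + 2) ∧
        (polynomialMetric fun α ↦ (A α).1.1).holonomyMatrices 0 (Pi.basisFun ℝ (Idx n)) =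
          gAlgebra h) ∧
    (∃ (n : ℕ) (h : LieSubalgebra ℝ (LieAlgebra.Orthogonal.so (Fin n) ℝ)), 1 ≤ n ∧
      ∀ (M : Type*) [TopologicalSpace M] [T2Space M] [SecondCountableTopology M] [ConnectedSpace M]
        [ChartedSpace (EuclideanSpace ℝ (Fin n)) M]
        [IsManifold 𝓘(ℝ, EuclideanSpace ℝ (Fin n)) ∞ M]
        (g : PseudoRiemannianMetric (EuclideanSpace ℝ (Fin n)) M), g.IsRiemannian →
        ∀ (p : M) (b : Module.Basis (Fin n) ℝ
            (TangentSpace 𝓘(ℝ, EuclideanSpace ℝ (Fin n)) p)),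
          g.IsOrthonormalBasis p b →
          g.holonomyMatrices p b ≠ {B | ∃ C ∈ h, B = C.1}) := by
  refine ⟨fun n hn h N A ↦ ⟨PolynomialMetric.hasSignature, PolynomialMetric.holonomyMatrices_eq hn h A⟩,
    4, complexStructureLine, by norm_num, ?_⟩
  intro M _ _ _ _ _ _ g _ p b _
  exact g.holonomyMatrices_ne_complexStructureLine p b
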